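/- For $t\in\mathbb C$ let $\lambda=\tfrac14+t^2$ and let $\xi_\lambda$ be the solution of $\xi''(v)+\frac{\lambda}{\cos^2 v}\,\xi(v)=0$ on $(-\pi/2,\pi/2)$ with $\xi(0)=1$, $\xi'(0)=0$. The Huber transform of $f$ is $$d_t(f)=\int_0^{\pi/2} f\Big(\frac1{\cos^2 v}\Big)\frac{\xi_\lambda(v)}{\cos^2 v}\,dv .$$ For $X\ge 2$ and $Y>0$ put $H=Y^2+2XY$, $a=\sqrt{X^2-1}$, $A=\sqrt{(X+Y)^2-1}$ and, for $x\ge 0$, $$f^{+}(x^2+1)=\begin{cases}\frac{2}{\pi H}\,x\big(\sqrt{A^2-x^2}-\sqrt{a^2-x^2}\big), & x\le a,\\ \frac{2}{\pi H}\,x\sqrt{A^2-x^2}, & a\le x\le A,\\ 0,& x>A.\end{cases}$$ Let $$\gamma_1(s)=\frac{\pi}{2}\,\frac{\Gamma(s+\frac12)\,\Gamma(\frac{s+1}2)}{\Gamma(\frac s2)^3}\,\frac{4}{s(2s-1)},\qquad \gamma_2(s)=\frac{\pi}{2}\,\frac{\Gamma(\frac{1-2s}2)\,\Gamma(\frac{2-s}2)}{\Gamma(\frac{1-s}2)^2\,\Gamma(\frac{5-s}2)}\qquad(\gamma_2(1)=0).$$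 Write $s=\tfrac12+it$, let $\delta,c,C>0$, and assume $X\ge2$ and $0<Y\le CX$ throughout. All implied constants depend only on $\delta,c,C$. (i) If $s$ is real with $\tfrac12+\delta\le s\le 1$ and $Y\ge c$, then $$d_t(f^+)=\frac{\gamma_1(s)}{\pi}X^{s}+\frac{\gamma_2(s)}{\pi}\cdot\frac12\Big(\frac52-it\Big)X^{1-s}+O\big(X^{s-1}Y+X^{-s}Y+Y\big).$$ (ii) If $t\in\mathbb R$ and $|t|\ge\delta$, then $d_t(f^+)\ll X^{1/2}\min\{|t|^{-1/2},\,|t|^{-3/2}X/Y\}$. (iii) There are functions $a(t,\rho)$, $b(t,\rho)$ of two real variables, with complex values and independent of $\delta,c,C$, such that, whenever $t\in\mathbb R$, $\delta\le|t|\le X^2/Y^2$ and $Y\ge cX^{1/2}$, $$d_t(f^+)=a(t,X/Y)\,X^{\frac12+it}+b(t,X/Y)\,X^{\frac12-it}+O\big(|t|^{-3/2}\big)$$ and $a(t,X/Y),\,b(t,X/Y)\ll\min\{|t|^{-1/2},\,|t|^{-3/2}X/Y\}$. (iv) $d_0(f^+)\ll X^{1/2}\log X$. -/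

import Mathlib

namespace HuberTransform

/-- `ξ` solves `ξ'' + (lam / cos² v) ξ = 0` on `(-π/2, π/2)` with `ξ 0 = 1` and `ξ' 0 = 0`;
`η` is the derivative of `ξ`. Values outside the interval are irrelevant. -/
def IsSolution (lam : ℂ) (ξ : ℝ → ℂ) : Prop :=
  ξ 0 = 1 ∧ ∃ η : ℝ → ℂ, η 0 = 0 ∧
    ∀ v ∈ Set.Ioo (-(Real.pi / 2)) (Real.pi / 2),
      HasDerivAt ξ (η v) v ∧ HasDerivAt η (-(lam / ((Real.cos v : ℝ) : ℂ) ^ 2) * ξ v) v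

section Existence

lemma hasDerivAt_series (c : ℕ → ℂ)
    (hc : ∀ r : ℝ, 0 ≤ r → r < 1 → Summable fun n => ‖c n‖ * r ^ n) :
    (∀ r : ℝ, 0 ≤ r → r < 1 → Summable fun n : ℕ => ‖((n : ℂ) + 1) * c (n + 1)‖ * r ^ n) ∧
    ∀ z : ℂ, ‖z‖ < 1 →
      HasDerivAt (fun z => ∑' n, c n * z ^ n) (∑' n : ℕ, ((n : ℂ) + 1) * c (n + 1) * z ^ n) z := by
  have key : ∀ r : ℝ, 0 ≤ r → r < 1 →
      Summable fun n : ℕ => ‖c n‖ * ((n : ℝ) * r ^ (n - 1)) := by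
    intro r hr0 hr1
    obtain ⟨ρ, h1, h2⟩ := exists_between hr1
    have hρ : 0 < ρ := lt_of_le_of_lt hr0 h1
    have hb := (hc ρ hρ.le h2).tendsto_atTop_zero.bddAbove_range
    obtain ⟨B, hB⟩ := hb
    have hq : ‖r / ρ‖ < 1 := by
      rw [Real.norm_of_nonneg (by positivity), div_lt_one hρ]; exact h1
    have hs := (summable_pow_mul_geometric_of_norm_lt_one 1 hq)
    have hs' : Summable fun n : ℕ => ((n : ℝ) + 1) * (r / ρ) ^ n := by
      have h0 := summable_geometric_of_norm_lt_one hq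
      refine (hs.add h0).congr fun n => ?_
      simp; ring
    rw [← summable_nat_add_iff 1]
    refine Summable.of_nonneg_of_le (fun n => by positivity) (fun n => ?_)
      (hs'.mul_left (B / ρ))
    have hBn : ‖c (n + 1)‖ * ρ ^ (n + 1) ≤ B := hB ⟨n + 1, rfl⟩
    have h3 : ‖c (n + 1)‖ ≤ B / ρ ^ (n + 1) := by rwa [le_div_iff₀ (by positivity)]
    calc ‖c (n + 1)‖ * (((n + 1 : ℕ) : ℝ) * r ^ (n + 1 - 1))
        ≤ B / ρ ^ (n + 1) * (((n + 1 : ℕ) : ℝ) * r ^ (n + 1 - 1)) := by gcongr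
      _ = B / ρ * (((n : ℝ) + 1) * (r / ρ) ^ n) := by
        simp only [Nat.add_sub_cancel, div_pow, pow_succ]; push_cast; field_simp
  refine ⟨fun r hr0 hr1 => ?_, fun z hz => ?_⟩
  · have := (summable_nat_add_iff 1).2 (key r hr0 hr1)
    refine this.congr fun n => ?_
    have : ‖((n : ℂ) + 1)‖ = (n : ℝ) + 1 := by
      rw [show ((n : ℂ) + 1) = ((n + 1 : ℕ) : ℂ) by push_cast; rfl, Complex.norm_natCast]
      push_cast; rfl
    rw [norm_mul, this]; simp; ring
  · obtain ⟨r, h1, h2⟩ := exists_between hz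
    have hr : 0 < r := lt_of_le_of_lt (norm_nonneg _) h1
    have hd := hasDerivAt_tsum_of_isPreconnected (𝕜 := ℂ) (F := ℂ)
      (g := fun n z => c n * z ^ n) (g' := fun n z => c n * ((n : ℂ) * z ^ (n - 1)))
      (t := Metric.ball 0 r) (y₀ := 0) (y := z) (key r hr.le h2) Metric.isOpen_ball
      (convex_ball _ _).isPreconnected
      (fun n y _ => (hasDerivAt_pow n y).const_mul _)
      (fun n y hy => by
        rw [norm_mul, norm_mul, norm_pow, Complex.norm_natCast]
        have : ‖y‖ ≤ r := by simpa using (Metric.mem_ball.1 hy).le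
        gcongr)
      (by simpa using hr)
      (by
        refine Summable.of_norm ?_
        simpa using hc 0 le_rfl one_pos)
      (by simpa using h1)
    refine hd.congr_deriv ?_
    have hsm : Summable fun n : ℕ => c n * ((n : ℂ) * z ^ (n - 1)) := by
      refine Summable.of_norm ?_
      refine (key ‖z‖ (norm_nonneg _) hz).congr fun n => ?_
      simp
    rw [hsm.tsum_eq_zero_add]
    simp only [Nat.cast_zero, zero_mul, mul_zero, zero_add, Nat.add_sub_cancel]
    refine tsum_congr fun n => ?_
    push_cast; ring

noncomputable def coeff (α : ℂ) : ℕ → ℂ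
  | 0 => 1
  | n + 1 => coeff α n * ((α + n) ^ 2 / (((n : ℂ) + 1 / 2) * ((n : ℂ) + 1)))

lemma coeff_succ (α : ℂ) (n : ℕ) :
    ((n : ℂ) + 1 / 2) * (((n : ℂ) + 1) * coeff α (n + 1)) = (α + n) ^ 2 * coeff α n := by
  have h1 : ((n : ℂ) + 1) ≠ 0 := by exact_mod_cast Nat.succ_ne_zero n
  have h2 : ((n : ℂ) + 1 / 2) ≠ 0 := by
    intro h
    have := congrArg Complex.re h
    simp at this
    have h0 : (0 : ℝ) ≤ n := Nat.cast_nonneg n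
    linarith
  rw [coeff]
  calc _ = (((n : ℂ) + 1 / 2) / ((n : ℂ) + 1 / 2)) * (((n : ℂ) + 1) / ((n : ℂ) + 1)) *
        ((α + n) ^ 2 * coeff α n) := by
        rw [div_mul_div_comm]; simp only [div_eq_mul_inv]; ring
    _ = _ := by rw [div_self h1, div_self h2]; ring

lemma coeff_summable (α : ℂ) (r : ℝ) (hr0 : 0 ≤ r) (hr1 : r < 1) :
    Summable fun n => ‖coeff α n‖ * r ^ n := by
  obtain ⟨q, hq1, hq2⟩ := exists_between hr1
  have hlim : Filter.Tendsto
      (fun n : ℕ => ‖((α + n) ^ 2 / (((n : ℂ) + 1 / 2) * ((n : ℂ) + 1)))‖) Filter.atTop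
      (nhds 1) := by
    have hi : Filter.Tendsto (fun n : ℕ => ((n : ℂ))⁻¹) Filter.atTop (nhds 0) :=
      tendsto_inv_atTop_nhds_zero_nat (𝕜 := ℂ)
    have : Filter.Tendsto (fun n : ℕ => (α * (n : ℂ)⁻¹ + 1) ^ 2 /
        ((1 + 1 / 2 * (n : ℂ)⁻¹) * (1 + (n : ℂ)⁻¹))) Filter.atTop
        (nhds ((α * 0 + 1) ^ 2 / ((1 + 1 / 2 * 0) * (1 + 0)))) := by
      refine Filter.Tendsto.div (((hi.const_mul α).add_const 1).pow 2)
        (((hi.const_mul _).const_add 1).mul (hi.const_add 1)) (by norm_num)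
    have h2 := this.norm
    simp only [mul_zero, zero_add, add_zero, one_pow, mul_one, div_one, norm_one] at h2
    refine h2.congr' ?_
    filter_upwards [Filter.eventually_gt_atTop 0] with n hn
    have : (n : ℂ) ≠ 0 := by exact_mod_cast hn.ne'
    congr 1
    rw [show α * (n : ℂ)⁻¹ + 1 = (α + n) / n by field_simp,
      show (1 + 1 / 2 * (n : ℂ)⁻¹) = ((n : ℂ) + 1 / 2) / n by field_simp,
      show (1 + (n : ℂ)⁻¹) = ((n : ℂ) + 1) / n by field_simp, div_pow, div_mul_div_comm,
      ← sq, div_div_div_cancel_right₀ (pow_ne_zero 2 this)]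
  have hlim' := hlim.mul_const r
  rw [one_mul] at hlim'
  refine summable_of_ratio_norm_eventually_le hq2 ?_
  filter_upwards [hlim'.eventually_lt_const hq1] with n hn
  have h0 : 0 ≤ ‖coeff α n‖ * r ^ n := by positivity
  rw [Real.norm_of_nonneg h0, Real.norm_of_nonneg (by positivity), coeff, norm_mul,
    pow_succ r]
  calc _ = (‖((α + n) ^ 2 / (((n : ℂ) + 1 / 2) * ((n : ℂ) + 1)))‖ * r) *
        (‖coeff α n‖ * r ^ n) := by
          ring
    _ ≤ _ := by gcongr

lemma exists_hypergeometric (α : ℂ) : ∃ F F₁ F₂ : ℂ → ℂ, F 0 = 1 ∧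
    ∀ z : ℂ, ‖z‖ < 1 → HasDerivAt F (F₁ z) z ∧ HasDerivAt F₁ (F₂ z) z ∧
      z * (1 - z) * F₂ z + (1 / 2 - (2 * α + 1) * z) * F₁ z - α ^ 2 * F z = 0 := by
  set c := coeff α with hcdef
  set d : ℕ → ℂ := fun n => ((n : ℂ) + 1) * c (n + 1) with hd
  set e : ℕ → ℂ := fun n => ((n : ℂ) + 1) * d (n + 1) with he
  obtain ⟨hds, hF⟩ := hasDerivAt_series c (coeff_summable α)
  obtain ⟨hes, hF1⟩ := hasDerivAt_series d hds
  refine ⟨fun z => ∑' n, c n * z ^ n, fun z => ∑' n, d n * z ^ n, fun z => ∑' n, e n * z ^ n,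
    ?_, fun z hz => ⟨hF z hz, hF1 z hz, ?_⟩⟩
  · change ∑' n, c n * (0 : ℂ) ^ n = 1
    rw [tsum_eq_single 0 (fun n hn => by rw [zero_pow hn, mul_zero])]; simp [hcdef, coeff]
  have sm : ∀ a : ℕ → ℂ, (∀ r : ℝ, 0 ≤ r → r < 1 → Summable fun n => ‖a n‖ * r ^ n) →
      HasSum (fun n => a n * z ^ n) (∑' n, a n * z ^ n) := fun a ha =>
    (Summable.of_norm ((ha ‖z‖ (norm_nonneg _) hz).congr fun n => by simp)).hasSum
  have hc := sm c (coeff_summable α)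
  have hdd := sm d hds
  have hee := sm e hes
  have hdz : HasSum (fun n : ℕ => (n : ℂ) * c n * z ^ n) (z * ∑' n, d n * z ^ n) := by
    rw [← hasSum_nat_add_iff' 1]
    simpa [hd, pow_succ, mul_assoc, mul_comm, mul_left_comm] using hdd.mul_left z
  have hez : HasSum (fun n : ℕ => (n : ℂ) * d n * z ^ n) (z * ∑' n, e n * z ^ n) := by
    rw [← hasSum_nat_add_iff' 1]
    simpa [he, pow_succ, mul_assoc, mul_comm, mul_left_comm] using hee.mul_left z
  have hezz : HasSum (fun n : ℕ => (n : ℂ) * ((n : ℂ) - 1) * c n * z ^ n)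
      (z * (z * ∑' n, e n * z ^ n)) := by
    rw [← hasSum_nat_add_iff' 1]
    have := hez.mul_left z
    simp only [Finset.range_one, Finset.sum_singleton, Nat.cast_zero, zero_mul, sub_zero]
    refine this.congr_fun fun n => ?_
    simp only [hd]; push_cast; ring
  have tot := (((hez.add (hdd.mul_left (1 / 2))).sub hezz).sub
    (hdz.mul_left (2 * α + 1))).sub (hc.mul_left (α ^ 2))
  have hz0 : (fun n : ℕ => (n : ℂ) * d n * z ^ n + 1 / 2 * (d n * z ^ n) -
      (n : ℂ) * ((n : ℂ) - 1) * c n * z ^ n - (2 * α + 1) * ((n : ℂ) * c n * z ^ n) -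
      α ^ 2 * (c n * z ^ n)) = fun _ => 0 := by
    funext n
    have := coeff_succ α n
    simp only [hd]
    linear_combination z ^ n * this
  rw [hz0] at tot
  have := tot.unique hasSum_zero
  linear_combination this

/-- The initial value problem has a solution for every spectral parameter `t`. -/
theorem exists_isSolution (t : ℂ) : ∃ ξ : ℝ → ℂ, IsSolution (1 / 4 + t ^ 2) ξ := by
  set β : ℂ := 1 / 2 - Complex.I * t with hβ
  have hlam : 1 / 4 + t ^ 2 = β - β ^ 2 := by
    rw [hβ]; linear_combination (t ^ 2) * Complex.I_sq
  obtain ⟨F, F₁, F₂, hF0, hF⟩ := exists_hypergeometric (β / 2)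
  set E : ℝ → ℂ := fun v => Complex.exp (β * ((Real.log (Real.cos v) : ℝ) : ℂ)) with hE
  set S : ℝ → ℂ := fun v => ((Real.sin v : ℝ) : ℂ) with hS
  set C : ℝ → ℂ := fun v => ((Real.cos v : ℝ) : ℂ) with hC
  refine ⟨fun v => E v * F (S v ^ 2), ?_,
    fun v => E v * (-β * (S v / C v) * F (S v ^ 2) + 2 * S v * C v * F₁ (S v ^ 2)), ?_, ?_⟩
  · simp [hE, hS, hF0]
  · simp [hS]
  intro v hv
  have hcos : 0 < Real.cos v := Real.cos_pos_of_mem_Ioo hv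
  have hC0 : C v ≠ 0 := by simpa [hC] using (Complex.ofReal_ne_zero.2 hcos.ne')
  have hsc : S v ^ 2 + C v ^ 2 = 1 := by
    have := Real.sin_sq_add_cos_sq v
    simp only [hS, hC]; exact_mod_cast this
  have hz : ‖S v ^ 2‖ < 1 := by
    have h1 := Real.sin_sq_add_cos_sq v
    have h2 : ‖S v ^ 2‖ = Real.sin v ^ 2 := by
      rw [norm_pow, hS]; simp only [Complex.norm_real, Real.norm_eq_abs, sq_abs]
    rw [h2]; nlinarith [pow_pos hcos 2]
  obtain ⟨d0, d1, ode⟩ := hF _ hz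
  have dS : HasDerivAt S (C v) v := (Real.hasDerivAt_sin v).ofReal_comp
  have dC : HasDerivAt C (-S v) v := by
    have := (Real.hasDerivAt_cos v).ofReal_comp
    simpa [hS, hC] using this
  have dE : HasDerivAt E (E v * (-β * (S v / C v))) v := by
    have h1 : HasDerivAt (fun v => ((Real.log (Real.cos v) : ℝ) : ℂ)) (-(S v / C v)) v := by
      have := ((Real.hasDerivAt_cos v).log hcos.ne').ofReal_comp
      convert this using 1
      simp only [hS, hC]; push_cast; ring
    have := (h1.const_mul β).cexp
    convert this using 1
    simp only [hE]; ring
  have dS2 : HasDerivAt (fun v => S v ^ 2) (2 * S v * C v) v := by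
    exact (dS.fun_pow 2).congr_deriv (by simp)
  have dF : HasDerivAt (fun v => F (S v ^ 2)) (F₁ (S v ^ 2) * (2 * S v * C v)) v :=
    HasDerivAt.comp v d0 dS2
  have dF1 : HasDerivAt (fun v => F₁ (S v ^ 2)) (F₂ (S v ^ 2) * (2 * S v * C v)) v :=
    HasDerivAt.comp v d1 dS2
  refine ⟨?_, ?_⟩
  · exact (dE.fun_mul dF).congr_deriv (by ring)
  · have dT : HasDerivAt (fun v => S v / C v) (1 / C v ^ 2) v := by
      refine (dS.fun_div dC hC0).congr_deriv ?_
      rw [← hsc]; ring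
    have d := dE.fun_mul ((((dT.const_mul (-β)).fun_mul dF)).fun_add
      (((dS.const_mul 2).fun_mul dC).fun_mul dF1))
    refine d.congr_deriv ?_
    rw [hlam]
    have hS2 : S v ^ 2 = 1 - C v ^ 2 := by linear_combination hsc
    change _ = -((β - β ^ 2) / C v ^ 2) * (E v * F (S v ^ 2))
    generalize F (S v ^ 2) = f at *
    generalize F₁ (S v ^ 2) = f1 at *
    generalize F₂ (S v ^ 2) = f2 at *
    rw [hS2] at ode
    field_simp
    rw [hS2]
    linear_combination (4 * C v ^ 2 * E v) * ode

/-- Two solutions agree on `(-π/2, π/2)`. -/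
theorem IsSolution.eqOn {lam : ℂ} {ξ₁ ξ₂ : ℝ → ℂ} (h₁ : IsSolution lam ξ₁)
    (h₂ : IsSolution lam ξ₂) : Set.EqOn ξ₁ ξ₂ (Set.Ioo (-(Real.pi / 2)) (Real.pi / 2)) := by
  obtain ⟨a₁, η₁, b₁, e₁⟩ := h₁
  obtain ⟨a₂, η₂, b₂, e₂⟩ := h₂
  intro v hv
  obtain ⟨b, hb1, hb2⟩ := exists_between (abs_lt.2 hv)
  have hb0 : 0 < b := lt_of_le_of_lt (abs_nonneg v) hb1
  have hcb : 0 < Real.cos b := Real.cos_pos_of_mem_Ioo ⟨by linarith, hb2⟩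
  have hsub : ∀ w ∈ Set.Ioo (-b) b, w ∈ Set.Ioo (-(Real.pi / 2)) (Real.pi / 2) :=
    fun w hw => ⟨by linarith [hw.1], by linarith [hw.2]⟩
  set K : NNReal := ⟨max 1 (‖lam‖ / Real.cos b ^ 2), by positivity⟩ with hK
  have huniq := ODE_solution_unique_of_mem_Ioo (E := ℂ × ℂ) (t₀ := 0) (K := K)
    (v := fun w p => (p.2, -(lam / ((Real.cos w : ℝ) : ℂ) ^ 2) * p.1)) (s := fun _ => Set.univ)
    (f := fun w => (ξ₁ w, η₁ w)) (g := fun w => (ξ₂ w, η₂ w)) (a := -b) (b := b)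
    (fun w hw => by
      have hcw : Real.cos b ≤ Real.cos w := by
        rw [← Real.cos_abs w]
        exact Real.cos_le_cos_of_nonneg_of_le_pi (abs_nonneg w)
          (by linarith [Real.pi_pos]) (abs_lt.2 hw).le
      refine (LipschitzWith.of_dist_le_mul fun p q => ?_).lipschitzOnWith
      rw [dist_eq_norm, dist_eq_norm, Prod.norm_def]
      have hKv : (K : ℝ) = max 1 (‖lam‖ / Real.cos b ^ 2) := rfl
      have hp1 : ‖p.1 - q.1‖ ≤ ‖p - q‖ := norm_fst_le (p - q)
      have hp2 : ‖p.2 - q.2‖ ≤ ‖p - q‖ := norm_snd_le (p - q)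
      refine max_le ?_ ?_
      · calc ‖p.2 - q.2‖ ≤ 1 * ‖p - q‖ := by linarith
          _ ≤ K * ‖p - q‖ := by rw [hKv]; gcongr; exact le_max_left _ _
      · have hn : ‖lam / ((Real.cos w : ℝ) : ℂ) ^ 2‖ ≤ ‖lam‖ / Real.cos b ^ 2 := by
          rw [norm_div, norm_pow, Complex.norm_real, Real.norm_of_nonneg (by linarith)]
          gcongr
        calc ‖-(lam / ((Real.cos w : ℝ) : ℂ) ^ 2) * p.1 -
              -(lam / ((Real.cos w : ℝ) : ℂ) ^ 2) * q.1‖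
            = ‖lam / ((Real.cos w : ℝ) : ℂ) ^ 2‖ * ‖p.1 - q.1‖ := by
              rw [← mul_sub, norm_mul, norm_neg]
          _ ≤ K * ‖p - q‖ := by
              rw [hKv]; gcongr; exact hn.trans (le_max_right _ _))
    ⟨by linarith, hb0⟩
    (fun w hw => ⟨(e₁ w (hsub w hw)).1.prodMk (e₁ w (hsub w hw)).2, Set.mem_univ _⟩)
    (fun w hw => ⟨(e₂ w (hsub w hw)).1.prodMk (e₂ w (hsub w hw)).2, Set.mem_univ _⟩)
    (by simp [a₁, a₂, b₁, b₂])
  exact congrArg Prod.fst (huniq (abs_lt.1 hb1))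

end Existence

/-- The function `ξ_λ` with `λ = 1/4 + t²`: the solution of the initial value problem. -/
noncomputable def xi (t : ℂ) : ℝ → ℂ := Classical.choose (exists_isSolution t)

theorem xi_isSolution (t : ℂ) : IsSolution (1 / 4 + t ^ 2) (xi t) :=
  Classical.choose_spec (exists_isSolution t)

/-- The Huber transform `d_t(f) = ∫_0^{π/2} f(1/cos² v) ξ_λ(v) / cos² v dv`, `λ = 1/4 + t²`. -/
noncomputable def huber (t : ℂ) (f : ℝ → ℝ) : ℂ :=
  ∫ v in (0 : ℝ)..(Real.pi / 2),
    ((f (1 / Real.cos v ^ 2) : ℝ) : ℂ) * xi t v / ((Real.cos v : ℝ) : ℂ) ^ 2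

/-- The test function `f⁺` on `[1, ∞)`, written in the variable `u = x² + 1`, that is
`x = √(u - 1)`, with `H = Y² + 2YX`, `a = √(X² - 1)` and `A = √((X + Y)² - 1)`. -/
noncomputable def fPlus (X Y u : ℝ) : ℝ :=
  let H := Y ^ 2 + 2 * Y * X
  let a := √(X ^ 2 - 1)
  let A := √((X + Y) ^ 2 - 1)
  let x := √(u - 1)
  if x ≤ a then 2 / (Real.pi * H) * x * (√(A ^ 2 - x ^ 2) - √(a ^ 2 - x ^ 2))
  else if x ≤ A then 2 / (Real.pi * H) * x * √(A ^ 2 - x ^ 2)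
  else 0

/-- The factor `γ₁(s)`. -/
noncomputable def gamma₁ (s : ℂ) : ℂ :=
  Real.pi / 2 * (Complex.Gamma (s + 1 / 2) * Complex.Gamma ((s + 1) / 2) /
    Complex.Gamma (s / 2) ^ 3) * (4 / (s * (2 * s - 1)))

/-- The factor `γ₂(s)`. At `s = 1` the pole of `Γ((1 - s)/2)` in the denominator makes it `0`,
which is also the value that Lean computes there (`Complex.Gamma 0 = 0` and division by zero). -/
noncomputable def gamma₂ (s : ℂ) : ℂ :=
  Real.pi / 2 * (Complex.Gamma ((1 - 2 * s) / 2) * Complex.Gamma ((2 - s) / 2) /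
    (Complex.Gamma ((1 - s) / 2) ^ 2 * Complex.Gamma ((5 - s) / 2)))

end HuberTransform

/-!
In the variable `x = tan v` the Huber equation becomes the Legendre-type equation
`((1 + x²) φ')' + l φ = 0` on the whole line, `l = 1/4 + t²`. As `√` of a negative number is `0`, the
three cases in the definition of `f⁺` are one formula, and `d_t(f⁺) = 2 / (π H) (G(A) - G(a))` with
`G(r) = ∫_0^r x √(r² - x²) φ(x) dx` (`huber_fPlus`). So everything follows from the behaviour of `G`
and of its derivative. Write `G(r) = r³ J(r)`, where `J(r) = ∫_0^{π/2} sin θ cos² θ φ(r sin θ) dθ`.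

For real `t` no explicit formula for `φ` is needed. The average `J` satisfies a second-order
equation with a constant inhomogeneity (`IsLegendre.hasDerivAt_avgDeriv`), and with `r = sinh u`
its Liouville normal form is `W'' + (t² + Q) W = -N`, where `Q = O(sinh⁻² u)` and `N` is explicit
(`IsLegendre.hasDerivAt_liouvilleDeriv`). Adding `N / t²` to `W` removes the inhomogeneity to
leading order. The energy `W₁'² + t² W₁²` of `W₁ = W + N / t²` is controlled at `u ≍ 1 / |t|` by
the trivial bounds `|φ| ≤ 1` and `φ'² ≤ l`, and it cannot grow much afterwards, because the
integral of `Q / |t|` from there on is bounded. This gives `W₁ ≪ |t|^{-3/2}` and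
`W₁' ≪ |t|^{-1/2}` (`exists_reduced_bound`), and with them the upper bound: the two terms of the
minimum come from the mean value theorem and from the triangle inequality. For `u ≥ 1` the
amplitude `e^{-itu} (W₁' + i t W₁)` converges exponentially fast. Its limit depends only on `t`, and
it determines the oscillating main terms (`exists_primitive_sub_oscTerm_bound`). At `t = 0` the
energy `(W - u W')² + W'²` shows that `W` grows at most linearly in `u`, that is, logarithmically
in `X` (`exists_liouville_zero_bound`).

For `1/2 < s < 1` the functions `Ψ_s(u) = ∫_0^∞ (sinh u + cosh u cosh θ)^{-s} dθ` and `Ψ_{1-s}` solve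
the equation for `l = s (1 - s)` (`hasDerivAt_decayingDeriv`). Their values at `0` and at infinity
are Beta integrals, so matching the initial conditions shows that `φ(x)` is
`c₁ x^{s-1} + c₂ x^{-s}` up to `O(1 / x)`, with explicit Gamma quotients
(`exists_isLegendre_asymptotics`). At `s = 1` the solution is constant. In `d_t(f⁺)` each of the
powers integrates to a Beta integral times a difference quotient of a power of `√(X² - 1)`
(`abs_rpow_quotient_sub_le`), and the error `O(1 / x)` contributes `O(1)`
(`abs_integral_kernel_sub_le`), which is `O(Y)` as `Y` is bounded below.
-/

namespace HuberTransform

open Real Set Filter Topology MeasureTheory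

/-! ### The Huber equation in the variable `x = tan v` -/

/-- `φ` is the even solution, normalised by `φ 0 = 1`, of the Legendre-type equation
`((1 + x²) φ')' + l φ = 0` on the whole real line, and `φ'` is its derivative. This is the Huber
equation with eigenvalue `l` after the substitution `x = tan v`. -/
structure IsLegendre (l : ℝ) (φ φ' : ℝ → ℝ) : Prop where
  zero : φ 0 = 1
  deriv_zero : φ' 0 = 0
  hasDerivAt : ∀ x, HasDerivAt φ (φ' x) x
  hasDerivAt_deriv : ∀ x, HasDerivAt φ' (-(2 * x * φ' x + l * φ x) / (1 + x ^ 2)) x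

lemma one_div_cos_sq {v : ℝ} (hv : cos v ≠ 0) : 1 / cos v ^ 2 = 1 + tan v ^ 2 := by
  rw [← inv_one_add_tan_sq hv]; simp

lemma IsLegendre.isSolution {l : ℝ} {φ φ' : ℝ → ℝ} (h : IsLegendre l φ φ') :
    IsSolution l (fun v => (φ (tan v) : ℂ)) := by
  refine ⟨by simp [h.zero], fun v => ((φ' (tan v) * (1 + tan v ^ 2) : ℝ) : ℂ),
    by simp [h.deriv_zero], fun v hv => ?_⟩
  have hc : cos v ≠ 0 := (cos_pos_of_mem_Ioo hv).ne'
  have hc2 := one_div_cos_sq hc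
  have dt : HasDerivAt tan (1 + tan v ^ 2) v := (hasDerivAt_tan hc).congr_deriv hc2
  refine ⟨((h.hasDerivAt _).comp v dt).ofReal_comp, ?_⟩
  have d := (((h.hasDerivAt_deriv _).comp v dt).mul ((dt.fun_pow 2).const_add 1)).ofReal_comp
  refine d.congr_deriv ?_
  have : (l : ℂ) / ((cos v : ℝ) : ℂ) ^ 2 = ((l * (1 + tan v ^ 2) : ℝ) : ℂ) := by
    rw [← hc2]; push_cast; ring
  rw [this, ← Complex.ofReal_neg, ← Complex.ofReal_mul]
  congr 1
  have : (1 + tan v ^ 2) ≠ 0 := by positivity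
  simp only [Function.comp]
  field_simp
  push_cast
  ring

lemma IsLegendre.xi_eq {l : ℝ} {φ φ' : ℝ → ℝ} (h : IsLegendre l φ φ') {t : ℂ}
    (ht : 1 / 4 + t ^ 2 = (l : ℂ)) {v : ℝ} (hv : v ∈ Ioo (-(π / 2)) (π / 2)) :
    xi t v = (φ (tan v) : ℂ) := by
  have h1 := xi_isSolution t
  rw [ht] at h1
  exact h1.eqOn h.isSolution hv

lemma exists_isLegendre (t : ℝ) : ∃ φ φ' : ℝ → ℝ, IsLegendre (1 / 4 + t ^ 2) φ φ' := by
  obtain ⟨h0, η, hη, h⟩ := xi_isSolution t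
  have hre : ∀ {f : ℝ → ℂ} {f' : ℂ} {x : ℝ}, HasDerivAt f f' x →
      HasDerivAt (fun x => (f x).re) f'.re x := fun hf =>
    (Complex.reCLM.hasFDerivAt.comp_hasDerivAt _ hf)
  have d0 : ∀ x : ℝ, HasDerivAt (fun x => (xi t (arctan x)).re)
      ((η (arctan x)).re / (1 + x ^ 2)) x := fun x => by
    have := (hre (h _ (arctan_mem_Ioo x)).1).comp x (hasDerivAt_arctan x)
    exact this.congr_deriv (by ring)
  have d1 : ∀ x : ℝ, HasDerivAt (fun x => (η (arctan x)).re)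
      (-((1 / 4 + t ^ 2) * (xi t (arctan x)).re)) x := fun x => by
    have := (hre (h _ (arctan_mem_Ioo x)).2).comp x (hasDerivAt_arctan x)
    refine this.congr_deriv ?_
    have e : (1 / 4 + (t : ℂ) ^ 2) / ((cos (arctan x) : ℝ) : ℂ) ^ 2 =
        (((1 / 4 + t ^ 2) * (1 + x ^ 2) : ℝ) : ℂ) := by
      rw [← Complex.ofReal_pow (cos _), cos_sq_arctan]; push_cast; simp
    rw [e, ← Complex.ofReal_neg, Complex.re_ofReal_mul]
    have : 1 + x ^ 2 ≠ 0 := by positivity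
    field_simp
  refine ⟨fun x => (xi t (arctan x)).re, fun x => (η (arctan x)).re / (1 + x ^ 2),
    by simp [h0], by simp [hη], d0, fun x => ?_⟩
  have hx : 1 + x ^ 2 ≠ 0 := by positivity
  refine ((d1 x).fun_div (((hasDerivAt_id' x).fun_pow 2).const_add 1) hx).congr_deriv ?_
  field_simp
  push_cast
  ring

lemma IsLegendre.continuous {l : ℝ} {φ φ' : ℝ → ℝ} (h : IsLegendre l φ φ') : Continuous φ :=
  continuous_iff_continuousAt.2 fun x => (h.hasDerivAt x).continuousAt

lemma IsLegendre.continuous_deriv {l : ℝ} {φ φ' : ℝ → ℝ} (h : IsLegendre l φ φ') :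
    Continuous φ' :=
  continuous_iff_continuousAt.2 fun x => (h.hasDerivAt_deriv x).continuousAt

/-! ### The Huber transform as a difference quotient -/

/-- The weighted average `J(r) = ∫_0^{π/2} sin θ cos² θ φ(r sin θ) dθ`. -/
noncomputable def avg (φ : ℝ → ℝ) (r : ℝ) : ℝ :=
  ∫ θ in (0 : ℝ)..(π / 2), sin θ * cos θ ^ 2 * φ (r * sin θ)

/-- `√(r² - tan² v) ψ(tan v) / cos² v`, which vanishes for `tan v ≥ r` because the square root
of a negative number is `0`. -/
noncomputable def kernel (ψ : ℝ → ℝ) (r v : ℝ) : ℝ :=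
  √(r ^ 2 - tan v ^ 2) * ψ (tan v) / cos v ^ 2

lemma continuousOn_kernel {ψ : ℝ → ℝ} (hψ : Continuous ψ) (r : ℝ) :
    ContinuousOn (kernel ψ r) (Ioo (-(π / 2)) (π / 2)) := by
  have ht : ContinuousOn tan (Ioo (-(π / 2)) (π / 2)) := continuousOn_tan_Ioo
  refine ContinuousOn.div ?_ (continuous_cos.continuousOn.pow 2)
    fun v hv => pow_ne_zero 2 (cos_pos_of_mem_Ioo hv).ne'
  exact (Real.continuous_sqrt.comp_continuousOn
    (continuousOn_const.sub (ht.pow 2))).mul (hψ.comp_continuousOn ht)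

lemma kernel_eq_zero {ψ : ℝ → ℝ} {r v : ℝ} (hr : 0 ≤ r) (hv : v ∈ Ioo (arctan r) (π / 2)) :
    kernel ψ r v = 0 := by
  have h0 : -(π / 2) < v := (neg_pi_div_two_lt_arctan r).trans hv.1
  have : r < tan v := by
    rw [← arctan_lt_arctan_iff, arctan_tan h0 hv.2]; exact hv.1
  rw [kernel, sqrt_eq_zero_of_nonpos (by nlinarith)]; simp

lemma kernel_intervalIntegrable_pieces {ψ : ℝ → ℝ} (hψ : Continuous ψ) {r : ℝ} (hr : 0 ≤ r) :
    IntervalIntegrable (kernel ψ r) volume 0 (arctan r) ∧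
      IntervalIntegrable (kernel ψ r) volume (arctan r) (π / 2) := by
  have h1 : 0 ≤ arctan r := arctan_nonneg.2 hr
  have h2 := arctan_lt_pi_div_two r
  refine ⟨ContinuousOn.intervalIntegrable ((continuousOn_kernel hψ r).mono ?_), ?_⟩
  · rw [uIcc_of_le h1]
    exact fun v hv => ⟨by linarith [hv.1, pi_pos], by linarith [hv.2]⟩
  · rw [intervalIntegrable_iff_integrableOn_Ioo_of_le h2.le]
    exact integrableOn_zero.congr_fun (fun v hv => (kernel_eq_zero hr hv).symm) measurableSet_Ioo

lemma kernel_intervalIntegrable {ψ : ℝ → ℝ} (hψ : Continuous ψ) {r : ℝ} (hr : 0 ≤ r) :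
    IntervalIntegrable (kernel ψ r) volume 0 (π / 2) :=
  (kernel_intervalIntegrable_pieces hψ hr).1.trans (kernel_intervalIntegrable_pieces hψ hr).2

lemma integral_kernel {ψ : ℝ → ℝ} (hψ : Continuous ψ) {r : ℝ} (hr : 0 ≤ r) :
    ∫ v in (0 : ℝ)..(π / 2), kernel ψ r v =
      r ^ 2 * ∫ θ in (0 : ℝ)..(π / 2), cos θ ^ 2 * ψ (r * sin θ) := by
  have h1 : 0 ≤ arctan r := arctan_nonneg.2 hr
  have h2 := arctan_lt_pi_div_two r
  obtain ⟨i1, i2⟩ := kernel_intervalIntegrable_pieces hψ hr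
  rw [← intervalIntegral.integral_add_adjacent_intervals i1 i2,
    intervalIntegral.integral_congr_Ioo_of_le (g := fun _ => 0) h2.le
      (fun v hv => kernel_eq_zero hr hv)]
  -- substitute `tan v = r sin θ`
  have hsub := intervalIntegral.integral_comp_mul_deriv' (a := 0) (b := π / 2)
    (f := fun θ => arctan (r * sin θ)) (f' := fun θ => r * cos θ / (1 + (r * sin θ) ^ 2))
    (g := kernel ψ r)
    (fun θ _ => by
      refine ((hasDerivAt_arctan _).comp θ ((hasDerivAt_sin θ).const_mul r)).congr_deriv ?_
      ring)
    (Continuous.continuousOn (by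
      refine Continuous.div (by fun_prop) (by fun_prop) fun θ => by positivity))
    ((continuousOn_kernel hψ r).mono (by rintro _ ⟨θ, _, rfl⟩; exact arctan_mem_Ioo _))
  simp only [sin_zero, mul_zero, arctan_zero, sin_pi_div_two, mul_one] at hsub
  rw [← hsub, intervalIntegral.integral_zero, add_zero, ← intervalIntegral.integral_const_mul]
  refine intervalIntegral.integral_congr fun θ hθ => ?_
  rw [uIcc_of_le (by positivity)] at hθ
  have hc : 0 ≤ cos θ := cos_nonneg_of_mem_Icc ⟨by linarith [hθ.1, pi_pos], hθ.2⟩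
  have hs : √(r ^ 2 - (r * sin θ) ^ 2) = r * cos θ := by
    rw [← sqrt_sq (mul_nonneg hr hc)]
    congr 1
    linear_combination r ^ 2 * (sin_sq_add_cos_sq θ).symm
  simp only [Function.comp, kernel, tan_arctan, hs, cos_sq_arctan]
  have : 1 + (r * sin θ) ^ 2 ≠ 0 := by positivity
  field_simp

lemma integral_kernel_id_mul {φ : ℝ → ℝ} (hφ : Continuous φ) {r : ℝ} (hr : 0 ≤ r) :
    ∫ v in (0 : ℝ)..(π / 2), kernel (fun x => x * φ x) r v = r ^ 3 * avg φ r := by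
  rw [integral_kernel (by fun_prop) hr, avg, ← intervalIntegral.integral_const_mul,
    ← intervalIntegral.integral_const_mul]
  congr 1 with θ
  ring

/-- All three cases in the definition of `fPlus` are the same formula, as the square root of a
negative number is `0`. -/
lemma fPlus_one_add_sq {X Y x : ℝ} (hX : 1 ≤ X) (hY : 0 < Y) (hx : 0 ≤ x) :
    fPlus X Y (1 + x ^ 2) = 2 / (π * (Y ^ 2 + 2 * Y * X)) *
      (x * √(√((X + Y) ^ 2 - 1) ^ 2 - x ^ 2) - x * √(√(X ^ 2 - 1) ^ 2 - x ^ 2)) := by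
  have hx' : √(1 + x ^ 2 - 1) = x := by rw [add_sub_cancel_left, sqrt_sq hx]
  have hle : √(X ^ 2 - 1) ≤ √((X + Y) ^ 2 - 1) := sqrt_le_sqrt (by nlinarith)
  simp only [fPlus, hx']
  split_ifs with h1 h2
  · ring
  · rw [sqrt_eq_zero_of_nonpos (x := √(X ^ 2 - 1) ^ 2 - x ^ 2)
      (by nlinarith [sqrt_nonneg (X ^ 2 - 1)])]
    ring
  · rw [sqrt_eq_zero_of_nonpos (x := √(X ^ 2 - 1) ^ 2 - x ^ 2)
      (by nlinarith [sqrt_nonneg (X ^ 2 - 1)]),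
      sqrt_eq_zero_of_nonpos (x := √((X + Y) ^ 2 - 1) ^ 2 - x ^ 2)
      (by nlinarith [sqrt_nonneg ((X + Y) ^ 2 - 1)])]
    ring

/-- The function `G(r) = ∫_0^r x √(r² - x²) φ(x) dx = r³ J(r)` at `r = √(X² - 1)`. -/
noncomputable def primitive (φ : ℝ → ℝ) (X : ℝ) : ℝ :=
  √(X ^ 2 - 1) ^ 3 * avg φ √(X ^ 2 - 1)

/-- The Huber transform of `f⁺` is a difference quotient of `primitive φ`, in the variable `X²`. -/
theorem huber_fPlus {l : ℝ} {φ φ' : ℝ → ℝ} (h : IsLegendre l φ φ') {t : ℂ}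
    (ht : 1 / 4 + t ^ 2 = (l : ℂ)) {X Y : ℝ} (hX : 1 ≤ X) (hY : 0 < Y) :
    huber t (fPlus X Y) = ((2 / (π * (Y ^ 2 + 2 * Y * X)) *
      (primitive φ (X + Y) - primitive φ X) : ℝ) : ℂ) := by
  have hφ := h.continuous
  have hA : 0 ≤ √((X + Y) ^ 2 - 1) := sqrt_nonneg _
  have ha : 0 ≤ √(X ^ 2 - 1) := sqrt_nonneg _
  have hψ : Continuous fun x => x * φ x := by fun_prop
  rw [primitive, primitive, ← integral_kernel_id_mul hφ hA, ← integral_kernel_id_mul hφ ha,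
    ← intervalIntegral.integral_sub (kernel_intervalIntegrable hψ hA)
      (kernel_intervalIntegrable hψ ha),
    ← intervalIntegral.integral_const_mul, ← intervalIntegral.integral_ofReal, huber]
  refine intervalIntegral.integral_congr_Ioo_of_le (by positivity) fun v hv => ?_
  have hv' : v ∈ Ioo (-(π / 2)) (π / 2) := ⟨by linarith [hv.1, pi_pos], hv.2⟩
  have hc := (cos_pos_of_mem_Ioo hv').ne'
  rw [h.xi_eq ht hv', one_div_cos_sq hc,
    fPlus_one_add_sq hX hY (tan_nonneg_of_nonneg_of_le_pi_div_two hv.1.le hv.2.le)]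
  simp only [kernel]
  push_cast
  ring

/-! ### The differential equation of the average -/

section Average

variable {l : ℝ} {φ φ' : ℝ → ℝ}

/-- For `l > 0` the energy `l φ² + (1 + x²) φ'²` decreases on `[0, ∞)`, from the value `l`. -/
lemma IsLegendre.energy_le (h : IsLegendre l φ φ') {x : ℝ} (hx : 0 ≤ x) :
    l * φ x ^ 2 + (1 + x ^ 2) * φ' x ^ 2 ≤ l := by
  have hd : ∀ y, HasDerivAt (fun y => l * φ y ^ 2 + (1 + y ^ 2) * φ' y ^ 2)
      (-(2 * y * φ' y ^ 2)) y := fun y => by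
    refine ((((h.hasDerivAt y).fun_pow 2).const_mul l).fun_add
      ((((hasDerivAt_id' y).fun_pow 2).const_add 1).fun_mul
        ((h.hasDerivAt_deriv y).fun_pow 2))).congr_deriv ?_
    have : 1 + y ^ 2 ≠ 0 := by positivity
    push_cast
    field_simp
    ring
  have := antitoneOn_of_deriv_nonpos (convex_Ici (0 : ℝ))
    (fun y _ => (hd y).continuousAt.continuousWithinAt)
    (fun y _ => (hd y).differentiableAt.differentiableWithinAt)
    (fun y hy => by
      rw [interior_Ici] at hy
      have hy : 0 < y := hy
      rw [(hd y).deriv]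
      have : 0 ≤ 2 * y * φ' y ^ 2 := by positivity
      linarith)
  simpa [h.zero, h.deriv_zero] using this (mem_Ici.2 le_rfl) (mem_Ici.2 hx) hx

lemma IsLegendre.abs_le_one (h : IsLegendre l φ φ') (hl : 0 < l) {x : ℝ} (hx : 0 ≤ x) :
    |φ x| ≤ 1 := by
  have h1 := h.energy_le hx
  have h2 : 0 ≤ (1 + x ^ 2) * φ' x ^ 2 := by positivity
  rw [← sq_le_one_iff_abs_le_one]
  exact le_of_mul_le_mul_left (by linarith) hl

lemma IsLegendre.deriv_sq_le (h : IsLegendre l φ φ') (hl : 0 < l) {x : ℝ} (hx : 0 ≤ x) :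
    φ' x ^ 2 ≤ l := by
  have h1 := h.energy_le hx
  have h2 : 0 ≤ l * φ x ^ 2 := by positivity
  nlinarith [sq_nonneg (x * φ' x)]

lemma hasDerivAt_integral_comp_mul_sin {w g g' : ℝ → ℝ} (hw : Continuous w)
    (hg : ∀ x, HasDerivAt g (g' x) x) (hg' : Continuous g') (r : ℝ) :
    HasDerivAt (fun r => ∫ θ in (0 : ℝ)..(π / 2), w θ * g (r * sin θ))
      (∫ θ in (0 : ℝ)..(π / 2), w θ * sin θ * g' (r * sin θ)) r := by
  have hgc : Continuous g := continuous_iff_continuousAt.2 fun x => (hg x).continuousAt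
  have hcont : Continuous fun p : ℝ × ℝ => w p.2 * sin p.2 * g' (p.1 * sin p.2) := by fun_prop
  obtain ⟨B, hB⟩ := ((isCompact_closedBall r 1).prod
    (isCompact_Icc (a := (0 : ℝ)) (b := π / 2))).exists_bound_of_continuousOn hcont.continuousOn
  refine (intervalIntegral.hasDerivAt_integral_of_dominated_loc_of_deriv_le
    (F := fun r θ => w θ * g (r * sin θ)) (F' := fun r θ => w θ * sin θ * g' (r * sin θ))
    (bound := fun _ => B) (Metric.closedBall_mem_nhds r one_pos) ?_ ?_ ?_ ?_ ?_ ?_).2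
  · exact Eventually.of_forall fun x => Continuous.aestronglyMeasurable (by fun_prop)
  · exact Continuous.intervalIntegrable (by fun_prop) _ _
  · exact Continuous.aestronglyMeasurable (by fun_prop)
  · refine Eventually.of_forall fun θ hθ x hx => hB (x, θ) ⟨hx, ?_⟩
    rw [uIoc_of_le (by positivity)] at hθ
    exact ⟨hθ.1.le, hθ.2⟩
  · exact intervalIntegrable_const
  · refine Eventually.of_forall fun θ _ x _ => ?_
    have := ((hg (x * sin θ)).comp x ((hasDerivAt_id' x).mul_const (sin θ))).const_mul (w θ)
    exact this.congr_deriv (by ring)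

/-- The derivative of `avg φ`, in terms of the derivative `φ'` of `φ`. -/
noncomputable def avgDeriv (φ' : ℝ → ℝ) (r : ℝ) : ℝ :=
  ∫ θ in (0 : ℝ)..(π / 2), sin θ * cos θ ^ 2 * sin θ * φ' (r * sin θ)

lemma IsLegendre.hasDerivAt_avg (h : IsLegendre l φ φ') (r : ℝ) :
    HasDerivAt (avg φ) (avgDeriv φ' r) r :=
  hasDerivAt_integral_comp_mul_sin (by fun_prop) h.hasDerivAt h.continuous_deriv r

/-- The equation satisfied by the average `J`. Modulo the equation for `φ`, it is the integral of
`d/dθ (cos³ θ φ(r sin θ) - r sin θ cos³ θ φ'(r sin θ))`, which leaves the boundary value `-1`. -/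
lemma IsLegendre.hasDerivAt_avgDeriv (h : IsLegendre l φ φ') {r : ℝ} (hr : r ≠ 0) :
    HasDerivAt (avgDeriv φ') (-(1 + (3 * r + 2 * r ^ 3) * avgDeriv φ' r +
      (l * r ^ 2 - 3) * avg φ r) / ((1 + r ^ 2) * r ^ 2)) r := by
  set φ₂ : ℝ → ℝ := fun x => -(2 * x * φ' x + l * φ x) / (1 + x ^ 2) with hφ₂
  have c0 := h.continuous
  have c1 := h.continuous_deriv
  have c2 : Continuous φ₂ := by
    refine Continuous.div (by fun_prop) (by fun_prop) fun x => by positivity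
  refine (hasDerivAt_integral_comp_mul_sin (by fun_prop) h.hasDerivAt_deriv c2 r).congr_deriv ?_
  rw [eq_div_iff (by positivity), eq_neg_iff_add_eq_zero]
  have hF : ∀ θ ∈ uIcc 0 (π / 2), HasDerivAt
      (fun θ => cos θ ^ 3 * φ (r * sin θ) - r * (sin θ * cos θ ^ 3 * φ' (r * sin θ)))
      ((1 + r ^ 2) * r ^ 2 * (sin θ * cos θ ^ 2 * sin θ * sin θ * φ₂ (r * sin θ)) +
        (3 * r + 2 * r ^ 3) * (sin θ * cos θ ^ 2 * sin θ * φ' (r * sin θ)) +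
        (l * r ^ 2 - 3) * (sin θ * cos θ ^ 2 * φ (r * sin θ))) θ := fun θ _ => by
    have ds := (hasDerivAt_sin θ).const_mul r
    have d0 := (h.hasDerivAt (r * sin θ)).comp θ ds
    have d1 := (h.hasDerivAt_deriv (r * sin θ)).comp θ ds
    have dc := (hasDerivAt_cos θ).fun_pow 3
    refine ((dc.fun_mul d0).fun_sub
      ((((hasDerivAt_sin θ).fun_mul dc).fun_mul d1).const_mul r)).congr_deriv ?_
    have hode : (1 + (r * sin θ) ^ 2) * φ₂ (r * sin θ) +
        2 * (r * sin θ) * φ' (r * sin θ) + l * φ (r * sin θ) = 0 := by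
      simp only [hφ₂]
      have : 1 + (r * sin θ) ^ 2 ≠ 0 := by positivity
      field_simp
      ring
    change 3 * cos θ ^ 2 * -sin θ * φ (r * sin θ) + cos θ ^ 3 * (φ' (r * sin θ) * (r * cos θ)) -
      r * ((cos θ * cos θ ^ 3 + sin θ * (3 * cos θ ^ 2 * -sin θ)) * φ' (r * sin θ) +
        sin θ * cos θ ^ 3 * (φ₂ (r * sin θ) * (r * cos θ))) = _
    have hc : cos θ ^ 2 = 1 - sin θ ^ 2 := by linear_combination sin_sq_add_cos_sq θ
    linear_combination (-r ^ 2 * sin θ * cos θ ^ 2) * hode -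
      r ^ 2 * sin θ * cos θ ^ 2 * φ₂ (r * sin θ) * hc
  have hint := intervalIntegral.integral_eq_sub_of_hasDerivAt hF
    (Continuous.intervalIntegrable (by fun_prop) _ _)
  rw [intervalIntegral.integral_add, intervalIntegral.integral_add,
    intervalIntegral.integral_const_mul, intervalIntegral.integral_const_mul,
    intervalIntegral.integral_const_mul] at hint
  · simp only [cos_pi_div_two, sin_zero, cos_zero, mul_zero, h.zero] at hint
    simp only [avg, avgDeriv]
    linear_combination hint
  all_goals exact Continuous.intervalIntegrable (by fun_prop) _ _

lemma abs_integral_zero_pi_div_two_le {f : ℝ → ℝ} {B : ℝ}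
    (hf : ∀ θ ∈ Icc 0 (π / 2), |f θ| ≤ B) : |∫ θ in (0 : ℝ)..(π / 2), f θ| ≤ 2 * B := by
  have hB : 0 ≤ B := (abs_nonneg _).trans (hf 0 ⟨le_rfl, by positivity⟩)
  have := intervalIntegral.norm_integral_le_of_norm_le_const (a := (0 : ℝ)) (b := π / 2) (C := B)
    (f := f) fun θ hθ => hf θ (by
      rw [uIoc_of_le (by positivity)] at hθ
      exact ⟨hθ.1.le, hθ.2⟩)
  rw [sub_zero, abs_of_pos (by positivity), norm_eq_abs] at this
  nlinarith [pi_le_four]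

lemma IsLegendre.abs_avg_le (h : IsLegendre l φ φ') (hl : 0 < l) {r : ℝ} (hr : 0 ≤ r) :
    |avg φ r| ≤ 2 := by
  have := abs_integral_zero_pi_div_two_le (f := fun θ => sin θ * cos θ ^ 2 * φ (r * sin θ))
    (B := 1) fun θ hθ => by
      have hs := sin_nonneg_of_nonneg_of_le_pi hθ.1 (by linarith [hθ.2, pi_pos])
      have h1 := h.abs_le_one hl (mul_nonneg hr hs)
      rw [abs_mul, abs_mul, abs_pow]
      exact mul_le_one₀ (mul_le_one₀ (abs_sin_le_one _) (by positivity)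
        (pow_le_one₀ (abs_nonneg _) (abs_cos_le_one _))) (abs_nonneg _) h1
  simpa [avg] using this

lemma IsLegendre.abs_avgDeriv_le (h : IsLegendre l φ φ') (hl : 0 < l) {r : ℝ} (hr : 0 ≤ r) :
    |avgDeriv φ' r| ≤ 2 * √l := by
  refine abs_integral_zero_pi_div_two_le fun θ hθ => ?_
  have hs := sin_nonneg_of_nonneg_of_le_pi hθ.1 (by linarith [hθ.2, pi_pos])
  have h1 := abs_le_sqrt (h.deriv_sq_le hl (mul_nonneg hr hs))
  rw [abs_mul, abs_mul, abs_mul, abs_pow]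
  have h2 : |sin θ| * |cos θ| ^ 2 * |sin θ| ≤ 1 :=
    mul_le_one₀ (mul_le_one₀ (abs_sin_le_one _) (by positivity)
        (pow_le_one₀ (abs_nonneg _) (abs_cos_le_one _))) (abs_nonneg _) (abs_sin_le_one _)
  calc _ ≤ 1 * √l := by gcongr
    _ = _ := one_mul _

end Average

/-! ### The Liouville normal form of the averaged equation -/

section NormalForm

variable {l : ℝ} {φ φ' : ℝ → ℝ}

/-- The forcing term `N(u) = (sinh u)^{-1/2} (cosh u)⁻¹` of the normal form. -/
noncomputable def forcing (u : ℝ) : ℝ := 1 / (√(sinh u) * cosh u)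

/-- The derivative of `forcing`. -/
noncomputable def forcingDeriv (u : ℝ) : ℝ :=
  -forcing u * (cosh u / (2 * sinh u) + sinh u / cosh u)

/-- The potential `Q(u) = -15 / (4 sinh² u) + 2 / cosh² u` of the normal form. -/
noncomputable def potential (u : ℝ) : ℝ := -15 / (4 * sinh u ^ 2) + 2 / cosh u ^ 2

/-- The Liouville transform `W(u) = (sinh u)^{3/2} (cosh u)⁻¹ J(sinh u)` of the average `J`; in the
variable `u` its equation has no first-order term. -/
noncomputable def liouville (φ : ℝ → ℝ) (u : ℝ) : ℝ :=
  sinh u * √(sinh u) / cosh u * avg φ (sinh u)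

/-- The derivative of `liouville φ`. -/
noncomputable def liouvilleDeriv (φ φ' : ℝ → ℝ) (u : ℝ) : ℝ :=
  √(sinh u) * ((3 / 2 - sinh u ^ 2 / cosh u ^ 2) * avg φ (sinh u) +
    sinh u * avgDeriv φ' (sinh u))

lemma hasDerivAt_sqrt_sinh {u : ℝ} (hu : 0 < u) :
    HasDerivAt (fun u => √(sinh u)) (cosh u / (2 * √(sinh u))) u :=
  (hasDerivAt_sinh u).sqrt (sinh_pos_iff.2 hu).ne'

lemma hasDerivAt_forcing {u : ℝ} (hu : 0 < u) : HasDerivAt forcing (forcingDeriv u) u := by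
  have hS : 0 < sinh u := sinh_pos_iff.2 hu
  have hC := cosh_pos u
  have hz : 0 < √(sinh u) := sqrt_pos.2 hS
  refine ((hasDerivAt_const u 1).fun_div ((hasDerivAt_sqrt_sinh hu).fun_mul (hasDerivAt_cosh u))
    (by positivity)).congr_deriv ?_
  simp only [forcingDeriv, forcing]
  have hzz : sinh u = √(sinh u) ^ 2 := (sq_sqrt hS.le).symm
  generalize √(sinh u) = z at *
  rw [hzz]
  field_simp
  ring

lemma hasDerivAt_forcingDeriv {u : ℝ} (hu : 0 < u) : HasDerivAt forcingDeriv
    (forcing u * (9 / 4 + 3 / (4 * sinh u ^ 2) - 2 / cosh u ^ 2)) u := by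
  have hS : 0 < sinh u := sinh_pos_iff.2 hu
  have hC := cosh_pos u
  refine ((hasDerivAt_forcing hu).fun_neg.fun_mul (((hasDerivAt_cosh u).fun_div
    ((hasDerivAt_sinh u).const_mul 2) (by positivity)).fun_add
    ((hasDerivAt_sinh u).fun_div (hasDerivAt_cosh u) hC.ne'))).congr_deriv ?_
  simp only [forcingDeriv]
  have h1 := cosh_sq u
  generalize forcing u = N
  generalize sinh u = S at *
  generalize cosh u = C at *
  field_simp
  simp only [h1]
  ring

lemma IsLegendre.hasDerivAt_liouville (h : IsLegendre l φ φ') {u : ℝ} (hu : 0 < u) :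
    HasDerivAt (liouville φ) (liouvilleDeriv φ φ' u) u := by
  have hS : 0 < sinh u := sinh_pos_iff.2 hu
  have hC := cosh_pos u
  have hz : 0 < √(sinh u) := sqrt_pos.2 hS
  refine ((((hasDerivAt_sinh u).fun_mul (hasDerivAt_sqrt_sinh hu)).fun_div (hasDerivAt_cosh u)
    hC.ne').fun_mul ((h.hasDerivAt_avg _).comp u (hasDerivAt_sinh u))).congr_deriv ?_
  simp only [liouvilleDeriv, Function.comp]
  have hzz : sinh u = √(sinh u) ^ 2 := (sq_sqrt hS.le).symm
  generalize avg φ (sinh u) = J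
  generalize avgDeriv φ' (sinh u) = J₁
  generalize √(sinh u) = z at *
  rw [hzz]
  field_simp
  ring

/-- The normal form `W'' + (l - 1/4 + Q) W = -N`. -/
lemma IsLegendre.hasDerivAt_liouvilleDeriv (h : IsLegendre l φ φ') {u : ℝ} (hu : 0 < u) :
    HasDerivAt (liouvilleDeriv φ φ')
      (-(l - 1 / 4 + potential u) * liouville φ u - forcing u) u := by
  have hS : 0 < sinh u := sinh_pos_iff.2 hu
  have hC := cosh_pos u
  have hz : 0 < √(sinh u) := sqrt_pos.2 hS
  have d0 := (h.hasDerivAt_avg _).comp u (hasDerivAt_sinh u)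
  have d1 := (h.hasDerivAt_avgDeriv hS.ne').comp u (hasDerivAt_sinh u)
  refine ((hasDerivAt_sqrt_sinh hu).fun_mul ((((((hasDerivAt_sinh u).fun_pow 2).fun_div
    ((hasDerivAt_cosh u).fun_pow 2) (by positivity)).const_sub (3 / 2)).fun_mul d0).fun_add
    ((hasDerivAt_sinh u).fun_mul d1))).congr_deriv ?_
  simp only [liouville, Function.comp, forcing, potential]
  have hzz : sinh u = √(sinh u) ^ 2 := (sq_sqrt hS.le).symm
  have h1 := cosh_sq u
  generalize avg φ (sinh u) = J
  generalize avgDeriv φ' (sinh u) = J₁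
  generalize √(sinh u) = z at *
  rw [show 1 + sinh u ^ 2 = cosh u ^ 2 by rw [h1]; ring]
  rw [hzz] at h1 ⊢
  generalize cosh u = C at *
  have h4 : C ^ 4 = ((z ^ 2) ^ 2 + 1) ^ 2 := by rw [← h1]; ring
  push_cast
  field_simp
  ring_nf
  simp only [h4, h1]
  ring

/-- The Liouville transform with the forcing term removed to leading order,
`W₁ = W + N / τ²` for `l = 1/4 + τ²`. -/
noncomputable def reduced (φ : ℝ → ℝ) (τ u : ℝ) : ℝ := liouville φ u + forcing u / τ ^ 2

/-- The derivative of `reduced φ τ`. -/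
noncomputable def reducedDeriv (φ φ' : ℝ → ℝ) (τ u : ℝ) : ℝ :=
  liouvilleDeriv φ φ' u + forcingDeriv u / τ ^ 2

/-- The forcing term `N'' + Q N` of the equation for `τ² W₁`. -/
noncomputable def residual (u : ℝ) : ℝ := forcing u * (9 / 4 - 3 / sinh u ^ 2)

lemma IsLegendre.hasDerivAt_reduced (h : IsLegendre l φ φ') {u : ℝ} (τ : ℝ) (hu : 0 < u) :
    HasDerivAt (reduced φ τ) (reducedDeriv φ φ' τ u) u :=
  (h.hasDerivAt_liouville hu).fun_add ((hasDerivAt_forcing hu).div_const _)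

lemma IsLegendre.hasDerivAt_reducedDeriv {τ : ℝ} (h : IsLegendre (1 / 4 + τ ^ 2) φ φ')
    {u : ℝ} (hτ : τ ≠ 0) (hu : 0 < u) :
    HasDerivAt (reducedDeriv φ φ' τ)
      (-(τ ^ 2 + potential u) * reduced φ τ u + residual u / τ ^ 2) u := by
  refine ((h.hasDerivAt_liouvilleDeriv hu).fun_add
    ((hasDerivAt_forcingDeriv hu).div_const (τ ^ 2))).congr_deriv ?_
  have hS : 0 < sinh u := sinh_pos_iff.2 hu
  simp only [reduced, residual, potential]
  have hC := cosh_pos u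
  generalize forcing u = N
  field_simp
  ring

/-! ### Energy estimate -/

/-- Grönwall's inequality in differential form, for a nonautonomous rate `K'`. -/
lemma gronwall_Ici {E E' K K' : ℝ → ℝ} {a : ℝ} (hE : ∀ u, a ≤ u → HasDerivAt E (E' u) u)
    (hK : ∀ u, a ≤ u → HasDerivAt K (K' u) u) (h : ∀ u, a ≤ u → E' u ≤ K' u * E u)
    {u : ℝ} (hu : a ≤ u) : E u ≤ E a * exp (K u - K a) := by
  have hd : ∀ v, a ≤ v → HasDerivAt (fun v => E v * exp (-K v))
      ((E' v - K' v * E v) * exp (-K v)) v := fun v hv =>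
    ((hE v hv).fun_mul (hK v hv).fun_neg.exp).congr_deriv (by ring)
  have := antitoneOn_of_deriv_nonpos (convex_Ici a)
    (fun v hv => (hd v hv).continuousAt.continuousWithinAt)
    (fun v hv => (hd v (interior_subset hv)).differentiableAt.differentiableWithinAt)
    (fun v hv => by
      rw [(hd v (interior_subset hv)).deriv]
      exact mul_nonpos_of_nonpos_of_nonneg (by linarith [h v (interior_subset hv)])
        (exp_pos _).le)
    (mem_Ici.2 le_rfl) (mem_Ici.2 hu) hu
  simp only at this
  calc E u = E u * exp (-K u) * exp (K u) := by rw [mul_assoc, ← exp_add]; simp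
    _ ≤ E a * exp (-K a) * exp (K u) := by gcongr
    _ = E a * exp (K u - K a) := by rw [mul_assoc, ← exp_add]; ring_nf

lemma self_le_sinh {u : ℝ} (hu : 0 ≤ u) : u ≤ sinh u := self_le_sinh_iff.2 hu

lemma sq_le_two_mul_cosh {u : ℝ} (hu : 0 ≤ u) : u ^ 2 ≤ 2 * cosh u := by
  have h1 : cosh u = 1 + 2 * sinh (u / 2) ^ 2 := by
    have := cosh_two_mul (u / 2)
    rw [show 2 * (u / 2) = u by ring, cosh_sq] at this
    linarith
  have h2 := self_le_sinh (u := u / 2) (by positivity)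
  nlinarith

lemma cosh_le_two {u : ℝ} (hu : 0 ≤ u) (hu1 : u ≤ 1) : cosh u ≤ 2 := by
  have h1 : cosh u ≤ cosh 1 := by
    rw [cosh_le_cosh, abs_of_nonneg hu, abs_one]; exact hu1
  refine h1.trans ?_
  rw [cosh_eq]
  have h2 : exp (-1) ≤ 1 := exp_le_one_iff.2 (by norm_num)
  linarith [exp_one_lt_d9]

lemma sinh_le_two_mul {u : ℝ} (hu : 0 ≤ u) (hu1 : u ≤ 1) : sinh u ≤ 2 * u := by
  have := (convex_Icc (0 : ℝ) 1).image_sub_le_mul_sub_of_deriv_le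
    (f := sinh) (C := 2) continuous_sinh.continuousOn differentiable_sinh.differentiableOn
    (fun x hx => by
      have hx := interior_subset hx
      rw [Real.deriv_sinh]
      exact cosh_le_two hx.1 hx.2) 0 ⟨le_rfl, zero_le_one⟩ u ⟨hu, hu1⟩ hu
  simpa using this

lemma abs_potential_le {u : ℝ} (hu : 0 < u) : |potential u| ≤ 6 / sinh u ^ 2 := by
  have hS : 0 < sinh u := sinh_pos_iff.2 hu
  have hC := cosh_pos u
  have h1 : 2 / cosh u ^ 2 ≤ 2 / sinh u ^ 2 := by
    gcongr; exact (sinh_lt_cosh u).le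
  have h2 : 0 < 2 / cosh u ^ 2 := by positivity
  have h3 : 0 < 1 / sinh u ^ 2 := by positivity
  rw [potential, abs_le]
  have e1 : -15 / (4 * sinh u ^ 2) = -(15 / 4) * (1 / sinh u ^ 2) := by field_simp
  have e2 : 2 / sinh u ^ 2 = 2 * (1 / sinh u ^ 2) := by ring
  have e3 : 6 / sinh u ^ 2 = 6 * (1 / sinh u ^ 2) := by ring
  rw [e1, e3]
  rw [e2] at h1
  constructor <;> linarith

lemma forcing_pos {u : ℝ} (hu : 0 < u) : 0 < forcing u := by
  have hS : 0 < sinh u := sinh_pos_iff.2 hu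
  have hC := cosh_pos u
  have hz : 0 < √(sinh u) := sqrt_pos.2 hS
  rw [forcing]; positivity

lemma abs_residual_le {u : ℝ} (hu : 0 < u) : |residual u| ≤ 8 / (u ^ 2 * √u) := by
  have hS : 0 < sinh u := sinh_pos_iff.2 hu
  have hC := cosh_pos u
  have hC1 := one_le_cosh u
  have hz : 0 < √u := sqrt_pos.2 hu
  have hle := self_le_sinh hu.le
  have hN := forcing_pos hu
  have hN1 : forcing u ≤ 1 / (√u * cosh u) := by
    rw [forcing]; gcongr
  have h3 : |9 / 4 - 3 / sinh u ^ 2| ≤ 9 / 4 + 3 / u ^ 2 := by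
    have : 3 / sinh u ^ 2 ≤ 3 / u ^ 2 := by gcongr
    have h' : 0 < 3 / sinh u ^ 2 := by positivity
    rw [abs_le]; constructor <;> linarith
  rw [residual, abs_mul, abs_of_pos hN]
  calc forcing u * |9 / 4 - 3 / sinh u ^ 2| ≤ 1 / (√u * cosh u) * (9 / 4 + 3 / u ^ 2) := by gcongr
    _ = (9 / 4 * u ^ 2 + 3) / cosh u / (u ^ 2 * √u) := by field_simp
    _ ≤ 8 / (u ^ 2 * √u) := by
      gcongr
      rw [div_le_iff₀ hC]
      linarith [sq_le_two_mul_cosh hu.le]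

/-- The energy of `W₁` at the point `u = δ / τ`, where the trivial bounds for `φ` and
`φ'` suffice. -/
lemma IsLegendre.reduced_initial {τ δ : ℝ} (h : IsLegendre (1 / 4 + τ ^ 2) φ φ') (hδ : 0 < δ)
    (hδ1 : δ ≤ 1) (hτ : δ ≤ τ) :
    τ ^ 3 * reduced φ τ (δ / τ) ^ 2 + τ * reducedDeriv φ φ' τ (δ / τ) ^ 2 ≤
      548 + 2 / δ + 8 / δ ^ 3 := by
  have hτ0 : 0 < τ := hδ.trans_le hτ
  set a := δ / τ with ha
  have ha0 : 0 < a := by positivity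
  have ha1 : a ≤ 1 := by rw [ha, div_le_one hτ0]; exact hτ
  have hδa : δ = a * τ := by rw [ha]; field_simp
  have hS : 0 < sinh a := sinh_pos_iff.2 ha0
  have hS1 := self_le_sinh ha0.le
  have hS2 := sinh_le_two_mul ha0.le ha1
  have hC := cosh_pos a
  have hC1 := one_le_cosh a
  have hC2 := cosh_le_two ha0.le ha1
  have hl : 0 < 1 / 4 + τ ^ 2 := by positivity
  have hJ := h.abs_avg_le hl hS.le
  have hJ1 := h.abs_avgDeriv_le hl hS.le
  have hsl : √(1 / 4 + τ ^ 2) ≤ 2 * (τ / δ) := by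
    rw [sqrt_le_left (by positivity)]
    have : 1 ≤ τ / δ := by rw [le_div_iff₀ hδ]; linarith
    have h2 : τ ≤ τ / δ := by rw [le_div_iff₀ hδ]; nlinarith
    nlinarith
  have hzz : √(sinh a) ^ 2 = sinh a := sq_sqrt hS.le
  have hN2 : forcing a ^ 2 ≤ 1 / a := by
    rw [forcing, div_pow, mul_pow, hzz, one_pow]
    gcongr
    exact hS1.trans (le_mul_of_one_le_right hS.le (one_le_pow₀ hC1))
  have hW : liouville φ a ^ 2 ≤ 32 * a ^ 3 := by
    have e : liouville φ a ^ 2 = sinh a ^ 3 / cosh a ^ 2 * avg φ (sinh a) ^ 2 := by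
      rw [liouville, mul_pow, div_pow, mul_pow, hzz]; ring
    rw [e]
    calc sinh a ^ 3 / cosh a ^ 2 * avg φ (sinh a) ^ 2 ≤ (2 * a) ^ 3 / 1 ^ 2 * 2 ^ 2 := by
          rw [← sq_abs (avg φ (sinh a))]
          gcongr
      _ = 32 * a ^ 3 := by ring
  have hW' : liouvilleDeriv φ φ' a ^ 2 ≤ 242 * a := by
    rw [liouvilleDeriv, mul_pow, hzz]
    have hb : |(3 / 2 - sinh a ^ 2 / cosh a ^ 2) * avg φ (sinh a) +
        sinh a * avgDeriv φ' (sinh a)| ≤ 11 := by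
      have h1 : sinh a ^ 2 / cosh a ^ 2 ≤ 1 := by
        rw [div_le_one (by positivity), cosh_sq]; linarith
      have h0 : 0 ≤ sinh a ^ 2 / cosh a ^ 2 := by positivity
      have h2 : |3 / 2 - sinh a ^ 2 / cosh a ^ 2| ≤ 3 / 2 := by
        rw [abs_le]; constructor <;> linarith
      refine (abs_add_le _ _).trans ?_
      rw [abs_mul, abs_mul, abs_of_pos hS]
      calc _ ≤ 3 / 2 * 2 + 2 * a * (2 * (2 * (τ / δ))) := by gcongr; exact hJ1.trans (by gcongr)
        _ = 11 := by rw [ha]; field_simp; norm_num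
    calc _ ≤ 2 * a * 11 ^ 2 := by
          rw [← sq_abs (_ + _)]
          gcongr
      _ = 242 * a := by ring
  have hN' : forcingDeriv a ^ 2 ≤ 4 / a ^ 3 := by
    have h1 : cosh a / (2 * sinh a) + sinh a / cosh a ≤ 2 / a := by
      have h1 : cosh a / (2 * sinh a) ≤ 2 / (2 * a) := by gcongr
      have h2 : sinh a / cosh a ≤ 1 := by
        rw [div_le_one hC]; exact (sinh_lt_cosh a).le
      have h3 : 1 ≤ 1 / a := by rw [le_div_iff₀ ha0]; linarith
      calc _ ≤ 2 / (2 * a) + 1 / a := by linarith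
        _ = 2 / a := by field_simp; norm_num
    rw [forcingDeriv, mul_pow, neg_sq]
    calc _ ≤ 1 / a * (2 / a) ^ 2 := by gcongr
      _ = 4 / a ^ 3 := by field_simp; norm_num
  have hsq : ∀ x y : ℝ, (x + y) ^ 2 ≤ 2 * x ^ 2 + 2 * y ^ 2 := fun x y => by
    nlinarith [sq_nonneg (x - y)]
  have b1 : τ ^ 3 * reduced φ τ a ^ 2 ≤ 64 + 2 / δ := by
    calc τ ^ 3 * reduced φ τ a ^ 2 ≤ τ ^ 3 * (2 * (32 * a ^ 3) + 2 * (1 / a / (τ ^ 2) ^ 2)) := by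
          gcongr
          refine (hsq _ _).trans ?_
          rw [div_pow]
          gcongr
      _ = 64 * δ ^ 3 + 2 / δ := by rw [hδa]; field_simp; ring
      _ ≤ 64 * 1 ^ 3 + 2 / δ := by gcongr
      _ = _ := by ring
  have b2 : τ * reducedDeriv φ φ' τ a ^ 2 ≤ 484 + 8 / δ ^ 3 := by
    calc τ * reducedDeriv φ φ' τ a ^ 2 ≤ τ * (2 * (242 * a) + 2 * (4 / a ^ 3 / (τ ^ 2) ^ 2)) := by
          gcongr
          refine (hsq _ _).trans ?_
          rw [div_pow]
          gcongr
      _ = 484 * δ + 8 / δ ^ 3 := by rw [hδa]; field_simp; ring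
      _ ≤ 484 * 1 + 8 / δ ^ 3 := by gcongr
      _ = _ := by ring
  linarith

/-- For `τ ≥ δ` the function `W₁` is `O(τ^{-3/2})` and its derivative is `O(τ^{-1/2})` for `u ≥ 1`,
uniformly: the energy `τ (W₁'² + τ² W₁²) + 1` at most grows by a bounded factor from `u = δ / τ`
on, as the potential and the forcing term contribute `O(1 / (τ u²))` to its logarithmic
derivative. -/
theorem exists_reduced_bound {δ : ℝ} (hδ : 0 < δ) (hδ1 : δ ≤ 1) : ∃ K : ℝ, 0 < K ∧
    ∀ (τ : ℝ) (φ φ' : ℝ → ℝ), δ ≤ τ → IsLegendre (1 / 4 + τ ^ 2) φ φ' → ∀ u, 1 ≤ u →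
      τ ^ 3 * reduced φ τ u ^ 2 + τ * reducedDeriv φ φ' τ u ^ 2 ≤ K := by
  set κ : ℝ := 6 + 8 / δ with hκ
  have hκ0 : 0 < κ := by positivity
  refine ⟨(548 + 2 / δ + 8 / δ ^ 3 + 1) * exp (κ / δ), by positivity,
    fun τ φ φ' hτ h u hu => ?_⟩
  have hτ0 : 0 < τ := hδ.trans_le hτ
  set a := δ / τ with ha
  have ha0 : 0 < a := by positivity
  have ha1 : a ≤ 1 := by rw [ha, div_le_one hτ0]; exact hτ
  have hE : ∀ v, a ≤ v → HasDerivAt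
      (fun v => τ ^ 3 * reduced φ τ v ^ 2 + τ * reducedDeriv φ φ' τ v ^ 2 + 1)
      (2 * τ * reducedDeriv φ φ' τ v *
        (-potential v * reduced φ τ v + residual v / τ ^ 2)) v := fun v hv => by
    have hv0 := ha0.trans_le hv
    refine (((((h.hasDerivAt_reduced τ hv0).fun_pow 2).const_mul (τ ^ 3)).fun_add
      (((h.hasDerivAt_reducedDeriv hτ0.ne' hv0).fun_pow 2).const_mul τ)).add_const 1).congr_deriv ?_
    push_cast
    ring
  -- the logarithmic derivative `κ / (τ v²)` has integral `κ / δ` over `[δ / τ, ∞)`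
  have hK : ∀ v, a ≤ v → HasDerivAt (fun v => -(κ / τ) * v⁻¹) (κ / (τ * v ^ 2)) v :=
    fun v hv => by
      have hv0 := ha0.trans_le hv
      refine ((hasDerivAt_inv hv0.ne').const_mul _).congr_deriv ?_
      field_simp
  have key := gronwall_Ici hE hK (fun v hv => ?_) (ha1.trans hu)
  · have h0 := h.reduced_initial hδ hδ1 hτ
    rw [← ha] at h0
    have hu0 : 0 < u := by linarith
    have hexp : exp (-(κ / τ) * u⁻¹ - -(κ / τ) * a⁻¹) ≤ exp (κ / δ) := by
      gcongr
      have e : -(κ / τ) * a⁻¹ = -(κ / δ) := by rw [ha]; field_simp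
      have : 0 < κ / τ * u⁻¹ := by positivity
      rw [e]; linarith
    have hpos : 0 ≤ τ ^ 3 * reduced φ τ a ^ 2 + τ * reducedDeriv φ φ' τ a ^ 2 + 1 := by positivity
    calc _ ≤ τ ^ 3 * reduced φ τ u ^ 2 + τ * reducedDeriv φ φ' τ u ^ 2 + 1 := by linarith
      _ ≤ _ := key
      _ ≤ _ := by gcongr
  · have hv0 := ha0.trans_le hv
    have hle := self_le_sinh hv0.le
    have hQ : |potential v| ≤ 6 / v ^ 2 := (abs_potential_le hv0).trans (by gcongr)
    have hf : √τ * (|residual v| / τ ^ 2) ≤ 8 / δ / (τ * v ^ 2) := by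
      have h1 : δ ≤ √τ * √v := by
        rw [← sqrt_mul hτ0.le]
        refine le_sqrt_of_sq_le ?_
        have : δ ≤ τ * v := by
          rw [ha, div_le_iff₀ hτ0] at hv; linarith
        nlinarith
      have hst : √τ ^ 2 = τ := sq_sqrt hτ0.le
      have hsτ : 0 < √τ := sqrt_pos.2 hτ0
      have hsv : 0 < √v := sqrt_pos.2 hv0
      calc √τ * (|residual v| / τ ^ 2) ≤ √τ * (8 / (v ^ 2 * √v) / τ ^ 2) := by
            gcongr; exact abs_residual_le hv0
        _ = 8 * √τ ^ 2 / ((√τ * √v) * τ ^ 2 * v ^ 2) := by field_simp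
        _ ≤ 8 * √τ ^ 2 / (δ * τ ^ 2 * v ^ 2) := by gcongr
        _ = _ := by rw [hst]; field_simp
    generalize reduced φ τ v = w
    generalize reducedDeriv φ φ' τ v = p
    set R := residual v
    set Q := potential v
    have e1 : 2 * τ * p * (-Q * w + R / τ ^ 2) ≤ |Q| * (2 * (|p| * (τ * |w|))) +
        √τ * (|R| / τ ^ 2) * (2 * (√τ * |p|)) := by
      have hst : √τ * √τ = τ := mul_self_sqrt hτ0.le
      calc _ ≤ |2 * τ * p * (-Q * w + R / τ ^ 2)| := le_abs_self _
        _ = 2 * τ * |p| * |-Q * w + R / τ ^ 2| := by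
          rw [abs_mul, abs_mul, abs_of_pos (by positivity : 0 < 2 * τ)]
        _ ≤ 2 * τ * |p| * (|Q| * |w| + |R| / τ ^ 2) := by
          gcongr
          refine (abs_add_le _ _).trans ?_
          rw [abs_mul, abs_neg, abs_div, abs_of_pos (by positivity : 0 < τ ^ 2)]
        _ = |Q| * (2 * (|p| * (τ * |w|))) + (√τ * √τ) * (|R| / τ ^ 2) * (2 * |p|) := by
          rw [hst]; ring
        _ = _ := by ring
    have e2 : 2 * (|p| * (τ * |w|)) ≤ (τ ^ 3 * w ^ 2 + τ * p ^ 2 + 1) / τ := by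
      rw [le_div_iff₀ hτ0]
      have : 2 * (|p| * (τ * |w|)) ≤ p ^ 2 + τ ^ 2 * w ^ 2 := by
        rw [← sq_abs p, ← sq_abs w]
        nlinarith [sq_nonneg (|p| - τ * |w|)]
      nlinarith
    have e3 : 2 * (√τ * |p|) ≤ τ ^ 3 * w ^ 2 + τ * p ^ 2 + 1 := by
      have hst : √τ ^ 2 = τ := sq_sqrt hτ0.le
      have : 0 ≤ τ ^ 3 * w ^ 2 := by positivity
      have h2 : τ * p ^ 2 = (√τ * |p|) ^ 2 := by rw [mul_pow, hst, sq_abs]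
      nlinarith [sq_nonneg (√τ * |p| - 1)]
    set E := τ ^ 3 * w ^ 2 + τ * p ^ 2 + 1
    have hE0 : 0 ≤ E := by positivity
    calc _ ≤ _ := e1
      _ ≤ 6 / v ^ 2 * (E / τ) + 8 / δ / (τ * v ^ 2) * E := by gcongr
      _ = κ / (τ * v ^ 2) * E := by rw [hκ]; field_simp

end NormalForm

/-! ### Bounds for real `t` -/

section Bounds

variable {l : ℝ} {φ φ' : ℝ → ℝ}

/-- The derivative of `primitive φ`, in terms of the Liouville transform. -/
noncomputable def primitiveDeriv (φ φ' : ℝ → ℝ) (X : ℝ) : ℝ :=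
  (3 / 2 * X ^ 2 / √√(X ^ 2 - 1) + √(X ^ 2 - 1) * √√(X ^ 2 - 1)) * liouville φ (arcosh X) +
    √√(X ^ 2 - 1) * X * liouvilleDeriv φ φ' (arcosh X)

lemma primitive_eq_liouville (φ : ℝ → ℝ) {X : ℝ} (hX : 1 < X) :
    primitive φ X = sinh (arcosh X) * √(sinh (arcosh X)) * cosh (arcosh X) *
      liouville φ (arcosh X) := by
  have hS : 0 < sinh (arcosh X) := sinh_pos_iff.2 (arcosh_pos hX)
  have hC := cosh_pos (arcosh X)
  rw [primitive, liouville, ← sinh_arcosh hX.le]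
  have hz : √(sinh (arcosh X)) ^ 2 = sinh (arcosh X) := sq_sqrt hS.le
  field_simp
  rw [hz]
  ring

lemma IsLegendre.hasDerivAt_primitive (h : IsLegendre l φ φ') {X : ℝ} (hX : 1 < X) :
    HasDerivAt (primitive φ) (primitiveDeriv φ φ' X) X := by
  have hu := arcosh_pos hX
  have hS : 0 < sinh (arcosh X) := sinh_pos_iff.2 hu
  have d := ((((hasDerivAt_sinh _).fun_mul (hasDerivAt_sqrt_sinh hu)).fun_mul
    (hasDerivAt_cosh _)).fun_mul (h.hasDerivAt_liouville hu)).comp X (hasDerivAt_arcosh hX)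
  refine (d.congr_of_eventuallyEq ?_).congr_deriv ?_
  · filter_upwards [lt_mem_nhds hX] with x hx
    exact primitive_eq_liouville φ hx
  · rw [primitiveDeriv, ← sinh_arcosh hX.le, cosh_arcosh hX.le]
    have hz : √(sinh (arcosh X)) ^ 2 = sinh (arcosh X) := sq_sqrt hS.le
    have hz0 : 0 < √(sinh (arcosh X)) := sqrt_pos.2 hS
    generalize sinh (arcosh X) = S at *
    generalize √S = z at *
    subst hz
    field_simp
    ring

lemma one_le_arcosh {X : ℝ} (hX : 2 ≤ X) : 1 ≤ arcosh X := by
  rw [← arcosh_cosh (x := 1) zero_le_one, arcosh_le_arcosh (cosh_pos 1) (by linarith)]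
  exact (cosh_le_two zero_le_one le_rfl).trans hX

lemma sqrt_sq_sub_one_le {X : ℝ} (hX : 2 ≤ X) : √(X ^ 2 - 1) ≤ X := by
  rw [sqrt_le_left (by linarith)]; linarith

lemma half_le_sqrt_sq_sub_one {X : ℝ} (hX : 2 ≤ X) : X / 2 ≤ √(X ^ 2 - 1) :=
  le_sqrt_of_sq_le (by nlinarith)

/-- A bound for the derivative of `primitive φ` from bounds for the Liouville transform. -/
lemma abs_primitive_coeff_le {X w p A B : ℝ} (hX : 2 ≤ X) (hw : |w| ≤ A) (hp : |p| ≤ B) :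
    |(3 / 2 * X ^ 2 / √√(X ^ 2 - 1) + √(X ^ 2 - 1) * √√(X ^ 2 - 1)) * w +
      √√(X ^ 2 - 1) * X * p| ≤ X * √X * (4 * A + B) := by
  have h1 := sqrt_sq_sub_one_le hX
  have h2 := half_le_sqrt_sq_sub_one hX
  have hX0 : 0 < X := by linarith
  set S := √(X ^ 2 - 1)
  have hA : 0 ≤ A := (abs_nonneg _).trans hw
  have hB : 0 ≤ B := (abs_nonneg _).trans hp
  have hS0 : 0 < S := by linarith
  have hz1 : √S ≤ √X := sqrt_le_sqrt h1
  have hz2 : 3 / 5 * √X ≤ √S := by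
    refine le_sqrt_of_sq_le ?_
    rw [mul_pow, sq_sqrt hX0.le]; linarith
  have hx0 : 0 < √X := sqrt_pos.2 hX0
  have hz0 : 0 < √S := sqrt_pos.2 hS0
  have e1 : 3 / 2 * X ^ 2 / √S ≤ 5 / 2 * (X * √X) := by
    rw [div_le_iff₀ hz0]
    calc 3 / 2 * X ^ 2 = 5 / 2 * X * (3 / 5) * √X ^ 2 := by rw [sq_sqrt hX0.le]; ring
      _ = 5 / 2 * X * √X * (3 / 5 * √X) := by ring
      _ ≤ 5 / 2 * X * √X * √S := by gcongr
      _ = _ := by ring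
  have e2 : S * √S ≤ X * √X := by gcongr
  have e3 : √S * X ≤ X * √X := by rw [mul_comm]; gcongr
  have e0 : 0 ≤ 3 / 2 * X ^ 2 / √S + S * √S := by positivity
  refine (abs_add_le _ _).trans ?_
  rw [abs_mul, abs_mul, abs_of_nonneg e0, abs_of_nonneg (by positivity : 0 ≤ √S * X)]
  calc _ ≤ (5 / 2 * (X * √X) + X * √X) * A + X * √X * B := by gcongr
    _ ≤ _ := by nlinarith [mul_nonneg (mul_nonneg hX0.le hx0.le) hA]

lemma primitive_eq_reduced (φ : ℝ → ℝ) (τ : ℝ) {X : ℝ} (hX : 1 < X) :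
    primitive φ X = √(X ^ 2 - 1) * √√(X ^ 2 - 1) * X * reduced φ τ (arcosh X) -
      √(X ^ 2 - 1) / τ ^ 2 := by
  have hS : 0 < sinh (arcosh X) := sinh_pos_iff.2 (arcosh_pos hX)
  have hz0 : 0 < √(sinh (arcosh X)) := sqrt_pos.2 hS
  rw [primitive_eq_liouville φ hX, ← sinh_arcosh hX.le, cosh_arcosh hX.le, reduced, forcing,
    cosh_arcosh hX.le]
  have : X ≠ 0 := by linarith
  field_simp
  ring

lemma primitiveDeriv_eq_reduced (φ φ' : ℝ → ℝ) (τ : ℝ) {X : ℝ} (hX : 1 < X) :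
    primitiveDeriv φ φ' X = (3 / 2 * X ^ 2 / √√(X ^ 2 - 1) + √(X ^ 2 - 1) * √√(X ^ 2 - 1)) *
      reduced φ τ (arcosh X) + √√(X ^ 2 - 1) * X * reducedDeriv φ φ' τ (arcosh X) -
      X / √(X ^ 2 - 1) / τ ^ 2 := by
  have hS : 0 < sinh (arcosh X) := sinh_pos_iff.2 (arcosh_pos hX)
  have hz0 : 0 < √(sinh (arcosh X)) := sqrt_pos.2 hS
  rw [primitiveDeriv, ← sinh_arcosh hX.le, reduced, reducedDeriv, forcingDeriv, forcing,
    cosh_arcosh hX.le]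
  have : X ≠ 0 := by linarith
  have hz : sinh (arcosh X) = √(sinh (arcosh X)) ^ 2 := (sq_sqrt hS.le).symm
  generalize √(sinh (arcosh X)) = z at *
  rw [hz]
  field_simp
  ring

lemma abs_reduced_le {K τ w p : ℝ} (hτ : 0 < τ) (hK : τ ^ 3 * w ^ 2 + τ * p ^ 2 ≤ K) :
    |w| ≤ √K / (τ * √τ) ∧ |p| ≤ √K / √τ := by
  have hs : 0 < √τ := sqrt_pos.2 hτ
  have hst : √τ ^ 2 = τ := sq_sqrt hτ.le
  have h1 : 0 ≤ τ ^ 3 * w ^ 2 := by positivity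
  have h2 : 0 ≤ τ * p ^ 2 := by positivity
  constructor
  · rw [le_div_iff₀ (by positivity), ← abs_of_pos (by positivity : 0 < τ * √τ), ← abs_mul]
    refine abs_le_sqrt ?_
    rw [mul_pow, mul_pow, hst]; linarith
  · rw [le_div_iff₀ hs, ← abs_of_pos hs, ← abs_mul]
    refine abs_le_sqrt ?_
    rw [mul_pow, hst]; linarith

theorem exists_primitive_bound {δ : ℝ} (hδ : 0 < δ) (hδ1 : δ ≤ 1) : ∃ K : ℝ, 0 < K ∧
    ∀ (τ : ℝ) (φ φ' : ℝ → ℝ), δ ≤ τ → IsLegendre (1 / 4 + τ ^ 2) φ φ' → ∀ X, 2 ≤ X →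
      |primitive φ X| ≤ K * (X ^ 2 * √X / (τ * √τ)) ∧
      |primitiveDeriv φ φ' X| ≤ K * (X * √X / √τ) := by
  obtain ⟨K, hK0, hK⟩ := exists_reduced_bound hδ hδ1
  refine ⟨√K * (4 / δ + 1) + 2 / δ ^ 2, by positivity, fun τ φ φ' hτ h X hX => ?_⟩
  have hτ0 : 0 < τ := hδ.trans_le hτ
  have hX0 : 0 < X := by linarith
  obtain ⟨hw, hp⟩ := abs_reduced_le hτ0 (hK τ φ φ' hτ h _ (one_le_arcosh hX))
  have h1 := sqrt_sq_sub_one_le hX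
  have h2 := half_le_sqrt_sq_sub_one hX
  have hst : √τ ^ 2 = τ := sq_sqrt hτ0.le
  have hs : 0 < √τ := sqrt_pos.2 hτ0
  have hsδ : δ ≤ √τ := le_sqrt_of_sq_le (by nlinarith)
  have hx1 : 1 ≤ √X := by rw [one_le_sqrt]; linarith
  have hi : 1 / τ ^ 2 ≤ 1 / (δ * (τ * √τ)) := by
    gcongr
    calc δ * (τ * √τ) ≤ √τ * (τ * √τ) := by gcongr
      _ = √τ ^ 2 * τ := by ring
      _ = τ ^ 2 := by rw [hst]; ring
  constructor
  · rw [primitive_eq_reduced φ τ (by linarith)]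
    set S := √(X ^ 2 - 1)
    have hS0 : 0 < S := by linarith
    refine (abs_sub _ _).trans ?_
    rw [abs_mul, abs_of_nonneg (by positivity : 0 ≤ S * √S * X),
      abs_of_pos (by positivity : 0 < S / τ ^ 2)]
    have hz1 : √S ≤ √X := sqrt_le_sqrt h1
    have e1 : S / τ ^ 2 ≤ X ^ 2 * √X / (δ * (τ * √τ)) := by
      calc S / τ ^ 2 = S * (1 / τ ^ 2) := by ring
        _ ≤ X * (1 / (δ * (τ * √τ))) := by gcongr
        _ = X * 1 * 1 / (δ * (τ * √τ)) := by ring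
        _ ≤ X * X * √X / (δ * (τ * √τ)) := by gcongr; linarith
        _ = _ := by ring
    have hδ2 : 1 / δ ≤ 2 / δ ^ 2 := by
      rw [div_le_div_iff₀ hδ (by positivity)]; nlinarith
    calc _ ≤ X * √X * X * (√K / (τ * √τ)) + X ^ 2 * √X / (δ * (τ * √τ)) := by gcongr
      _ = (√K * 1 + 1 / δ) * (X ^ 2 * √X / (τ * √τ)) := by field_simp
      _ ≤ (√K * (4 / δ + 1) + 2 / δ ^ 2) * (X ^ 2 * √X / (τ * √τ)) := by
        gcongr
        have : 0 < 4 / δ := by positivity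
        linarith
  · rw [primitiveDeriv_eq_reduced φ φ' τ (by linarith)]
    refine (abs_sub _ _).trans ?_
    have hS0 : 0 < √(X ^ 2 - 1) := by linarith
    rw [abs_of_pos (by positivity : 0 < X / √(X ^ 2 - 1) / τ ^ 2)]
    have e1 : X / √(X ^ 2 - 1) ≤ 2 := by rw [div_le_iff₀ hS0]; linarith
    have e2 : 1 / (τ * √τ) ≤ 1 / (δ * √τ) := by gcongr
    have e3 : 1 / τ ^ 2 ≤ 1 / (δ ^ 2 * √τ) := by
      refine hi.trans (one_div_le_one_div_of_le (by positivity) ?_)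
      calc δ ^ 2 * √τ = δ * (δ * √τ) := by ring
        _ ≤ δ * (τ * √τ) := by gcongr
    have e4 : 1 ≤ X * √X := by nlinarith
    calc _ ≤ X * √X * (4 * (√K / (τ * √τ)) + √K / √τ) + 2 * (1 / τ ^ 2) := by
          refine add_le_add (abs_primitive_coeff_le hX hw hp) ?_
          rw [div_eq_mul_one_div _ (τ ^ 2)]; gcongr
      _ = X * √X * (4 * (√K * (1 / (τ * √τ))) + √K / √τ) + 1 * (2 * (1 / τ ^ 2)) := by ring
      _ ≤ X * √X * (4 * (√K * (1 / (δ * √τ))) + √K / √τ) +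
          X * √X * (2 * (1 / (δ ^ 2 * √τ))) := by gcongr
      _ = _ := by field_simp

/-- A bound for the Huber transform of `f⁺` from a bound for the derivative of `primitive φ`. -/
lemma IsLegendre.norm_huber_le_of_deriv (h : IsLegendre l φ φ') {t : ℂ}
    (ht : 1 / 4 + t ^ 2 = (l : ℂ)) {X Y B : ℝ} (hX : 2 ≤ X) (hY : 0 < Y)
    (hB : ∀ x ∈ Icc X (X + Y), |primitiveDeriv φ φ' x| ≤ B) :
    ‖huber t (fPlus X Y)‖ ≤ B / X := by
  have hX0 : 0 < X := by linarith
  have hB0 : 0 ≤ B := (abs_nonneg _).trans (hB X ⟨le_rfl, by linarith⟩)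
  have hm := (convex_Icc X (X + Y)).norm_image_sub_le_of_norm_hasDerivWithin_le
    (f := primitive φ) (C := B)
    (fun x hx => (h.hasDerivAt_primitive (by linarith [hx.1])).hasDerivWithinAt) hB
    ⟨le_rfl, by linarith⟩ ⟨by linarith, le_rfl⟩
  rw [add_sub_cancel_left, norm_eq_abs, norm_eq_abs, abs_of_pos hY] at hm
  rw [huber_fPlus h ht (by linarith) hY, Complex.norm_real, norm_eq_abs, abs_mul,
    abs_of_pos (by positivity)]
  calc _ ≤ 2 / (2 * (0 + 2 * Y * X)) * (B * Y) := by
        gcongr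
        · exact two_le_pi
        · positivity
    _ = B / X / 2 := by field_simp; norm_num
    _ ≤ B / X := by have : 0 ≤ B / X := by positivity
                    linarith

lemma IsLegendre.norm_huber_le (h : IsLegendre l φ φ') {t : ℂ}
    (ht : 1 / 4 + t ^ 2 = (l : ℂ)) {X Y B : ℝ} (hX : 2 ≤ X) (hY : 0 < Y)
    (h1 : |primitive φ (X + Y)| ≤ B) (h2 : |primitive φ X| ≤ B) :
    ‖huber t (fPlus X Y)‖ ≤ B / (X * Y) := by
  have hX0 : 0 < X := by linarith
  have hB0 : 0 ≤ B := (abs_nonneg _).trans h1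
  rw [huber_fPlus h ht (by linarith) hY, Complex.norm_real, norm_eq_abs, abs_mul,
    abs_of_pos (by positivity)]
  calc _ ≤ 2 / (2 * (0 + 2 * Y * X)) * (B + B) := by
        gcongr
        · exact two_le_pi
        · positivity
        · exact (abs_sub _ _).trans (by gcongr)
    _ = B / (X * Y) := by field_simp; ring

lemma sqrt_mul_le {X C x : ℝ} (hX : 0 ≤ X) (hC : 0 ≤ C) (hx : x ≤ (1 + C) * X) :
    √x ≤ (1 + C) * √X := by
  have : √X ^ 2 = X := sq_sqrt hX
  rw [sqrt_le_left (by positivity), mul_pow, this]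
  nlinarith [mul_nonneg hC hX, mul_nonneg (mul_nonneg hC hC) hX]

lemma rpow_half (x : ℝ) : x ^ (1 / 2 : ℝ) = √x := (sqrt_eq_rpow x).symm

lemma rpow_neg_half {x : ℝ} (hx : 0 ≤ x) : x ^ (-(1 / 2) : ℝ) = 1 / √x := by
  rw [rpow_neg hx, rpow_half, one_div]

lemma rpow_neg_three_halves {x : ℝ} (hx : 0 < x) : x ^ (-(3 / 2) : ℝ) = 1 / (x * √x) := by
  rw [rpow_neg hx.le, show (3 / 2 : ℝ) = 1 + 1 / 2 by norm_num, rpow_add hx, rpow_one, rpow_half,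
    one_div]

/-- The upper bound for real `t` away from `0`. -/
theorem exists_norm_huber_bound {δ C : ℝ} (hδ : 0 < δ) (hC : 0 < C) : ∃ M : ℝ, ∀ X Y t : ℝ,
    2 ≤ X → 0 < Y → Y ≤ C * X → δ ≤ |t| → ‖huber t (fPlus X Y)‖ ≤
      M * (X ^ (1 / 2 : ℝ) * min (|t| ^ (-(1 / 2) : ℝ)) (|t| ^ (-(3 / 2) : ℝ) * (X / Y))) := by
  obtain ⟨K, hK0, hK⟩ := exists_primitive_bound (δ := min δ 1) (by positivity) (min_le_right _ _)
  refine ⟨K * (1 + C) ^ 3, fun X Y t hX hY hYX ht => ?_⟩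
  have ht0 : 0 < |t| := hδ.trans_le ht
  have hX0 : 0 < X := by linarith
  obtain ⟨φ, φ', h⟩ := exists_isLegendre |t|
  have hl : 1 / 4 + (t : ℂ) ^ 2 = ((1 / 4 + |t| ^ 2 : ℝ) : ℂ) := by rw [sq_abs]; push_cast; ring
  have hK := hK |t| φ φ' ((min_le_left _ _).trans ht) h
  have hXY : X + Y ≤ (1 + C) * X := by linarith
  have h1 : 1 ≤ 1 + C := by linarith
  rw [rpow_half, rpow_neg_half ht0.le, rpow_neg_three_halves ht0]
  set τ := |t|
  have hs : 0 < √τ := sqrt_pos.2 ht0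
  rw [mul_min_of_nonneg _ _ (by positivity), mul_min_of_nonneg _ _ (by positivity)]
  refine le_min ?_ ?_
  · refine (h.norm_huber_le_of_deriv hl (B := K * ((1 + C) * X * ((1 + C) * √X) / √τ)) hX hY
      fun x hx => ((hK x (by linarith [hx.1])).2).trans ?_).trans ?_
    · have := hx.2.trans hXY
      have := sqrt_mul_le hX0.le hC.le this
      gcongr
    · calc _ = K * (1 + C) ^ 2 * (√X * (1 / √τ)) := by field_simp
        _ ≤ _ := by gcongr; norm_num
  · refine (h.norm_huber_le hl
      (B := K * (((1 + C) * X) ^ 2 * ((1 + C) * √X) / (τ * √τ))) hX hY ?_ ?_).trans ?_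
    · refine ((hK _ (by linarith)).1).trans ?_
      have := sqrt_mul_le hX0.le hC.le hXY
      gcongr
    · refine ((hK _ (by linarith)).1).trans ?_
      have h3 : X ≤ (1 + C) * X := by linarith
      have := sqrt_mul_le hX0.le hC.le h3
      gcongr
    · refine le_of_eq ?_
      field_simp

/-! ### The case `t = 0` -/

lemma exp_div_three_le_sinh {u : ℝ} (hu : 1 ≤ u) : exp u / 3 ≤ sinh u := by
  have h1 : exp (-u) * exp u = 1 := by rw [← exp_add]; simp
  have h2 : 2 ≤ exp u := by linarith [add_one_le_exp u]
  rw [sinh_eq]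
  nlinarith [exp_pos u, exp_pos (-u)]

lemma abs_potential_le_exp {u : ℝ} (hu : 1 ≤ u) : |potential u| ≤ 54 * exp (-2 * u) := by
  have h1 := exp_div_three_le_sinh hu
  have h2 : exp (-2 * u) = 1 / exp u ^ 2 := by
    rw [← exp_nat_mul, one_div, ← exp_neg]; push_cast; ring_nf
  rw [h2]
  calc _ ≤ 6 / sinh u ^ 2 := abs_potential_le (by linarith)
    _ ≤ 6 / (exp u / 3) ^ 2 := by have := exp_pos u; gcongr
    _ = _ := by field_simp; norm_num

lemma forcing_le_exp {u : ℝ} (hu : 1 ≤ u) : forcing u ≤ 4 * exp (-(3 / 2) * u) := by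
  have h1 := exp_div_three_le_sinh hu
  have h2 : exp (-(3 / 2) * u) = 1 / (exp (u / 2) * exp u) := by
    rw [← exp_add, one_div, ← exp_neg]; ring_nf
  have h3 : exp (u / 2) / 2 ≤ √(sinh u) := by
    refine le_sqrt_of_sq_le ?_
    rw [div_pow, ← exp_nat_mul]
    push_cast
    rw [show 2 * (u / 2) = u by ring]
    linarith [exp_pos u]
  have h4 : exp u / 2 ≤ cosh u := by rw [cosh_eq]; linarith [exp_pos (-u)]
  rw [h2, forcing]
  calc _ ≤ 1 / (exp (u / 2) / 2 * (exp u / 2)) := by gcongr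
    _ = _ := by field_simp; norm_num

/-- At `t = 0` the Liouville transform grows at most linearly: the energy
`(W - u W')² + W'² + 1` is bounded. -/
theorem exists_liouville_zero_bound : ∃ K : ℝ, 0 < K ∧ ∀ φ φ' : ℝ → ℝ,
    IsLegendre (1 / 4) φ φ' → ∀ u, 1 ≤ u →
      |liouville φ u| ≤ K * u ∧ |liouvilleDeriv φ φ' u| ≤ K := by
  -- `425` bounds the energy at `u = 1`, and `880` the integral of its logarithmic derivative,
  -- which is at most `440 e^{-u/2}`
  refine ⟨2 * √(425 * exp 880), by positivity, fun φ φ' h u hu => ?_⟩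
  have hE : ∀ v, 1 ≤ v → HasDerivAt (fun v => (liouville φ v - v * liouvilleDeriv φ φ' v) ^ 2 +
      liouvilleDeriv φ φ' v ^ 2 + 1) (2 * (-potential v * liouville φ v - forcing v) *
      (liouvilleDeriv φ φ' v - v * (liouville φ v - v * liouvilleDeriv φ φ' v))) v :=
    fun v hv => by
    have hv0 : 0 < v := by linarith
    have d := h.hasDerivAt_liouvilleDeriv hv0
    refine (((((h.hasDerivAt_liouville hv0).fun_sub ((hasDerivAt_id' v).fun_mul d)).fun_pow
      2).fun_add (d.fun_pow 2)).add_const 1).congr_deriv ?_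
    push_cast
    ring
  have hK : ∀ v, 1 ≤ v → HasDerivAt (fun v => -880 * exp (-(1 / 2) * v))
      (440 * exp (-(1 / 2) * v)) v := fun v _ => by
    refine ((((hasDerivAt_id' v).const_mul (-(1 / 2))).exp).const_mul (-880)).congr_deriv ?_
    ring
  have key := gronwall_Ici hE hK (fun v hv => ?_) hu
  · have hexp : exp (-880 * exp (-(1 / 2) * u) - -880 * exp (-(1 / 2) * 1)) ≤ exp 880 := by
      gcongr
      have h1 : exp (-(1 / 2) * 1) ≤ 1 := exp_le_one_iff.2 (by norm_num)
      linarith [exp_pos (-(1 / 2) * u)]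
    have hS : 0 < sinh 1 := sinh_pos_iff.2 one_pos
    have hS2 : sinh 1 ≤ 2 := by simpa using sinh_le_two_mul zero_le_one le_rfl
    have hC1 := one_le_cosh 1
    have hz : √(sinh 1) ≤ 2 := by rw [sqrt_le_left (by norm_num)]; linarith
    have hJ := h.abs_avg_le (by norm_num) hS.le
    have hJ1 : |avgDeriv φ' (sinh 1)| ≤ 2 * (1 / 2) := by
      have := h.abs_avgDeriv_le (by norm_num) hS.le
      rwa [show √(1 / 4 : ℝ) = 1 / 2 by
        rw [show (1 / 4 : ℝ) = (1 / 2) ^ 2 by norm_num, sqrt_sq (by norm_num)]] at this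
    have hW : |liouville φ 1| ≤ 8 := by
      rw [liouville, abs_mul, abs_of_nonneg (by positivity)]
      calc _ ≤ (2 * 2 / 1 * 2 : ℝ) := by gcongr
        _ = 8 := by norm_num
    have hW' : |liouvilleDeriv φ φ' 1| ≤ 10 := by
      rw [liouvilleDeriv, abs_mul, abs_of_nonneg (sqrt_nonneg _)]
      have h1 : sinh 1 ^ 2 / cosh 1 ^ 2 ≤ 1 := by
        rw [div_le_one (by positivity), cosh_sq]; linarith
      have h0 : 0 ≤ sinh 1 ^ 2 / cosh 1 ^ 2 := by positivity
      have h2 : |3 / 2 - sinh 1 ^ 2 / cosh 1 ^ 2| ≤ 3 / 2 := by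
        rw [abs_le]; constructor <;> linarith
      have h3 : |(3 / 2 - sinh 1 ^ 2 / cosh 1 ^ 2) * avg φ (sinh 1) +
          sinh 1 * avgDeriv φ' (sinh 1)| ≤ 3 / 2 * 2 + 2 * (2 * (1 / 2)) := by
        refine (abs_add_le _ _).trans ?_
        rw [abs_mul, abs_mul, abs_of_pos hS]
        gcongr
      calc _ ≤ (2 * (3 / 2 * 2 + 2 * (2 * (1 / 2))) : ℝ) := by gcongr
        _ = 10 := by norm_num
    have hE1 : (liouville φ 1 - 1 * liouvilleDeriv φ φ' 1) ^ 2 +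
        liouvilleDeriv φ φ' 1 ^ 2 + 1 ≤ 425 := by
      have h1 : |liouville φ 1 - 1 * liouvilleDeriv φ φ' 1| ≤ 18 := by
        rw [one_mul]; exact (abs_sub _ _).trans (by linarith)
      have := sq_le_sq' (by linarith [abs_le.1 h1]) (abs_le.1 h1).2
      have := sq_le_sq' (by linarith [abs_le.1 hW']) (abs_le.1 hW').2
      linarith
    have hb : (liouville φ u - u * liouvilleDeriv φ φ' u) ^ 2 +
        liouvilleDeriv φ φ' u ^ 2 + 1 ≤ 425 * exp 880 := by
      refine key.trans ?_
      gcongr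
    generalize liouville φ u = w at *
    generalize liouvilleDeriv φ φ' u = p at *
    have h1 : |p| ≤ √(425 * exp 880) := abs_le_sqrt (by nlinarith [sq_nonneg (w - u * p)])
    have h2 : |w - u * p| ≤ √(425 * exp 880) := abs_le_sqrt (by nlinarith [sq_nonneg p])
    refine ⟨?_, h1.trans (by linarith [sqrt_nonneg (425 * exp 880)])⟩
    calc |w| = |(w - u * p) + u * p| := by ring_nf
      _ ≤ √(425 * exp 880) + u * √(425 * exp 880) := by
        refine (abs_add_le _ _).trans ?_
        rw [abs_mul, abs_of_pos (by linarith : 0 < u)]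
        gcongr
      _ ≤ _ := by nlinarith [sqrt_nonneg (425 * exp 880)]
  · have hv0 : 0 < v := by linarith
    have hQ := abs_potential_le_exp hv
    have hN := forcing_le_exp hv
    have hN0 := forcing_pos hv0
    have hu1 : v ≤ exp v := by linarith [add_one_le_exp v]
    have hu2 : v ^ 2 ≤ 2 * exp v := by linarith [quadratic_le_exp_of_nonneg hv0.le]
    have e1 : |potential v| * v ^ 2 ≤ 108 * exp (-(1 / 2) * v) := by
      calc _ ≤ 54 * exp (-2 * v) * (2 * exp v) := by gcongr
        _ = 108 * exp (-v) := by
          rw [show -v = -2 * v + v by ring, exp_add]; ring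
        _ ≤ _ := by gcongr; linarith
    have e2 : forcing v * v ≤ 4 * exp (-(1 / 2) * v) := by
      calc _ ≤ 4 * exp (-(3 / 2) * v) * exp v := by gcongr
        _ = _ := by rw [mul_assoc, ← exp_add]; ring_nf
    generalize liouvilleDeriv φ φ' v = p
    obtain ⟨q, hq⟩ : ∃ q, q = liouville φ v - v * p := ⟨_, rfl⟩
    rw [← hq, show liouville φ v = q + v * p by linarith]
    generalize potential v = Q at *
    generalize forcing v = N at *
    have f1 : |q + v * p| ≤ v * (|q| + |p|) := by
      refine (abs_add_le _ _).trans ?_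
      rw [abs_mul, abs_of_pos hv0]
      nlinarith [abs_nonneg q]
    have f2 : |p - v * q| ≤ v * (|q| + |p|) := by
      refine (abs_sub _ _).trans ?_
      rw [abs_mul, abs_of_pos hv0]
      nlinarith [abs_nonneg p]
    have f3 : (|q| + |p|) ^ 2 ≤ 2 * (q ^ 2 + p ^ 2 + 1) := by
      rw [← sq_abs q, ← sq_abs p]; nlinarith [sq_nonneg (|q| - |p|)]
    have f4 : |q| + |p| ≤ q ^ 2 + p ^ 2 + 1 := by
      rw [← sq_abs q, ← sq_abs p]; nlinarith [sq_nonneg (|q| - 1 / 2), sq_nonneg (|p| - 1 / 2)]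
    calc _ ≤ |2 * (-Q * (q + v * p) - N) * (p - v * q)| := le_abs_self _
      _ = 2 * |-Q * (q + v * p) - N| * |p - v * q| := by rw [abs_mul, abs_mul, abs_two]
      _ ≤ 2 * (|Q| * (v * (|q| + |p|)) + N) * (v * (|q| + |p|)) := by
        gcongr
        refine (abs_sub _ _).trans ?_
        rw [abs_mul, abs_neg, abs_of_pos hN0]
        gcongr
      _ = 2 * (|Q| * v ^ 2) * (|q| + |p|) ^ 2 + 2 * (N * v) * (|q| + |p|) := by ring
      _ ≤ 2 * (108 * exp (-(1 / 2) * v)) * (2 * (q ^ 2 + p ^ 2 + 1)) +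
          2 * (4 * exp (-(1 / 2) * v)) * (q ^ 2 + p ^ 2 + 1) := by gcongr
      _ = _ := by ring

theorem exists_norm_huber_zero_bound {C : ℝ} (hC : 0 < C) : ∃ M : ℝ, ∀ X Y : ℝ,
    2 ≤ X → 0 < Y → Y ≤ C * X →
      ‖huber 0 (fPlus X Y)‖ ≤ M * (X ^ (1 / 2 : ℝ) * log X) := by
  obtain ⟨K, hK0, hK⟩ := exists_liouville_zero_bound
  obtain ⟨φ, φ', h⟩ := exists_isLegendre 0
  rw [zero_pow two_ne_zero, add_zero] at h
  have hK := hK φ φ' h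
  have hl2 : 0 < log 2 := log_pos (by norm_num)
  have hlC : 0 ≤ log (1 + C) := log_nonneg (by linarith)
  refine ⟨5 * K * (1 + C) ^ 2 * (2 + log (1 + C) / log 2), fun X Y hX hY hYX => ?_⟩
  have hX0 : 0 < X := by linarith
  have hlX : log 2 ≤ log X := log_le_log (by norm_num) hX
  refine (h.norm_huber_le_of_deriv (by norm_num) (B := (1 + C) * X * ((1 + C) * √X) *
      (5 * K * ((2 + log (1 + C) / log 2) * log X))) hX hY fun x hx => ?_).trans ?_
  · have hx1 : x ≤ (1 + C) * X := by linarith [hx.2]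
    have hx2 := sqrt_mul_le hX0.le hC.le hx1
    have hx0 : 2 ≤ x := hX.trans hx.1
    have hu := one_le_arcosh hx0
    obtain ⟨h1, h2⟩ := hK _ hu
    have hua : arcosh x ≤ (2 + log (1 + C) / log 2) * log X := by
      have e1 : arcosh x ≤ log (2 * ((1 + C) * X)) := by
        rw [arcosh]
        refine log_le_log (by positivity) ?_
        linarith [sqrt_sq_sub_one_le hx0]
      rw [log_mul (by norm_num) (by positivity), log_mul (by positivity) hX0.ne'] at e1
      have e2 : log (1 + C) ≤ log (1 + C) / log 2 * log X := by
        rw [div_mul_eq_mul_div, le_div_iff₀ hl2]; gcongr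
      linarith
    refine (abs_primitive_coeff_le hx0 h1 h2).trans ?_
    have : 4 * (K * arcosh x) + K ≤ 5 * K * arcosh x := by nlinarith
    calc _ ≤ (1 + C) * X * ((1 + C) * √X) * (5 * K * arcosh x) := by gcongr
      _ ≤ _ := by gcongr
  · rw [rpow_half]
    refine le_of_eq ?_
    field_simp

end Bounds

/-! ### The oscillating main terms -/

section Oscillation

variable {φ φ' : ℝ → ℝ}

/-- The complex amplitude `e^{-itu} (W₁' + i t W₁)`, which is constant up to the potential and the
forcing term. -/
noncomputable def amplitude (φ φ' : ℝ → ℝ) (t u : ℝ) : ℂ :=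
  Complex.exp (((-(t * u) : ℝ) : ℂ) * Complex.I) *
    ((reducedDeriv φ φ' t u : ℂ) + Complex.I * t * (reduced φ t u : ℂ))

lemma IsLegendre.hasDerivAt_amplitude {t u : ℝ} (h : IsLegendre (1 / 4 + t ^ 2) φ φ')
    (ht : t ≠ 0) (hu : 0 < u) :
    HasDerivAt (amplitude φ φ' t) (Complex.exp (((-(t * u) : ℝ) : ℂ) * Complex.I) *
      ((residual u / t ^ 2 - potential u * reduced φ t u : ℝ) : ℂ)) u := by
  have d0 := (h.hasDerivAt_reduced t hu).ofReal_comp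
  have d1 := (h.hasDerivAt_reducedDeriv ht hu).ofReal_comp
  have de : HasDerivAt (fun u : ℝ => Complex.exp (((-(t * u) : ℝ) : ℂ) * Complex.I))
      (Complex.exp (((-(t * u) : ℝ) : ℂ) * Complex.I) * (((-(t * 1) : ℝ) : ℂ) * Complex.I)) u :=
    ((((hasDerivAt_id' u).const_mul t).fun_neg.ofReal_comp).mul_const Complex.I).cexp
  refine (de.fun_mul (d1.fun_add (d0.const_mul (Complex.I * t)))).congr_deriv ?_
  push_cast
  linear_combination (-Complex.exp (-((t : ℂ) * u) * Complex.I) * t ^ 2 * reduced φ t u) *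
    Complex.I_sq

lemma abs_residual_le_exp {u : ℝ} (hu : 1 ≤ u) : |residual u| ≤ 21 * exp (-(3 / 2) * u) := by
  have h1 : 1 ≤ sinh u := hu.trans (self_le_sinh (by linarith))
  have h3 : |9 / 4 - 3 / sinh u ^ 2| ≤ 21 / 4 := by
    have h2 : 3 / sinh u ^ 2 ≤ 3 / 1 ^ 2 := by gcongr
    have h' : 0 < 3 / sinh u ^ 2 := by positivity
    rw [abs_le]; constructor <;> linarith
  rw [residual, abs_mul, abs_of_pos (forcing_pos (by linarith))]
  calc _ ≤ 4 * exp (-(3 / 2) * u) * (21 / 4) := by gcongr; exact forcing_le_exp hu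
    _ = _ := by ring

lemma IsLegendre.norm_amplitude_sub_le {t A : ℝ} (h : IsLegendre (1 / 4 + t ^ 2) φ φ')
    (ht : t ≠ 0) (hA : ∀ u, 1 ≤ u → |reduced φ t u| ≤ A) {u v : ℝ} (hu : 1 ≤ u) (huv : u ≤ v) :
    ‖amplitude φ φ' t v - amplitude φ φ' t u‖ ≤ (21 / t ^ 2 + 54 * A) * exp (-(3 / 2) * u) := by
  have hA0 : 0 ≤ A := (abs_nonneg _).trans (hA 1 le_rfl)
  set B := 21 / t ^ 2 + 54 * A with hB
  have hB0 : 0 ≤ B := by positivity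
  have hd : ∀ x ∈ Ico u v, HasDerivWithinAt (fun x => amplitude φ φ' t x - amplitude φ φ' t u) _
      (Ici x) x := fun x hx =>
    ((h.hasDerivAt_amplitude ht (by linarith [hx.1] : 0 < x)).sub_const _).hasDerivWithinAt
  have hb : ∀ x : ℝ, HasDerivAt
      (fun x => B * (2 / 3) * exp (-(3 / 2) * u) - B * (2 / 3) * exp (-(3 / 2) * x))
      (B * exp (-(3 / 2) * x)) x := fun x => by
    refine (((((hasDerivAt_id' x).const_mul (-(3 / 2))).exp).const_mul
      (B * (2 / 3))).const_sub _).congr_deriv ?_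
    ring
  have key := image_norm_le_of_norm_deriv_right_le_deriv_boundary
    (f := fun x => amplitude φ φ' t x - amplitude φ φ' t u)
    (fun x hx => ((h.hasDerivAt_amplitude ht
      (by linarith [hx.1] : 0 < x)).sub_const _).continuousAt.continuousWithinAt) hd
    (by simp) hb (fun x hx => by
      have hx1 : 1 ≤ x := hu.trans hx.1
      rw [norm_mul, Complex.norm_exp_ofReal_mul_I, one_mul, Complex.norm_real, norm_eq_abs]
      refine (abs_sub _ _).trans ?_
      rw [abs_div, abs_mul, abs_of_pos (by positivity : 0 < t ^ 2)]
      have e1 := abs_residual_le_exp hx1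
      have e2 := abs_potential_le_exp hx1
      have e3 : exp (-2 * x) ≤ exp (-(3 / 2) * x) := by gcongr; linarith
      calc _ ≤ 21 * exp (-(3 / 2) * x) / t ^ 2 + 54 * exp (-(3 / 2) * x) * A := by
            gcongr
            · exact e2.trans (by gcongr)
            · exact hA x hx1
        _ = _ := by rw [hB]; ring) (x := v) ⟨huv, le_rfl⟩
  refine key.trans ?_
  nlinarith [mul_nonneg hB0 (exp_pos (-(3 / 2) * u)).le,
    mul_nonneg hB0 (exp_pos (-(3 / 2) * v)).le]

lemma IsLegendre.exists_tendsto_amplitude {t : ℝ} (h : IsLegendre (1 / 4 + t ^ 2) φ φ')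
    (ht : t ≠ 0) : ∃ Z, Tendsto (amplitude φ φ' t) atTop (𝓝 Z) := by
  obtain ⟨K, hK0, hK⟩ := exists_reduced_bound (δ := min |t| 1) (by positivity) (min_le_right _ _)
  have hA : ∀ u, 1 ≤ u → |reduced φ t u| ≤ √K / (|t| * √|t|) := fun u hu => by
    have := hK |t| φ φ' (min_le_left _ _) (by rwa [sq_abs]) u hu
    simp only [reduced, sq_abs, reducedDeriv] at this ⊢
    exact (abs_reduced_le (abs_pos.2 ht) this).1
  have hlim : Tendsto (fun u => 2 * ((21 / t ^ 2 + 54 * (√K / (|t| * √|t|))) *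
      exp (-(3 / 2) * u))) atTop (𝓝 0) := by
    have : Tendsto (fun u : ℝ => -(3 / 2) * u) atTop atBot :=
      tendsto_id.const_mul_atTop_of_neg (by norm_num)
    simpa using ((tendsto_exp_atBot.comp this).const_mul _).const_mul 2
  refine cauchySeq_tendsto_of_complete (Metric.cauchySeq_iff.2 fun ε hε => ?_)
  obtain ⟨N, hN1, hN⟩ := ((eventually_ge_atTop 1).and (hlim.eventually_lt_const hε)).exists
  refine ⟨N, fun m hm n hn => ?_⟩
  calc dist (amplitude φ φ' t m) (amplitude φ φ' t n)
      ≤ dist (amplitude φ φ' t m) (amplitude φ φ' t N) +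
        dist (amplitude φ φ' t n) (amplitude φ φ' t N) := dist_triangle_right _ _ _
    _ ≤ (21 / t ^ 2 + 54 * (√K / (|t| * √|t|))) * exp (-(3 / 2) * N) +
        (21 / t ^ 2 + 54 * (√K / (|t| * √|t|))) * exp (-(3 / 2) * N) := by
      rw [dist_eq_norm, dist_eq_norm]
      exact add_le_add (h.norm_amplitude_sub_le ht hA hN1 hm)
        (h.norm_amplitude_sub_le ht hA hN1 hn)
    _ < ε := by linarith

/-- The oscillating main term of `primitive φ` when the amplitude tends to `Z`; this is the real
number `X^{5/2} Im ((2X)^{it} Z) / t`. -/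
noncomputable def oscTerm (t : ℝ) (Z : ℂ) (X : ℝ) : ℂ :=
  Z / (2 * Complex.I * t) * (2 : ℂ) ^ (Complex.I * t) * (X : ℂ) ^ (5 / 2 + Complex.I * t)

lemma oscTerm_eq (t : ℝ) (Z : ℂ) {X : ℝ} (hX : 0 < X) :
    oscTerm t Z X = ((X ^ 2 * √X : ℝ) : ℂ) *
      (Complex.exp (((t * log (2 * X) : ℝ) : ℂ) * Complex.I) * Z) / (2 * Complex.I * t) := by
  have hX' : (X : ℂ) ≠ 0 := by exact_mod_cast hX.ne'
  have h2 : (2 : ℂ) = ((2 : ℝ) : ℂ) := by norm_num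
  have e1 : (X : ℂ) ^ (5 / 2 : ℂ) = ((X ^ 2 * √X : ℝ) : ℂ) := by
    rw [sqrt_eq_rpow, ← rpow_natCast, ← rpow_add hX, Complex.ofReal_cpow hX.le]
    norm_num
  have e2 : Complex.exp (((t * log (2 * X) : ℝ) : ℂ) * Complex.I) =
      (2 : ℂ) ^ (Complex.I * t) * (X : ℂ) ^ (Complex.I * t) := by
    rw [Complex.cpow_def_of_ne_zero two_ne_zero, Complex.cpow_def_of_ne_zero hX', ← Complex.exp_add,
      log_mul two_ne_zero hX.ne', h2, ← Complex.ofReal_log (by norm_num),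
      ← Complex.ofReal_log hX.le]
    push_cast
    ring_nf
  rw [oscTerm, Complex.cpow_add _ _ hX', e1, e2]
  ring

lemma oscTerm_add_conj {t : ℝ} (ht : t ≠ 0) (Z : ℂ) {X : ℝ} (hX : 0 < X) :
    oscTerm t Z X + oscTerm (-t) (starRingEnd ℂ Z) X = ((X ^ 2 * √X *
      (Complex.exp (((t * log (2 * X) : ℝ) : ℂ) * Complex.I) * Z).im / t : ℝ) : ℂ) := by
  rw [oscTerm_eq _ _ hX, oscTerm_eq _ _ hX]
  set w := Complex.exp (((t * log (2 * X) : ℝ) : ℂ) * Complex.I) * Z with hw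
  have hc : Complex.exp (((-t * log (2 * X) : ℝ) : ℂ) * Complex.I) * starRingEnd ℂ Z =
      starRingEnd ℂ w := by
    rw [hw, map_mul, ← Complex.exp_conj, map_mul, Complex.conj_ofReal, Complex.conj_I]
    push_cast
    ring_nf
  have him : w - starRingEnd ℂ w = 2 * Complex.I * w.im := by
    rw [Complex.sub_conj]; push_cast; ring
  have htc : (t : ℂ) ≠ 0 := by exact_mod_cast ht
  rw [hc]
  push_cast
  field_simp
  linear_combination ((X : ℂ) ^ 2 * (√X : ℝ)) * him

/-- The coefficient of `X^{1/2+it}` in the Huber transform, as a function of `ρ = X / Y`. -/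
noncomputable def oscCoeff (t : ℝ) (Z : ℂ) (ρ : ℝ) : ℂ :=
  2 / π * (ρ / (2 + 1 / ρ)) * (Z / (2 * Complex.I * t)) * (2 : ℂ) ^ (Complex.I * t) *
    (((1 + 1 / ρ : ℝ) : ℂ) ^ (5 / 2 + Complex.I * t) - 1)

lemma oscTerm_sub (t : ℝ) (Z : ℂ) {X Y : ℝ} (hX : 0 < X) (hY : 0 < Y) :
    ((2 / (π * (Y ^ 2 + 2 * Y * X)) : ℝ) : ℂ) * (oscTerm t Z (X + Y) - oscTerm t Z X) =
      oscCoeff t Z (X / Y) * (X : ℂ) ^ (1 / 2 + Complex.I * t) := by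
  have hX' : (X : ℂ) ≠ 0 := by exact_mod_cast hX.ne'
  have hY' : (Y : ℂ) ≠ 0 := by exact_mod_cast hY.ne'
  have hπ : (π : ℂ) ≠ 0 := by exact_mod_cast pi_ne_zero
  have e1 : X + Y = X * (1 + 1 / (X / Y)) := by field_simp
  have e2 : ((X + Y : ℝ) : ℂ) ^ (5 / 2 + Complex.I * t) = (X : ℂ) ^ (5 / 2 + Complex.I * t) *
      ((1 + 1 / (X / Y) : ℝ) : ℂ) ^ (5 / 2 + Complex.I * t) := by
    rw [e1, Complex.ofReal_mul, Complex.mul_cpow_ofReal_nonneg hX.le (by positivity)]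
  have e3 : (X : ℂ) ^ (5 / 2 + Complex.I * t) = (X : ℂ) ^ 2 *
      (X : ℂ) ^ (1 / 2 + Complex.I * t) := by
    rw [show 5 / 2 + Complex.I * t = (2 : ℕ) + (1 / 2 + Complex.I * t) by push_cast; ring,
      Complex.cpow_add _ _ hX', Complex.cpow_natCast]
  have hden : ((Y : ℂ) + 2 * X) ≠ 0 := by
    exact_mod_cast (by positivity : Y + 2 * X ≠ 0)
  have hden' : (2 * (X : ℂ) + Y) ≠ 0 := by rwa [add_comm] at hden
  have e4 : (X / Y : ℂ) / (2 + 1 / (X / Y : ℂ)) * 2 / π =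
      2 / (π * (Y ^ 2 + 2 * Y * X)) * (X : ℂ) ^ 2 := by
    rw [show (2 + 1 / (X / Y : ℂ)) = (Y + 2 * X) / X by field_simp; ring,
      show ((Y : ℂ) ^ 2 + 2 * Y * X) = Y * (Y + 2 * X) by ring]
    field_simp
  rw [oscTerm, oscTerm, oscCoeff, e2, e3]
  generalize ((1 + 1 / (X / Y) : ℝ) : ℂ) ^ (5 / 2 + Complex.I * t) = P
  push_cast
  linear_combination (-(Z / (2 * Complex.I * t)) * 2 ^ (Complex.I * t) *
    (X : ℂ) ^ (1 / 2 + Complex.I * t) * (P - 1)) * e4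

lemma norm_cpow_half_add (n : ℕ) {x : ℝ} (hx : 0 < x) (t : ℝ) :
    ‖(x : ℂ) ^ ((n : ℂ) + 1 / 2 + Complex.I * t)‖ = x ^ n * √x := by
  rw [Complex.norm_cpow_eq_rpow_re_of_pos hx, sqrt_eq_rpow, ← rpow_natCast, ← rpow_add hx]
  congr 1
  simp

lemma norm_one_add_cpow_sub_one_le {C y : ℝ} (hy : 0 ≤ y) (hyC : y ≤ C) (t : ℝ) :
    ‖((1 + y : ℝ) : ℂ) ^ (5 / 2 + Complex.I * t) - 1‖ ≤ (1 + C) ^ 3 + 1 ∧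
    ‖((1 + y : ℝ) : ℂ) ^ (5 / 2 + Complex.I * t) - 1‖ ≤ (5 / 2 + |t|) * (1 + C) ^ 2 * y := by
  have hC : 0 ≤ C := hy.trans hyC
  have hs : ∀ {x : ℝ}, x ≤ C → √(1 + x) ≤ 1 + C := fun {x} hx => by
    rw [sqrt_le_left (by positivity)]; nlinarith
  constructor
  · refine (norm_sub_le _ _).trans ?_
    rw [show (5 / 2 + Complex.I * t) = ((2 : ℕ) : ℂ) + 1 / 2 + Complex.I * t by push_cast; ring,
      norm_cpow_half_add 2 (by positivity), norm_one]
    gcongr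
    calc _ ≤ (1 + C) ^ 2 * (1 + C) := by gcongr; exact hs hyC
      _ = _ := by ring
  · have hd : ∀ x ∈ Icc 0 C, HasDerivWithinAt
        (fun x : ℝ => ((1 + x : ℝ) : ℂ) ^ (5 / 2 + Complex.I * t))
        ((5 / 2 + Complex.I * t) * ((1 + x : ℝ) : ℂ) ^ (((1 : ℕ) : ℂ) + 1 / 2 + Complex.I * t))
        (Icc 0 C) x := fun x hx => by
      have hx0 : (0 : ℝ) < 1 + x := by linarith [hx.1]
      have d1 : HasDerivAt (fun x : ℝ => ((1 + x : ℝ) : ℂ)) 1 x := by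
        simpa using ((hasDerivAt_id' x).const_add 1).ofReal_comp
      have d2 := (hasDerivAt_id' ((1 + x : ℝ) : ℂ)).cpow_const (c := 5 / 2 + Complex.I * t)
        (Complex.ofReal_mem_slitPlane.2 hx0)
      refine ((HasDerivAt.comp x d2 d1).congr_deriv ?_).hasDerivWithinAt
      rw [mul_one, mul_one, show (((1 : ℕ) : ℂ) + 1 / 2 + Complex.I * t) =
        5 / 2 + Complex.I * t - 1 by push_cast; ring]
    have := (convex_Icc (0 : ℝ) C).norm_image_sub_le_of_norm_hasDerivWithin_le hd
      (C := (5 / 2 + |t|) * (1 + C) ^ 2) (fun x hx => by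
        have hx0 : (0 : ℝ) < 1 + x := by linarith [hx.1]
        rw [norm_mul, norm_cpow_half_add 1 hx0]
        gcongr
        · refine (norm_add_le _ _).trans ?_
          simp
        · calc (1 + x) ^ 1 * √(1 + x) ≤ (1 + C) ^ 1 * (1 + C) := by
                gcongr
                · exact hx.2
                · exact hs hx.2
            _ = _ := by ring) ⟨le_rfl, hC⟩ ⟨hy, hyC⟩
    simpa [abs_of_nonneg hy] using this

lemma norm_oscCoeff_le {δ C A ρ t : ℝ} (hδ : 0 < δ) (hC : 0 < C) (hρ : 0 < ρ) (hρC : 1 / ρ ≤ C)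
    (ht : δ ≤ |t|) {Z : ℂ} (hZ : ‖Z‖ ≤ A / √|t|) :
    ‖oscCoeff t Z ρ‖ ≤ A * ((1 + C) ^ 3 + 1 + (5 / 2 / δ + 1) * (1 + C) ^ 2) *
      min (1 / √|t|) (1 / (|t| * √|t|) * ρ) := by
  have ht0 : 0 < |t| := hδ.trans_le ht
  have hs : 0 < √|t| := sqrt_pos.2 ht0
  have hA : 0 ≤ A := by
    have := (norm_nonneg _).trans hZ
    by_contra hneg
    exact absurd this (not_le.2 (div_neg_of_neg_of_pos (not_le.1 hneg) hs))
  obtain ⟨h1, h2⟩ := norm_one_add_cpow_sub_one_le (y := 1 / ρ) (by positivity) hρC t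
  have h2t : ‖(2 : ℂ) ^ (Complex.I * t)‖ = 1 := by
    rw [show (2 : ℂ) = ((2 : ℝ) : ℂ) by norm_num,
      Complex.norm_cpow_eq_rpow_re_of_pos two_pos]
    simp
  have e1 : ‖(2 / π * (ρ / (2 + 1 / ρ)) : ℂ)‖ ≤ ρ := by
    have : (2 / π * (ρ / (2 + 1 / ρ)) : ℂ) = ((2 / π * (ρ / (2 + 1 / ρ)) : ℝ) : ℂ) := by
      push_cast; ring
    rw [this, Complex.norm_real, norm_of_nonneg (by positivity)]
    calc _ ≤ 1 * (ρ / 1) := by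
          gcongr
          · rw [div_le_one pi_pos]; exact two_le_pi
          · have : 0 < 1 / ρ := by positivity
            linarith
      _ = ρ := by ring
  have e2 : ‖Z / (2 * Complex.I * t)‖ ≤ A / (|t| * √|t|) := by
    rw [norm_div, norm_mul, norm_mul, Complex.norm_I, Complex.norm_real, norm_eq_abs]
    simp only [Complex.norm_ofNat, mul_one]
    calc _ ≤ (A / √|t|) / (1 * |t|) := by gcongr; norm_num
      _ = _ := by field_simp
  have e3 : ∀ D, ‖((1 + 1 / ρ : ℝ) : ℂ) ^ (5 / 2 + Complex.I * t) - 1‖ ≤ D →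
      ‖oscCoeff t Z ρ‖ ≤ ρ * (A / (|t| * √|t|)) * D := fun D hD => by
    rw [oscCoeff, norm_mul, norm_mul, norm_mul, h2t, mul_one]
    gcongr
  have f1 : 0 ≤ (1 + C) ^ 3 + 1 := by positivity
  have f2 : 0 ≤ (5 / 2 / δ + 1) * (1 + C) ^ 2 := by positivity
  rw [mul_min_of_nonneg _ _ (by positivity)]
  refine le_min ((e3 _ h2).trans ?_) ((e3 _ h1).trans ?_)
  · have : 5 / 2 / |t| ≤ 5 / 2 / δ := by gcongr
    calc _ = A * ((5 / 2 / |t| + 1) * (1 + C) ^ 2) * (1 / √|t|) := by field_simp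
      _ ≤ A * (0 + (5 / 2 / δ + 1) * (1 + C) ^ 2) * (1 / √|t|) := by rw [zero_add]; gcongr
      _ ≤ _ := by gcongr
  · calc _ = A * ((1 + C) ^ 3 + 1 + 0) * (1 / (|t| * √|t|) * ρ) := by field_simp; ring
      _ ≤ _ := by gcongr

lemma norm_exp_I_sub_exp_I_le (a b : ℝ) :
    ‖Complex.exp ((a : ℂ) * Complex.I) - Complex.exp ((b : ℂ) * Complex.I)‖ ≤ |a - b| := by
  have e : Complex.exp ((a : ℂ) * Complex.I) - Complex.exp ((b : ℂ) * Complex.I) =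
      Complex.exp ((b : ℂ) * Complex.I) * (Complex.exp (Complex.I * ((a - b : ℝ) : ℂ)) - 1) := by
    rw [mul_sub, ← Complex.exp_add]; push_cast; ring_nf
  rw [e, norm_mul, Complex.norm_exp_ofReal_mul_I, one_mul]
  exact norm_exp_I_mul_ofReal_sub_one_le

lemma sub_sqrt_sq_sub_one_le {X : ℝ} (hX : 2 ≤ X) : X - √(X ^ 2 - 1) ≤ 1 / X := by
  have h1 := half_le_sqrt_sq_sub_one hX
  have hs : √(X ^ 2 - 1) ^ 2 = X ^ 2 - 1 := sq_sqrt (by nlinarith)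
  rw [le_div_iff₀ (by linarith)]
  nlinarith

lemma abs_arcosh_sub_log_le {X : ℝ} (hX : 2 ≤ X) : |arcosh X - log (2 * X)| ≤ 1 / X ^ 2 := by
  have hX0 : 0 < X := by linarith
  have h1 := sqrt_sq_sub_one_le hX
  have h2 := sub_sqrt_sq_sub_one_le hX
  rw [arcosh]
  set S := √(X ^ 2 - 1)
  have hS : 0 ≤ S := sqrt_nonneg _
  have hle : log (X + S) ≤ log (2 * X) := log_le_log (by positivity) (by linarith)
  rw [abs_of_nonpos (by linarith), neg_sub, ← log_div (by positivity) (by positivity)]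
  refine (log_le_sub_one_of_pos (by positivity)).trans ?_
  rw [div_sub_one (by positivity), div_le_div_iff₀ (by positivity) (by positivity)]
  rw [le_div_iff₀ hX0] at h2
  nlinarith

/-- Replacing `√(X² - 1)` by `X` and `arcosh X` by `log (2 X)` in the main term. -/
lemma norm_phase_sub_le {X : ℝ} (hX : 2 ≤ X) (t : ℝ) :
    ‖((√(X ^ 2 - 1) * √√(X ^ 2 - 1) * X : ℝ) : ℂ) *
        Complex.exp (((t * arcosh X : ℝ) : ℂ) * Complex.I) -
      ((X ^ 2 * √X : ℝ) : ℂ) * Complex.exp (((t * log (2 * X) : ℝ) : ℂ) * Complex.I)‖ ≤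
      (2 + |t|) * √X := by
  have hX0 : 0 < X := by linarith
  have h1 := sqrt_sq_sub_one_le hX
  have h2 := sub_sqrt_sq_sub_one_le hX
  have h3 := half_le_sqrt_sq_sub_one hX
  have h4 := abs_arcosh_sub_log_le hX
  have he := norm_exp_I_sub_exp_I_le (t * arcosh X) (t * log (2 * X))
  have hn : ‖Complex.exp (((t * arcosh X : ℝ) : ℂ) * Complex.I)‖ = 1 :=
    Complex.norm_exp_ofReal_mul_I _
  rw [← mul_sub, abs_mul] at he
  set S := √(X ^ 2 - 1)
  generalize Complex.exp (((t * arcosh X : ℝ) : ℂ) * Complex.I) = e₁ at *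
  generalize Complex.exp (((t * log (2 * X) : ℝ) : ℂ) * Complex.I) = e₂ at *
  have hS : 0 < S := by linarith
  have hx : 0 < √X := sqrt_pos.2 hX0
  have hxx : √X ^ 2 = X := sq_sqrt hX0.le
  have hzz : √S ^ 2 = S := sq_sqrt hS.le
  have hz : √S ≤ √X := sqrt_le_sqrt h1
  have hz0 : 0 < √S := sqrt_pos.2 hS
  have e : ((S * √S * X : ℝ) : ℂ) * e₁ - ((X ^ 2 * √X : ℝ) : ℂ) * e₂ =
      ((S * √S * X - X ^ 2 * √X : ℝ) : ℂ) * e₁ + ((X ^ 2 * √X : ℝ) : ℂ) * (e₁ - e₂) := by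
    push_cast; ring
  have b1 : |S * √S * X - X ^ 2 * √X| ≤ 2 * √X := by
    have g1 : √X - √S ≤ 1 / X / √X := by
      rw [le_div_iff₀ hx]
      nlinarith [mul_nonneg hz0.le (sub_nonneg.2 hz)]
    have g2 : S * √S * X ≤ X ^ 2 * √X := by
      calc S * √S * X ≤ X * √X * X := by gcongr
        _ = _ := by ring
    rw [abs_sub_comm, abs_of_nonneg (by linarith)]
    calc X ^ 2 * √X - S * √S * X = (X - S) * √X * X + S * (√X - √S) * X := by ring
      _ ≤ 1 / X * √X * X + X * (1 / X / √X) * X := by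
        gcongr
      _ = √X + X / √X := by field_simp
      _ = 2 * √X := by
        rw [show X / √X = √X by rw [div_eq_iff hx.ne', ← sq, hxx]]; ring
  rw [e]
  refine (norm_add_le _ _).trans ?_
  rw [norm_mul, norm_mul, hn, mul_one, Complex.norm_real, Complex.norm_real, norm_eq_abs,
    norm_of_nonneg (by positivity : 0 ≤ X ^ 2 * √X)]
  calc _ ≤ 2 * √X + X ^ 2 * √X * (|t| * (1 / X ^ 2)) := by
        gcongr
        exact he.trans (by gcongr)
    _ = _ := by field_simp

lemma reduced_eq_im (φ φ' : ℝ → ℝ) {t : ℝ} (ht : t ≠ 0) (u : ℝ) :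
    reduced φ t u =
      (Complex.exp (((t * u : ℝ) : ℂ) * Complex.I) * amplitude φ φ' t u).im / t := by
  rw [amplitude, ← mul_assoc, ← Complex.exp_add]
  have : ((t * u : ℝ) : ℂ) * Complex.I + ((-(t * u) : ℝ) : ℂ) * Complex.I = 0 := by
    push_cast; ring
  rw [this, Complex.exp_zero, one_mul]
  simp [mul_div_cancel_left₀ _ ht]

/-- For `|t| ≪ X` the function `primitive φ` is its oscillating main term up to `O(X / |t|)`, if
`Z` is the limit of the amplitude; moreover `Z` is `O(|t|^{-1/2})`. -/
theorem exists_primitive_sub_oscTerm_bound {δ c : ℝ} (hδ : 0 < δ) (hδ1 : δ ≤ 1) (hc : 0 < c) :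
    ∃ K : ℝ, 0 < K ∧ ∀ (t : ℝ) (φ φ' : ℝ → ℝ) (Z : ℂ), δ ≤ |t| →
      IsLegendre (1 / 4 + t ^ 2) φ φ' → Tendsto (amplitude φ φ' t) atTop (𝓝 Z) →
      ‖Z‖ ≤ K / √|t| ∧ ∀ X, 2 ≤ X → c ^ 2 * |t| ≤ X →
        ‖(primitive φ X : ℂ) - (oscTerm t Z X + oscTerm (-t) (starRingEnd ℂ Z) X)‖ ≤
          K * (X / |t|) := by
  obtain ⟨K, hK0, hK⟩ := exists_reduced_bound hδ hδ1
  set B : ℝ := 21 / δ ^ 2 + 54 * (√K / (δ * √δ)) with hB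
  have hsδ : 0 < √δ := sqrt_pos.2 hδ
  have hB0 : 0 < B := by positivity
  refine ⟨2 * √K + (B + 2 * √K * (1 / c + 2 / δ) + 1 / δ), by positivity,
    fun t φ φ' Z ht h hZ => ?_⟩
  have hτ0 : 0 < |t| := hδ.trans_le ht
  have ht0 : t ≠ 0 := abs_pos.1 hτ0
  set τ := |t| with hτ
  have hs : 0 < √τ := sqrt_pos.2 hτ0
  have hss : √τ ^ 2 = τ := sq_sqrt hτ0.le
  have hwp : ∀ u, 1 ≤ u → |reduced φ t u| ≤ √K / (τ * √τ) ∧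
      |reducedDeriv φ φ' t u| ≤ √K / √τ := fun u hu => by
    have := hK τ φ φ' ht (by rwa [hτ, sq_abs]) u hu
    simp only [reduced, hτ, sq_abs, reducedDeriv] at this ⊢
    exact abs_reduced_le hτ0 this
  have hA : ∀ u, 1 ≤ u → |reduced φ t u| ≤ √K / (δ * √δ) := fun u hu =>
    (hwp u hu).1.trans (by gcongr)
  have hbd : ∀ u, 1 ≤ u → ‖amplitude φ φ' t u‖ ≤ 2 * √K / √τ := fun u hu => by
    obtain ⟨h1, h2⟩ := hwp u hu
    rw [amplitude, norm_mul, Complex.norm_exp_ofReal_mul_I, one_mul]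
    refine (norm_add_le _ _).trans ?_
    rw [norm_mul, norm_mul, Complex.norm_I, one_mul, Complex.norm_real, Complex.norm_real,
      Complex.norm_real, norm_eq_abs, norm_eq_abs, norm_eq_abs]
    calc _ ≤ √K / √τ + τ * (√K / (τ * √τ)) := by gcongr
      _ = _ := by field_simp; ring
  have hZn : ‖Z‖ ≤ 2 * √K / √τ := le_of_tendsto hZ.norm
    ((eventually_ge_atTop 1).mono hbd)
  have htail : ∀ u, 1 ≤ u → ‖Z - amplitude φ φ' t u‖ ≤ B * exp (-(3 / 2) * u) := fun u hu => by
    refine le_of_tendsto (hZ.sub_const _).norm ((eventually_ge_atTop u).mono fun v hv => ?_)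
    refine (h.norm_amplitude_sub_le ht0 hA hu hv).trans ?_
    have : δ ^ 2 ≤ t ^ 2 := by rw [← sq_abs t]; gcongr
    rw [hB]
    gcongr
  have hr : 0 ≤ B + 2 * √K * (1 / c + 2 / δ) + 1 / δ := by positivity
  refine ⟨hZn.trans (by gcongr; linarith), fun X hX hcX => ?_⟩
  have hX0 : 0 < X := by linarith
  have hx : 0 < √X := sqrt_pos.2 hX0
  have hxx : √X ^ 2 = X := sq_sqrt hX0.le
  rw [oscTerm_add_conj ht0 _ hX0, ← Complex.ofReal_sub, Complex.norm_real, norm_eq_abs,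
    primitive_eq_reduced φ t (by linarith), reduced_eq_im φ φ' ht0]
  have h1 := sqrt_sq_sub_one_le hX
  have hph := norm_phase_sub_le hX t
  have htl := htail _ (one_le_arcosh hX)
  have hexp : exp (-(3 / 2) * arcosh X) ≤ 1 / (X * √X) := by
    have g1 : X ≤ exp (arcosh X) := by
      rw [exp_arcosh (by linarith)]; linarith [sqrt_nonneg (X ^ 2 - 1)]
    have g2 : √X ≤ exp (1 / 2 * arcosh X) := by
      rw [sqrt_le_left (exp_pos _).le, ← exp_nat_mul]
      push_cast
      rw [← mul_assoc]
      norm_num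
      exact g1
    rw [show -(3 / 2) * arcosh X = -(arcosh X + 1 / 2 * arcosh X) by ring, exp_neg, exp_add,
      ← one_div]
    gcongr
  set S := √(X ^ 2 - 1)
  have hS0 : 0 ≤ S := sqrt_nonneg _
  have hz : √S ≤ √X := sqrt_le_sqrt h1
  have hn : ‖Complex.exp (((t * arcosh X : ℝ) : ℂ) * Complex.I)‖ = 1 :=
    Complex.norm_exp_ofReal_mul_I _
  generalize Complex.exp (((t * arcosh X : ℝ) : ℂ) * Complex.I) = e₁ at *
  generalize Complex.exp (((t * log (2 * X) : ℝ) : ℂ) * Complex.I) = e₂ at *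
  generalize amplitude φ φ' t (arcosh X) = Z₁ at *
  have key : S * √S * X * ((e₁ * Z₁).im / t) - S / t ^ 2 - X ^ 2 * √X * (e₂ * Z).im / t =
      ((((S * √S * X : ℝ) : ℂ) * e₁ * (Z₁ - Z)).im +
        ((((S * √S * X : ℝ) : ℂ) * e₁ - ((X ^ 2 * √X : ℝ) : ℂ) * e₂) * Z).im) / t - S / t ^ 2 := by
    have : ((((S * √S * X : ℝ) : ℂ) * e₁ * (Z₁ - Z)).im +
        ((((S * √S * X : ℝ) : ℂ) * e₁ - ((X ^ 2 * √X : ℝ) : ℂ) * e₂) * Z).im) =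
        S * √S * X * (e₁ * Z₁).im - X ^ 2 * √X * (e₂ * Z).im := by
      rw [← Complex.add_im, ← Complex.im_ofReal_mul, ← Complex.im_ofReal_mul, ← Complex.sub_im]
      congr 1
      push_cast
      ring
    rw [this]; ring
  rw [key]
  -- the amplitude differs from its limit by `O(X^{-3/2})`, as `e^{-3u/2} ≤ X^{-3/2}`
  have b1 : |(((S * √S * X : ℝ) : ℂ) * e₁ * (Z₁ - Z)).im| ≤ B * X := by
    refine (Complex.abs_im_le_norm _).trans ?_
    rw [norm_mul, norm_mul, hn, mul_one, Complex.norm_real,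
      norm_of_nonneg (by positivity : 0 ≤ S * √S * X), norm_sub_rev]
    calc _ ≤ X * √X * X * (B * (1 / (X * √X))) := by
          gcongr
          exact htl.trans (by gcongr)
      _ = _ := by field_simp
  have b2 : |((((S * √S * X : ℝ) : ℂ) * e₁ - ((X ^ 2 * √X : ℝ) : ℂ) * e₂) * Z).im| ≤
      2 * √K * (1 / c + 2 / δ) * X := by
    refine (Complex.abs_im_le_norm _).trans ?_
    rw [norm_mul]
    have g1 : √τ ≤ √X / c := by
      rw [le_div_iff₀ hc]
      refine le_sqrt_of_sq_le ?_
      rw [mul_pow, hss]; linarith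
    have g2 : 2 * √X / √τ ≤ 2 / δ * X := by
      have hδs : δ ≤ √τ := le_sqrt_of_sq_le (by nlinarith)
      have : √X ≤ X := by rw [sqrt_le_left hX0.le]; nlinarith
      calc _ ≤ 2 * X / δ := by gcongr
        _ = _ := by ring
    calc _ ≤ (2 + τ) * √X * (2 * √K / √τ) := by gcongr
      _ = 2 * √K * (√X * (√τ ^ 2 / √τ) + 2 * √X / √τ) := by rw [hss]; ring
      _ = 2 * √K * (√X * √τ + 2 * √X / √τ) := by
        rw [show √τ ^ 2 / √τ = √τ by field_simp]
      _ ≤ 2 * √K * (√X * (√X / c) + 2 / δ * X) := by gcongr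
      _ = 2 * √K * (√X ^ 2 / c + 2 / δ * X) := by ring
      _ = _ := by rw [hxx]; ring
  have b3 : |S / t ^ 2| ≤ 1 / δ * (X / τ) := by
    rw [abs_of_nonneg (by positivity), ← sq_abs t, ← hτ]
    calc S / τ ^ 2 ≤ X / (δ * τ) := by
          rw [sq]; gcongr
      _ = _ := by field_simp
  calc _ ≤ (B * X + 2 * √K * (1 / c + 2 / δ) * X) / τ + 1 / δ * (X / τ) := by
        refine (abs_sub _ _).trans (add_le_add ?_ b3)
        rw [abs_div, ← hτ]
        gcongr
        exact (abs_add_le _ _).trans (add_le_add b1 b2)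
    _ = (0 + (B + 2 * √K * (1 / c + 2 / δ) + 1 / δ)) * (X / τ) := by ring
    _ ≤ _ := by gcongr; positivity

/-- The asymptotic formula for real `t` with oscillating main terms. -/
theorem exists_huber_oscillation : ∃ a b : ℝ → ℝ → ℂ, ∀ δ c C : ℝ, 0 < δ → 0 < c → 0 < C →
    ∃ M : ℝ, ∀ X Y t : ℝ,
      2 ≤ X → c * X ^ (1 / 2 : ℝ) ≤ Y → Y ≤ C * X → δ ≤ |t| → |t| ≤ X ^ 2 / Y ^ 2 →
      ‖huber t (fPlus X Y) -
          (a t (X / Y) * (X : ℂ) ^ (1 / 2 + Complex.I * t) +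
            b t (X / Y) * (X : ℂ) ^ (1 / 2 - Complex.I * t))‖ ≤ M * |t| ^ (-(3 / 2) : ℝ) ∧
      ‖a t (X / Y)‖ ≤ M * min (|t| ^ (-(1 / 2) : ℝ)) (|t| ^ (-(3 / 2) : ℝ) * (X / Y)) ∧
      ‖b t (X / Y)‖ ≤ M * min (|t| ^ (-(1 / 2) : ℝ)) (|t| ^ (-(3 / 2) : ℝ) * (X / Y)) := by
  choose φ φ' h using exists_isLegendre
  -- the limit of the amplitude; its value at `t = 0` plays no role
  have hlim : ∀ t : ℝ, ∃ Z, t ≠ 0 → Tendsto (amplitude (φ t) (φ' t) t) atTop (𝓝 Z) := fun t => by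
    by_cases ht : t = 0
    · exact ⟨0, fun h => absurd ht h⟩
    · obtain ⟨Z, hZ⟩ := (h t).exists_tendsto_amplitude ht
      exact ⟨Z, fun _ => hZ⟩
  choose Z hZ using hlim
  refine ⟨fun t => oscCoeff t (Z t), fun t => oscCoeff (-t) (starRingEnd ℂ (Z t)),
    fun δ c C hδ hc hC => ?_⟩
  obtain ⟨K, hK0, hK⟩ := exists_primitive_sub_oscTerm_bound (δ := min δ 1) (by positivity)
    (min_le_right _ _) hc
  set M₁ : ℝ := K * ((1 + C) ^ 3 + 1 + (5 / 2 / δ + 1) * (1 + C) ^ 2)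
  have hM₁ : 0 < M₁ := by positivity
  refine ⟨M₁ + K * (2 + C) / c ^ 2, fun X Y t hX hcY hYX ht htX => ?_⟩
  have hX0 : 0 < X := by linarith
  have hx : 0 < √X := sqrt_pos.2 hX0
  have hxx : √X ^ 2 = X := sq_sqrt hX0.le
  rw [rpow_half] at hcY
  have hY : 0 < Y := lt_of_lt_of_le (by positivity) hcY
  have hτ0 : 0 < |t| := hδ.trans_le ht
  have ht0 : t ≠ 0 := abs_pos.1 hτ0
  obtain ⟨hZn, hmain⟩ := hK t (φ t) (φ' t) (Z t) ((min_le_left _ _).trans ht) (h t) (hZ t ht0)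
  -- the range of `t` and the lower bound for `Y` together give `|t| ≪ X`
  have hcX : c ^ 2 * |t| ≤ X := by
    have h1 : c ^ 2 * X ≤ Y ^ 2 := by rw [← hxx, ← mul_pow]; gcongr
    have h2 : |t| * Y ^ 2 ≤ X ^ 2 := by rwa [le_div_iff₀ (by positivity)] at htX
    have h3 : c ^ 2 * |t| * X ≤ X * X := by nlinarith
    exact le_of_mul_le_mul_right h3 hX0
  have hρ : 0 < X / Y := by positivity
  have hρC : 1 / (X / Y) ≤ C := by
    rw [one_div_div, div_le_iff₀ hX0]; exact hYX
  have hKcC : 0 ≤ K * (2 + C) / c ^ 2 := by positivity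
  rw [rpow_neg_half hτ0.le, rpow_neg_three_halves hτ0]
  refine ⟨?_, (norm_oscCoeff_le hδ hC hρ hρC ht hZn).trans ?_,
    (norm_oscCoeff_le (t := -t) hδ hC hρ hρC (by rwa [abs_neg])
      (by rwa [abs_neg, RCLike.norm_conj])).trans ?_⟩
  · have hl : 1 / 4 + (t : ℂ) ^ 2 = ((1 / 4 + t ^ 2 : ℝ) : ℂ) := by push_cast; ring
    have e1 := oscTerm_sub t (Z t) hX0 hY
    have e2 := oscTerm_sub (-t) (starRingEnd ℂ (Z t)) hX0 hY
    have m1 := hmain X hX hcX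
    have m2 := hmain (X + Y) (by linarith) (by linarith)
    rw [huber_fPlus (h t) hl (by linarith) hY]
    rw [show (1 / 2 - Complex.I * t : ℂ) = 1 / 2 + Complex.I * ((-t : ℝ) : ℂ) by
      push_cast; ring, ← e1, ← e2]
    set P := oscTerm t (Z t) X
    set P' := oscTerm (-t) (starRingEnd ℂ (Z t)) X
    set R := oscTerm t (Z t) (X + Y)
    set R' := oscTerm (-t) (starRingEnd ℂ (Z t)) (X + Y)
    set H := 2 / (π * (Y ^ 2 + 2 * Y * X)) with hH
    have hH0 : 0 < H := by positivity
    have hHle : H ≤ 1 / (Y * X) := by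
      calc H ≤ 2 / (2 * (0 + Y * X)) := by
            rw [hH]; gcongr
            · exact two_le_pi
            · positivity
            · nlinarith [mul_pos hY hX0]
        _ = _ := by field_simp; ring
    have e : ((H * (primitive (φ t) (X + Y) - primitive (φ t) X) : ℝ) : ℂ) -
        ((H : ℂ) * (R - P) + (H : ℂ) * (R' - P')) =
        H * (((primitive (φ t) (X + Y) : ℂ) - (R + R')) -
          ((primitive (φ t) X : ℂ) - (P + P'))) := by push_cast; ring
    rw [e, norm_mul, Complex.norm_real, norm_of_nonneg hH0.le]
    have hs : 0 < √|t| := sqrt_pos.2 hτ0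
    have hcs : c * √|t| ≤ √X := by
      refine le_sqrt_of_sq_le ?_
      rw [mul_pow, sq_sqrt hτ0.le]; exact hcX
    calc _ ≤ 1 / (Y * X) * (K * ((1 + C) * X / |t|) + K * (X / |t|)) := by
          gcongr
          refine (norm_sub_le _ _).trans (add_le_add (m2.trans ?_) m1)
          gcongr
          linarith
      _ = K * (2 + C) / (Y * |t|) := by field_simp; ring
      _ ≤ K * (2 + C) / (c * (c * √|t|) * |t|) := by
        gcongr
        exact (mul_le_mul_of_nonneg_left hcs hc.le).trans hcY
      _ = (0 + K * (2 + C) / c ^ 2) * (1 / (|t| * √|t|)) := by field_simp; ring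
      _ ≤ _ := by gcongr
  · gcongr; linarith
  · rw [abs_neg]; gcongr; linarith

end Oscillation

/-! ### Solutions by integral representations -/

section HyperbolicIntegral

/-- `sinh u + cosh u cosh θ`; for each `s` its power `-s`, as a function of `(u, θ)`, is an
eigenfunction of a wave operator, and integrating out `θ` leaves the Huber equation. -/
noncomputable def base (u θ : ℝ) : ℝ := sinh u + cosh u * cosh θ

/-- The derivative of `base` in `u`. -/
noncomputable def baseDeriv (u θ : ℝ) : ℝ := cosh u + sinh u * cosh θ

lemma exp_neg_mul_cosh_le_base {R u : ℝ} (hu : |u| ≤ R) (θ : ℝ) :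
    exp (-R) * cosh θ ≤ base u θ := by
  have h1 := one_le_cosh θ
  have h2 : exp (-R) ≤ cosh u - |sinh u| := by
    have h3 : exp (-R) ≤ exp (-|u|) := by gcongr
    have h4 : exp (-|u|) = cosh u - |sinh u| := by
      rw [abs_sinh, ← cosh_abs u, cosh_sub_sinh]
    linarith
  rw [base]
  nlinarith [neg_abs_le (sinh u), abs_nonneg (sinh u)]

lemma base_pos (u θ : ℝ) : 0 < base u θ :=
  lt_of_lt_of_le (mul_pos (exp_pos _) (cosh_pos θ)) (exp_neg_mul_cosh_le_base le_rfl θ)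

lemma base_sq_sub (u θ : ℝ) : base u θ ^ 2 - baseDeriv u θ ^ 2 = sinh θ ^ 2 := by
  rw [base, baseDeriv]
  linear_combination (cosh θ ^ 2 - 1) * cosh_sq u + cosh_sq θ

lemma abs_baseDeriv_le (u θ : ℝ) : |baseDeriv u θ| ≤ base u θ := by
  refine abs_le_of_sq_le_sq ?_ (base_pos u θ).le
  nlinarith [base_sq_sub u θ, sq_nonneg (sinh θ)]

lemma hasDerivAt_base (u θ : ℝ) : HasDerivAt (fun u => base u θ) (baseDeriv u θ) u :=
  (hasDerivAt_sinh u).fun_add ((hasDerivAt_cosh u).mul_const _)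

lemma hasDerivAt_baseDeriv (u θ : ℝ) : HasDerivAt (fun u => baseDeriv u θ) (base u θ) u :=
  ((hasDerivAt_cosh u).fun_add ((hasDerivAt_sinh u).mul_const _)).congr_deriv (by rw [base])

lemma continuous_base_rpow (u s : ℝ) : Continuous fun θ => base u θ ^ s :=
  Continuous.rpow_const (by unfold base; fun_prop) fun θ => Or.inl (base_pos u θ).ne'

lemma continuous_cosh_rpow (s : ℝ) : Continuous fun θ => cosh θ ^ s :=
  continuous_cosh.rpow_const fun θ => Or.inl (cosh_pos θ).ne'

lemma integrableOn_cosh_rpow {s : ℝ} (hs : 0 < s) :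
    IntegrableOn (fun θ => cosh θ ^ (-s)) (Ioi 0) := by
  have h1 : IntegrableOn (fun θ => 2 ^ s * exp (-s * θ)) (Ioi 0) :=
    (integrableOn_exp_mul_Ioi (by linarith) 0).const_mul _
  refine h1.mono' (continuous_cosh_rpow _).aestronglyMeasurable ?_
  filter_upwards with θ
  have h2 : exp θ / 2 ≤ cosh θ := by rw [cosh_eq]; linarith [exp_pos (-θ)]
  rw [norm_of_nonneg (rpow_nonneg (cosh_pos θ).le _)]
  calc cosh θ ^ (-s) ≤ (exp θ / 2) ^ (-s) :=
        rpow_le_rpow_of_nonpos (by positivity) h2 (by linarith)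
    _ = 2 ^ s * exp (-s * θ) := by
      rw [div_rpow (exp_pos _).le two_pos.le, ← exp_mul, rpow_neg two_pos.le, div_inv_eq_mul,
        mul_comm]
      ring_nf

lemma base_rpow_le {R u s : ℝ} (hs : 0 < s) (hu : |u| ≤ R) (θ : ℝ) :
    base u θ ^ (-s) ≤ exp (R * s) * cosh θ ^ (-s) := by
  calc base u θ ^ (-s) ≤ (exp (-R) * cosh θ) ^ (-s) :=
        rpow_le_rpow_of_nonpos (mul_pos (exp_pos _) (cosh_pos θ))
          (exp_neg_mul_cosh_le_base hu θ) (by linarith)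
    _ = _ := by
      rw [mul_rpow (exp_pos _).le (cosh_pos _).le, ← exp_mul]; ring_nf

lemma integrableOn_base_rpow {s : ℝ} (hs : 0 < s) (u : ℝ) :
    IntegrableOn (fun θ => base u θ ^ (-s)) (Ioi 0) := by
  refine ((integrableOn_cosh_rpow hs).const_mul (exp (|u| * s))).mono'
    (continuous_base_rpow _ _).aestronglyMeasurable ?_
  filter_upwards with θ
  rw [norm_of_nonneg (rpow_nonneg (base_pos u θ).le _)]
  exact base_rpow_le hs le_rfl θ

/-- The derivative in `u` of `base u θ ^ (-s)`. -/
noncomputable def wave (s u θ : ℝ) : ℝ := -s * base u θ ^ (-s - 1) * baseDeriv u θ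

/-- The second derivative in `u` of `base u θ ^ (-s)`. -/
noncomputable def waveDeriv (s u θ : ℝ) : ℝ :=
  s * (s + 1) * base u θ ^ (-s - 2) * baseDeriv u θ ^ 2 - s * base u θ ^ (-s)

lemma base_rpow_sub_one (s u θ : ℝ) : base u θ ^ (-s - 1) = base u θ ^ (-s) / base u θ :=
  rpow_sub_one (base_pos u θ).ne' _

lemma base_rpow_sub_two (s u θ : ℝ) : base u θ ^ (-s - 2) = base u θ ^ (-s) / base u θ ^ 2 := by
  rw [rpow_sub (base_pos u θ), rpow_two]

lemma hasDerivAt_base_rpow (s u θ : ℝ) :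
    HasDerivAt (fun u => base u θ ^ (-s)) (wave s u θ) u := by
  refine ((hasDerivAt_base u θ).rpow_const (p := -s) (Or.inl (base_pos u θ).ne')).congr_deriv ?_
  rw [wave]; ring

lemma hasDerivAt_wave (s u θ : ℝ) :
    HasDerivAt (fun u => wave s u θ) (waveDeriv s u θ) u := by
  have d := (hasDerivAt_base u θ).rpow_const (p := -s - 1) (Or.inl (base_pos u θ).ne')
  refine ((d.const_mul (-s)).fun_mul (hasDerivAt_baseDeriv u θ)).congr_deriv ?_
  have hb := (base_pos u θ).ne'
  rw [waveDeriv, base_rpow_sub_one, show -s - 1 - 1 = -s - 2 by ring]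
  field_simp
  ring

lemma abs_wave_le {s : ℝ} (hs : 0 < s) (u θ : ℝ) : |wave s u θ| ≤ s * base u θ ^ (-s) := by
  have hb := base_pos u θ
  have hbs : 0 < base u θ ^ (-s) := rpow_pos_of_pos hb _
  rw [wave, base_rpow_sub_one, abs_mul, abs_mul, abs_neg, abs_of_pos hs,
    abs_of_pos (by positivity)]
  calc _ ≤ s * (base u θ ^ (-s) / base u θ) * base u θ := by
        gcongr; exact abs_baseDeriv_le u θ
    _ = _ := by field_simp

lemma abs_waveDeriv_le {s : ℝ} (hs : 0 < s) (u θ : ℝ) :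
    |waveDeriv s u θ| ≤ s * (s + 2) * base u θ ^ (-s) := by
  have hb := base_pos u θ
  have hbs : 0 < base u θ ^ (-s) := rpow_pos_of_pos hb _
  have h1 : baseDeriv u θ ^ 2 ≤ base u θ ^ 2 := by
    rw [← sq_abs]; gcongr; exact abs_baseDeriv_le u θ
  rw [waveDeriv, base_rpow_sub_two]
  refine (abs_sub _ _).trans ?_
  rw [abs_of_nonneg (by positivity), abs_of_pos (by positivity)]
  calc _ ≤ s * (s + 1) * (base u θ ^ (-s) / base u θ ^ 2) * base u θ ^ 2 +
        s * base u θ ^ (-s) := by gcongr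
    _ = _ := by field_simp; ring

lemma continuous_wave (s u : ℝ) : Continuous fun θ => wave s u θ := by
  unfold wave
  exact (continuous_const.mul (continuous_base_rpow u _)).mul (by unfold baseDeriv; fun_prop)

lemma continuous_waveDeriv (s u : ℝ) : Continuous fun θ => waveDeriv s u θ := by
  unfold waveDeriv
  exact ((continuous_const.mul (continuous_base_rpow u _)).mul
    (by unfold baseDeriv; fun_prop)).sub (continuous_const.mul (continuous_base_rpow u _))

/-- The solution `Ψ_s(u) = ∫_0^∞ (sinh u + cosh u cosh θ)^{-s} dθ`, which is a multiple of
`x^{-s} (1 + O(x⁻²))` for `x = sinh u → ∞`. -/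
noncomputable def decaying (s u : ℝ) : ℝ := ∫ θ in Ioi 0, base u θ ^ (-s)

/-- The derivative of `decaying s`. -/
noncomputable def decayingDeriv (s u : ℝ) : ℝ := ∫ θ in Ioi 0, wave s u θ

lemma hasDerivAt_integral_Ioi {F F' : ℝ → ℝ → ℝ} {s B : ℝ} (hs : 0 < s) (hB : 0 ≤ B)
    (hFc : ∀ u, Continuous (F u)) (hFc' : ∀ u, Continuous (F' u)) (u : ℝ)
    (hF : IntegrableOn (F u) (Ioi 0)) (hd : ∀ u θ, HasDerivAt (fun u => F u θ) (F' u θ) u)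
    (hb : ∀ u θ, |F' u θ| ≤ B * base u θ ^ (-s)) :
    IntegrableOn (F' u) (Ioi 0) ∧
      HasDerivAt (fun u => ∫ θ in Ioi 0, F u θ) (∫ θ in Ioi 0, F' u θ) u := by
  refine hasDerivAt_integral_of_dominated_loc_of_deriv_le (F := F) (F' := F')
    (bound := fun θ => B * (exp ((|u| + 1) * s) * cosh θ ^ (-s)))
    (Metric.closedBall_mem_nhds u one_pos) ?_ hF ?_ ?_ ?_ ?_
  · exact Eventually.of_forall fun x => (hFc x).aestronglyMeasurable
  · exact (hFc' u).aestronglyMeasurable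
  · refine Eventually.of_forall fun θ x hx => (hb x θ).trans ?_
    have hx1 : |x| ≤ |u| + 1 := by
      have h1 : |x - u| ≤ 1 := by simpa [dist_eq_norm] using hx
      have h2 := abs_add_le (x - u) u
      rw [sub_add_cancel] at h2
      linarith
    gcongr
    exact base_rpow_le hs hx1 θ
  · exact ((integrableOn_cosh_rpow hs).const_mul _).const_mul _
  · exact Eventually.of_forall fun θ x _ => hd x θ

lemma hasDerivAt_decaying {s : ℝ} (hs : 0 < s) (u : ℝ) :
    IntegrableOn (wave s u) (Ioi 0) ∧ HasDerivAt (decaying s) (decayingDeriv s u) u :=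
  hasDerivAt_integral_Ioi hs hs.le (fun u => continuous_base_rpow u _) (continuous_wave s) u
    (integrableOn_base_rpow hs u) (fun u θ => hasDerivAt_base_rpow s u θ)
    (fun u θ => abs_wave_le hs u θ)

/-- `Ψ_s` solves the equation because `base u θ ^ (-s)` is an eigenfunction up to a total
derivative in `θ`. -/
lemma hasDerivAt_decayingDeriv {s : ℝ} (hs : 0 < s) (u : ℝ) :
    HasDerivAt (decayingDeriv s)
      (-(sinh u / cosh u) * decayingDeriv s u - s * (1 - s) * decaying s u) u := by
  obtain ⟨i1, -⟩ := hasDerivAt_decaying hs u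
  obtain ⟨i2, d⟩ := hasDerivAt_integral_Ioi hs (by positivity : 0 ≤ s * (s + 2))
    (continuous_wave s) (continuous_waveDeriv s) u i1 (fun u θ => hasDerivAt_wave s u θ)
    (fun u θ => abs_waveDeriv_le hs u θ)
  refine d.congr_deriv ?_
  have hC := cosh_pos u
  have i0 := integrableOn_base_rpow hs u
  -- the total derivative; its primitive vanishes at `θ = 0` and at infinity
  have hF : ∀ θ ∈ Ici (0 : ℝ), HasDerivAt
      (fun θ => -s * base u θ ^ (-s - 1) * (cosh u * sinh θ))
      (-cosh u ^ 2 * (waveDeriv s u θ + sinh u / cosh u * wave s u θ +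
        s * (1 - s) * base u θ ^ (-s))) θ := fun θ _ => by
    have db : HasDerivAt (fun θ => base u θ) (cosh u * sinh θ) θ :=
      ((hasDerivAt_cosh θ).const_mul _).const_add _
    have d1 := db.rpow_const (p := -s - 1) (Or.inl (base_pos u θ).ne')
    refine ((d1.const_mul (-s)).fun_mul ((hasDerivAt_sinh θ).const_mul (cosh u))).congr_deriv ?_
    have hb := (base_pos u θ).ne'
    rw [waveDeriv, wave, show -s - 1 - 1 = -s - 2 by ring, base_rpow_sub_one, base_rpow_sub_two]
    have e1 := base_sq_sub u θ
    have e2 : base u θ = sinh u + cosh u * cosh θ := rfl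
    have e3 : baseDeriv u θ = cosh u + sinh u * cosh θ := rfl
    have e4 : cosh u * cosh θ + cosh u * sinh u * baseDeriv u θ = cosh u ^ 2 * base u θ := by
      rw [e2, e3]; linear_combination (-(cosh u * cosh θ)) * cosh_sq u
    generalize base u θ ^ (-s) = P
    generalize base u θ = b at *
    generalize baseDeriv u θ = b' at *
    have e5 : (-s * ((-s - 1) * 1) * (cosh u * sinh θ) ^ 2 - s * b * (cosh u * cosh θ)) =
        -cosh u ^ 2 * (s * (s + 1) * b' ^ 2 - s * b ^ 2 - s * b * (sinh u / cosh u) * b' +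
          s * (1 - s) * b ^ 2) := by
      have e0 : cosh u ^ 2 * (sinh u / cosh u) = cosh u * sinh u := by field_simp
      linear_combination (-s * (s + 1) * cosh u ^ 2) * e1 - s * b * e4 - s * b * b' * e0
    have e6 : -s * (cosh u * sinh θ * (-s - 1) * (P / b ^ 2)) * (cosh u * sinh θ) +
        -s * (P / b) * (cosh u * cosh θ) = P / b ^ 2 *
        (-s * ((-s - 1) * 1) * (cosh u * sinh θ) ^ 2 - s * b * (cosh u * cosh θ)) := by
      field_simp
      ring
    rw [e6, e5]
    field_simp
    ring
  have hint : IntegrableOn (fun θ => waveDeriv s u θ + sinh u / cosh u * wave s u θ +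
      s * (1 - s) * base u θ ^ (-s)) (Ioi 0) := (i2.add (i1.const_mul _)).add (i0.const_mul _)
  have hlim : Tendsto (fun θ => -s * base u θ ^ (-s - 1) * (cosh u * sinh θ)) atTop (𝓝 0) := by
    have h0 : Tendsto (fun θ : ℝ => s * cosh u * (exp (|u|) * (exp (|u| * s) *
        (2 ^ s * exp (-s * θ))))) atTop (𝓝 0) := by
      have : Tendsto (fun θ : ℝ => -s * θ) atTop atBot :=
        tendsto_id.const_mul_atTop_of_neg (by linarith)
      simpa using ((((tendsto_exp_atBot.comp this).const_mul _).const_mul _).const_mul _).const_mul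
        (s * cosh u)
    refine squeeze_zero_norm' ?_ h0
    filter_upwards [eventually_ge_atTop 0] with θ hθ
    have hb := base_pos u θ
    have hbs : 0 < base u θ ^ (-s) := rpow_pos_of_pos hb _
    have h1 : exp (-|u|) * sinh θ ≤ base u θ :=
      le_trans (by gcongr; exact (sinh_lt_cosh θ).le) (exp_neg_mul_cosh_le_base le_rfl θ)
    have h2 : sinh θ ≤ exp |u| * base u θ := by
      calc sinh θ = exp |u| * (exp (-|u|) * sinh θ) := by
            rw [← mul_assoc, ← exp_add]; simp
        _ ≤ _ := by gcongr
    have h3 : cosh θ ^ (-s) ≤ 2 ^ s * exp (-s * θ) := by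
      have h2 : exp θ / 2 ≤ cosh θ := by rw [cosh_eq]; linarith [exp_pos (-θ)]
      calc cosh θ ^ (-s) ≤ (exp θ / 2) ^ (-s) :=
            rpow_le_rpow_of_nonpos (by positivity) h2 (by linarith)
        _ = 2 ^ s * exp (-s * θ) := by
          rw [div_rpow (exp_pos _).le two_pos.le, ← exp_mul, rpow_neg two_pos.le, div_inv_eq_mul,
            mul_comm]
          ring_nf
    have hsinh : 0 ≤ sinh θ := sinh_nonneg_iff.2 hθ
    rw [base_rpow_sub_one, norm_eq_abs, abs_mul, abs_mul, abs_neg, abs_of_pos hs,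
      abs_of_pos (by positivity), abs_of_nonneg (by positivity)]
    calc _ ≤ s * (base u θ ^ (-s) / base u θ) * (cosh u * (exp |u| * base u θ)) := by gcongr
      _ = s * cosh u * (exp |u| * base u θ ^ (-s)) := by field_simp
      _ ≤ _ := by
        gcongr
        exact (base_rpow_le hs le_rfl θ).trans (by gcongr)
  have key := integral_Ioi_of_hasDerivAt_of_tendsto' hF (hint.const_mul _) hlim
  simp only [sinh_zero, mul_zero, sub_zero] at key
  rw [integral_const_mul, mul_eq_zero, or_iff_right (neg_ne_zero.2 (pow_ne_zero 2 hC.ne')),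
    integral_add (f := fun θ => waveDeriv s u θ + sinh u / cosh u * wave s u θ)
      (i2.add (i1.const_mul _)) (i0.const_mul _),
    integral_add i2 (i1.const_mul _), integral_const_mul, integral_const_mul] at key
  simp only [decaying, decayingDeriv]
  linear_combination key

/-- A solution in the variable `u = arsinh x`. -/
lemma isLegendre_of_hyperbolic {l : ℝ} {w w' : ℝ → ℝ} (h0 : w 0 = 1) (h1 : w' 0 = 0)
    (hw : ∀ u, HasDerivAt w (w' u) u)
    (hw' : ∀ u, HasDerivAt w' (-(sinh u / cosh u) * w' u - l * w u) u) :
    IsLegendre l (fun x => w (arsinh x)) (fun x => w' (arsinh x) / √(1 + x ^ 2)) := by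
  refine ⟨by simp [h0], by simp [h1], fun x => ?_, fun x => ?_⟩
  · refine ((hw _).comp x (hasDerivAt_arsinh x)).congr_deriv ?_
    rw [div_eq_mul_inv]
  · have hx : 0 < 1 + x ^ 2 := by positivity
    have hs : 0 < √(1 + x ^ 2) := sqrt_pos.2 hx
    have hss : √(1 + x ^ 2) ^ 2 = 1 + x ^ 2 := sq_sqrt hx.le
    have ds : HasDerivAt (fun x : ℝ => √(1 + x ^ 2)) (2 * x / (2 * √(1 + x ^ 2))) x :=
      ((((hasDerivAt_id' x).fun_pow 2).const_add 1).sqrt hx.ne').congr_deriv (by push_cast; ring)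
    refine (((hw' _).comp x (hasDerivAt_arsinh x)).fun_div ds hs.ne').congr_deriv ?_
    simp only [Function.comp, sinh_arsinh, cosh_arsinh]
    generalize w (arsinh x) = a
    generalize w' (arsinh x) = b
    generalize √(1 + x ^ 2) = z at *
    rw [← hss]
    field_simp
    ring

/-! ### Asymptotics of the decaying solutions -/

/-- The leading coefficient `∫_0^∞ (1 + cosh θ)^{-s} dθ` of `Ψ_s` at infinity. -/
noncomputable def leading (s : ℝ) : ℝ := ∫ θ in Ioi 0, (1 + cosh θ) ^ (-s)

lemma continuous_one_add_cosh_rpow (s : ℝ) : Continuous fun θ => (1 + cosh θ) ^ s :=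
  Continuous.rpow_const (by fun_prop) fun θ => Or.inl (by linarith [cosh_pos θ])

lemma integrableOn_one_add_cosh_rpow {s : ℝ} (hs : 0 < s) :
    IntegrableOn (fun θ => (1 + cosh θ) ^ (-s)) (Ioi 0) := by
  refine (integrableOn_cosh_rpow hs).mono'
    (continuous_one_add_cosh_rpow _).aestronglyMeasurable ?_
  filter_upwards with θ
  have := cosh_pos θ
  rw [norm_of_nonneg (by positivity)]
  exact rpow_le_rpow_of_nonpos this (by linarith) (by linarith)

lemma leading_nonneg (s : ℝ) : 0 ≤ leading s :=
  integral_nonneg fun θ => rpow_nonneg (by linarith [cosh_pos θ]) _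

/-- Each solution `Ψ_s` is its leading term `x^{-s}` up to `O(1 / x)`, uniformly in `s ≤ 1`: with
`m = √(1 + x²) / x` the integrand lies between `(x m (1 + cosh θ))^{-s}` and
`(x (1 + cosh θ))^{-s}`. -/
lemma abs_decaying_sub_le {s x : ℝ} (hs : 0 < s) (hs1 : s ≤ 1) (hx : 0 < x) :
    x * |decaying s (arsinh x) - leading s * x ^ (-s)| ≤ leading s := by
  set m := √(1 + x ^ 2) with hm
  have hm2 : m ^ 2 = 1 + x ^ 2 := sq_sqrt (by positivity)
  have hm0 : 0 < m := sqrt_pos.2 (by positivity)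
  have hxm : x ≤ m := le_sqrt_of_sq_le (by linarith)
  have hbase : ∀ θ, base (arsinh x) θ = x + m * cosh θ := fun θ => by
    rw [base, sinh_arsinh, cosh_arsinh]
  have hup : decaying s (arsinh x) ≤ leading s * x ^ (-s) := by
    rw [decaying, leading, ← integral_mul_const]
    refine integral_mono (integrableOn_base_rpow hs _)
      ((integrableOn_one_add_cosh_rpow hs).mul_const _) fun θ => ?_
    have := cosh_pos θ
    simp only
    rw [← mul_rpow (by positivity) hx.le, hbase]
    exact rpow_le_rpow_of_nonpos (by positivity) (by nlinarith) (by linarith)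
  have hlow : leading s * m ^ (-s) ≤ decaying s (arsinh x) := by
    rw [decaying, leading, ← integral_mul_const]
    refine integral_mono ((integrableOn_one_add_cosh_rpow hs).mul_const _)
      (integrableOn_base_rpow hs _) fun θ => ?_
    have := cosh_pos θ
    simp only
    rw [← mul_rpow (by positivity) hm0.le]
    refine rpow_le_rpow_of_nonpos (base_pos _ _) ?_ (by linarith)
    rw [hbase]
    nlinarith
  have hL := leading_nonneg s
  rw [abs_of_nonpos (by linarith), neg_sub]
  have hms : x / m * x ^ (-s) ≤ m ^ (-s) := by
    have h1 : x / m ≤ (x / m) ^ s := by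
      conv_lhs => rw [← rpow_one (x / m)]
      exact rpow_le_rpow_of_exponent_ge (by positivity) ((div_le_one hm0).2 hxm) hs1
    calc x / m * x ^ (-s) ≤ (x / m) ^ s * x ^ (-s) := by gcongr
      _ = m ^ (-s) := by
        rw [div_rpow hx.le hm0.le, rpow_neg hx.le, rpow_neg hm0.le]
        have := rpow_pos_of_pos hx s
        field_simp
  have hx1 : x * x ^ (-s) ≤ max 1 x := by
    have e : x * x ^ (-s) = x ^ (1 - s) := by
      rw [sub_eq_add_neg, rpow_add hx, rpow_one]
    rw [e]
    rcases le_total x 1 with h | h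
    · exact (rpow_le_one hx.le h (by linarith)).trans (le_max_left _ _)
    · refine le_trans ?_ (le_max_right _ _)
      calc x ^ (1 - s) ≤ x ^ (1 : ℝ) := rpow_le_rpow_of_exponent_le h (by linarith)
        _ = x := rpow_one x
  have hmx : max 1 x * (1 - x / m) ≤ 1 := by
    have e : 1 - x / m = 1 / (m * (m + x)) := by
      field_simp; nlinarith
    rw [e, mul_one_div, div_le_one (by positivity)]
    refine max_le ?_ ?_ <;> nlinarith
  calc x * (leading s * x ^ (-s) - decaying s (arsinh x))
      ≤ x * (leading s * x ^ (-s) - leading s * (x / m * x ^ (-s))) := by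
        gcongr
        exact le_trans (by gcongr) hlow
    _ = leading s * (x * x ^ (-s) * (1 - x / m)) := by ring
    _ ≤ leading s * (max 1 x * (1 - x / m)) := by
      have : 0 ≤ 1 - x / m := sub_nonneg.2 ((div_le_one hm0).2 hxm)
      gcongr
    _ ≤ leading s * 1 := by gcongr
    _ = _ := mul_one _

end HyperbolicIntegral

/-! ### Evaluation in terms of the Gamma function -/

section GammaValues

lemma integral_beta {a b : ℝ} (ha : 0 < a) (hb : 0 < b) :
    ∫ y in Ioo (0 : ℝ) 1, y ^ (a - 1) * (1 - y) ^ (b - 1) = Gamma a * Gamma b / Gamma (a + b) := by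
  have h := ProbabilityTheory.beta_eq_betaIntegralReal a b ha hb
  rw [ProbabilityTheory.beta] at h
  rw [h, Complex.betaIntegral, ← integral_Ioc_eq_integral_Ioo,
    ← intervalIntegral.integral_of_le zero_le_one]
  have e : ∀ y ∈ uIcc (0 : ℝ) 1, (y : ℂ) ^ ((a : ℂ) - 1) * (1 - (y : ℂ)) ^ ((b : ℂ) - 1) =
      ((y ^ (a - 1) * (1 - y) ^ (b - 1) : ℝ) : ℂ) := fun y hy => by
    rw [uIcc_of_le zero_le_one] at hy
    rw [Complex.ofReal_mul, Complex.ofReal_cpow hy.1, Complex.ofReal_cpow (by linarith [hy.2])]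
    push_cast
    rfl
  rw [intervalIntegral.integral_congr e, intervalIntegral.integral_ofReal, Complex.ofReal_re]

lemma image_inv_cosh_sq : (fun θ : ℝ => (cosh θ ^ 2)⁻¹) '' Ioi 0 = Ioo 0 1 := by
  ext y
  constructor
  · rintro ⟨θ, hθ, rfl⟩
    have h1 : 1 < cosh θ := one_lt_cosh.2 (ne_of_gt hθ)
    exact ⟨by positivity, inv_lt_one_of_one_lt₀ (by nlinarith)⟩
  · rintro ⟨h0, h1⟩
    have hs : 1 < √y⁻¹ := by
      rw [lt_sqrt zero_le_one, one_pow]; exact (one_lt_inv₀ h0).2 h1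
    refine ⟨arcosh √y⁻¹, arcosh_pos hs, ?_⟩
    simp only
    rw [cosh_arcosh hs.le, sq_sqrt (by positivity), inv_inv]

/-- The integral `∫_0^∞ (cosh θ)^{-s} dθ`, by the substitution `y = (cosh θ)⁻²`. -/
lemma integral_cosh_rpow {s : ℝ} (hs : 0 < s) :
    ∫ θ in Ioi (0 : ℝ), cosh θ ^ (-s) = √π / 2 * (Gamma (s / 2) / Gamma ((s + 1) / 2)) := by
  have hb := integral_beta (a := s / 2) (b := 1 / 2) (by positivity) (by norm_num)
  have hder : ∀ θ ∈ Ioi (0 : ℝ), HasDerivWithinAt (fun θ : ℝ => (cosh θ ^ 2)⁻¹)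
      (-(2 * cosh θ * sinh θ) / (cosh θ ^ 2) ^ 2) (Ioi 0) θ := fun θ _ => by
    have := cosh_pos θ
    refine ((((hasDerivAt_cosh θ).fun_pow 2).fun_inv
      (by positivity)).congr_deriv ?_).hasDerivWithinAt
    push_cast
    ring
  have hinj : InjOn (fun θ : ℝ => (cosh θ ^ 2)⁻¹) (Ioi 0) := fun x hx y hy hxy => by
    have h1 : cosh x ^ 2 = cosh y ^ 2 := inv_injective hxy
    have h2 : cosh x = cosh y := by
      rwa [sq_eq_sq₀ (cosh_pos x).le (cosh_pos y).le] at h1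
    exact cosh_injOn (mem_Ici.2 (le_of_lt hx)) (mem_Ici.2 (le_of_lt hy)) h2
  rw [← image_inv_cosh_sq, integral_image_eq_integral_abs_deriv_smul measurableSet_Ioi hder hinj,
    Gamma_one_half_eq, show s / 2 + 1 / 2 = (s + 1) / 2 by ring] at hb
  have e : ∀ θ ∈ Ioi (0 : ℝ), |-(2 * cosh θ * sinh θ) / (cosh θ ^ 2) ^ 2| •
      (((cosh θ ^ 2)⁻¹) ^ (s / 2 - 1) * (1 - (cosh θ ^ 2)⁻¹) ^ (1 / 2 - 1 : ℝ)) =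
      2 * cosh θ ^ (-s) := fun θ hθ => by
    have hC := cosh_pos θ
    have hS : 0 < sinh θ := sinh_pos_iff.2 hθ
    have e1 : 1 - (cosh θ ^ 2)⁻¹ = (sinh θ / cosh θ) ^ 2 := by
      rw [div_pow, sinh_sq]; field_simp
    have e2 : ((sinh θ / cosh θ) ^ 2) ^ (1 / 2 - 1 : ℝ) = cosh θ / sinh θ := by
      rw [← rpow_natCast, ← rpow_mul (by positivity)]
      norm_num
      rw [rpow_neg_one, inv_div]
    have e3 : ((cosh θ ^ 2)⁻¹) ^ (s / 2 - 1) = cosh θ ^ (-s) * cosh θ ^ 2 := by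
      rw [inv_rpow (by positivity), ← rpow_neg (by positivity), ← rpow_natCast,
        ← rpow_mul hC.le, ← rpow_add hC]
      congr 1
      push_cast
      ring
    rw [e1, e2, e3, neg_div, abs_neg, abs_of_pos (by positivity), smul_eq_mul]
    field_simp
  rw [setIntegral_congr_fun measurableSet_Ioi e, integral_const_mul] at hb
  linear_combination hb / 2

lemma image_sin_sq : (fun θ : ℝ => sin θ ^ 2) '' Ioo 0 (π / 2) = Ioo 0 1 := by
  ext y
  constructor
  · rintro ⟨θ, hθ, rfl⟩
    have h1 : 0 < sin θ := sin_pos_of_pos_of_lt_pi hθ.1 (by linarith [hθ.2, pi_pos])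
    have h2 : 0 < cos θ := cos_pos_of_mem_Ioo ⟨by linarith [hθ.1, pi_pos], hθ.2⟩
    exact ⟨by positivity, by nlinarith [sin_sq_add_cos_sq θ]⟩
  · rintro ⟨h0, h1⟩
    have hs1 : √y < 1 := by rw [sqrt_lt' one_pos]; simpa
    have hs0 : 0 < √y := sqrt_pos.2 h0
    refine ⟨arcsin √y, ⟨arcsin_pos.2 hs0, arcsin_lt_pi_div_two.2 hs1⟩, ?_⟩
    simp only
    rw [sin_arcsin (by linarith) hs1.le, sq_sqrt h0.le]

/-- The integral `∫_0^{π/2} cos² θ sin^s θ dθ`, by the substitution `y = sin² θ`. -/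
lemma integral_cos_sq_mul_sin_rpow {s : ℝ} (hs : 0 ≤ s) :
    ∫ θ in (0 : ℝ)..(π / 2), cos θ ^ 2 * sin θ ^ s =
      √π / 4 * (Gamma ((s + 1) / 2) / Gamma (s / 2 + 2)) := by
  have hb := integral_beta (a := (s + 1) / 2) (b := 3 / 2) (by positivity) (by norm_num)
  have hder : ∀ θ ∈ Ioo 0 (π / 2), HasDerivWithinAt (fun θ : ℝ => sin θ ^ 2)
      (2 * sin θ * cos θ) (Ioo 0 (π / 2)) θ := fun θ _ =>
    (((hasDerivAt_sin θ).fun_pow 2).congr_deriv (by push_cast; ring)).hasDerivWithinAt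
  have hinj : InjOn (fun θ : ℝ => sin θ ^ 2) (Ioo 0 (π / 2)) := fun x hx y hy hxy => by
    have h1 : 0 < sin x := sin_pos_of_pos_of_lt_pi hx.1 (by linarith [hx.2, pi_pos])
    have h2 : 0 < sin y := sin_pos_of_pos_of_lt_pi hy.1 (by linarith [hy.2, pi_pos])
    have h3 : sin x = sin y := by
      simp only at hxy
      rwa [sq_eq_sq₀ h1.le h2.le] at hxy
    exact injOn_sin ⟨by linarith [hx.1, pi_pos], hx.2.le⟩ ⟨by linarith [hy.1, pi_pos], hy.2.le⟩ h3
  have hG : Gamma (3 / 2) = √π / 2 := by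
    rw [show (3 / 2 : ℝ) = 1 / 2 + 1 by norm_num, Gamma_add_one (by norm_num), Gamma_one_half_eq]
    ring
  rw [← image_sin_sq, integral_image_eq_integral_abs_deriv_smul measurableSet_Ioo hder hinj, hG,
    show (s + 1) / 2 + 3 / 2 = s / 2 + 2 by ring] at hb
  have e : ∀ θ ∈ Ioo 0 (π / 2), |2 * sin θ * cos θ| •
      ((sin θ ^ 2) ^ ((s + 1) / 2 - 1) * (1 - sin θ ^ 2) ^ (3 / 2 - 1 : ℝ)) =
      2 * (cos θ ^ 2 * sin θ ^ s) := fun θ hθ => by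
    have h1 : 0 < sin θ := sin_pos_of_pos_of_lt_pi hθ.1 (by linarith [hθ.2, pi_pos])
    have h2 : 0 < cos θ := cos_pos_of_mem_Ioo ⟨by linarith [hθ.1, pi_pos], hθ.2⟩
    have e2 : (1 - sin θ ^ 2) ^ (3 / 2 - 1 : ℝ) = cos θ := by
      rw [← cos_sq', ← rpow_natCast, ← rpow_mul h2.le]
      norm_num
    have e3 : (sin θ ^ 2) ^ ((s + 1) / 2 - 1) = sin θ ^ s / sin θ := by
      rw [← rpow_natCast, ← rpow_mul h1.le, ← rpow_sub_one h1.ne']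
      congr 1
      push_cast
      ring
    rw [e2, e3, abs_of_pos (by positivity), smul_eq_mul]
    field_simp
  rw [setIntegral_congr_fun measurableSet_Ioo e, integral_const_mul] at hb
  rw [intervalIntegral.integral_of_le (by positivity), integral_Ioc_eq_integral_Ioo]
  linear_combination hb / 2

lemma leading_eq {s : ℝ} (hs : 0 < s) :
    leading s = Gamma (s / 2) * Gamma ((s + 1) / 2) / (2 * Gamma (s + 1 / 2)) := by
  have e : ∀ θ : ℝ, (1 + cosh θ) ^ (-s) = 2 ^ (-s) * cosh (1 / 2 * θ) ^ (-(2 * s)) := fun θ => by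
    have h1 : 1 + cosh θ = 2 * cosh (1 / 2 * θ) ^ 2 := by
      have := cosh_two_mul (1 / 2 * θ)
      rw [show 2 * (1 / 2 * θ) = θ by ring, sinh_sq] at this
      linarith
    have hC := cosh_pos (1 / 2 * θ)
    rw [h1, mul_rpow two_pos.le (by positivity), ← rpow_natCast, ← rpow_mul hC.le]
    congr 2
    push_cast
    ring
  have h2 := integral_comp_mul_left_Ioi (fun θ => cosh θ ^ (-(2 * s))) 0
    (show (0 : ℝ) < 1 / 2 by norm_num)
  have h3 := integral_cosh_rpow (s := 2 * s) (by positivity)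
  have h4 := Gamma_mul_Gamma_add_half (s / 2)
  rw [mul_zero, h3, smul_eq_mul, show 2 * s / 2 = s by ring,
    show (2 * s + 1) / 2 = s + 1 / 2 by ring] at h2
  rw [show s / 2 + 1 / 2 = (s + 1) / 2 by ring, show 2 * (s / 2) = s by ring] at h4
  simp only [leading, e]
  have h5 : (2 : ℝ) ^ (-s) * 2 = 2 ^ (1 - s) := by
    rw [sub_eq_add_neg, rpow_add two_pos, rpow_one]; ring
  have h6 : Gamma (s + 1 / 2) ≠ 0 := (Gamma_pos_of_pos (by positivity)).ne'
  rw [integral_const_mul, h2, h4, ← h5]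
  field_simp

/-- The coefficient of `x^{s-1}` in the asymptotics of the even solution for `l = s (1 - s)`. -/
noncomputable def coeffGrow (s : ℝ) : ℝ := √π * Gamma (s - 1 / 2) / Gamma (s / 2) ^ 2

/-- The coefficient of `x^{-s}` in the asymptotics of the even solution for `l = s (1 - s)`. For
`s < 1` it equals `√π Γ(1/2 - s) / Γ((1 - s)/2)²`; the form chosen here is continuous at `s = 1`. -/
noncomputable def coeffDecay (s : ℝ) : ℝ :=
  √π * Gamma (3 / 2 - s) * ((1 - s) / 2) ^ 2 / ((1 / 2 - s) * Gamma ((3 - s) / 2) ^ 2)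

lemma coeffDecay_eq {s : ℝ} (hs : 1 / 2 < s) (hs1 : s < 1) :
    coeffDecay s = √π * Gamma (1 / 2 - s) / Gamma ((1 - s) / 2) ^ 2 := by
  have h1 : Gamma (3 / 2 - s) = (1 / 2 - s) * Gamma (1 / 2 - s) := by
    rw [← Gamma_add_one (by linarith)]; ring_nf
  have h2 : Gamma ((3 - s) / 2) = (1 - s) / 2 * Gamma ((1 - s) / 2) := by
    rw [← Gamma_add_one (by linarith)]; ring_nf
  have h3 : 1 / 2 - s ≠ 0 := by linarith
  have h4 : 1 - s ≠ 0 := by linarith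
  have h5 : Gamma ((1 - s) / 2) ≠ 0 := (Gamma_pos_of_pos (by linarith)).ne'
  rw [coeffDecay, h1, h2]
  generalize Gamma (1 / 2 - s) = g
  generalize Gamma ((1 - s) / 2) = k at *
  have h6 : 1 - s * 2 ≠ 0 := by linarith
  have h7 : 1 - 2 * s ≠ 0 := by linarith
  field_simp

lemma decaying_zero {s : ℝ} (hs : 0 < s) :
    decaying s 0 = √π / 2 * (Gamma (s / 2) / Gamma ((s + 1) / 2)) := by
  rw [← integral_cosh_rpow hs, decaying]
  simp [base]

lemma decayingDeriv_zero {s : ℝ} (hs : 0 < s) :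
    decayingDeriv s 0 = -(√π * (Gamma ((s + 1) / 2) / Gamma (s / 2))) := by
  have h := integral_cosh_rpow (s := s + 1) (by positivity)
  have hG : Gamma ((s + 1 + 1) / 2) = s / 2 * Gamma (s / 2) := by
    rw [← Gamma_add_one (by positivity)]; ring_nf
  have h1 : Gamma (s / 2) ≠ 0 := (Gamma_pos_of_pos (by positivity)).ne'
  rw [decayingDeriv]
  simp only [wave, base, baseDeriv, sinh_zero, cosh_zero, zero_mul, one_mul, zero_add, add_zero,
    mul_one]
  rw [integral_const_mul, show -s - 1 = -(s + 1) by ring, h, hG]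
  field_simp

/-- The connection formula: the even solution for `l = s (1 - s)` is
`coeffGrow s * x^{s-1} + coeffDecay s * x^{-s}` up to `O(1 / x)`, uniformly. For `s < 1` it is the
combination of `Ψ_{1-s}` and `Ψ_s` determined by the values at `0`. -/
theorem exists_isLegendre_asymptotics {s : ℝ} (hs : 1 / 2 < s) (hs1 : s ≤ 1) :
    ∃ φ φ' : ℝ → ℝ, IsLegendre (s * (1 - s)) φ φ' ∧ ∀ x, 0 < x →
      |x * φ x - coeffGrow s * x ^ s - coeffDecay s * x ^ (1 - s)| ≤
        |coeffGrow s| + |coeffDecay s| := by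
  rcases hs1.eq_or_lt with rfl | hs1
  · refine ⟨fun _ => 1, fun _ => 0, ⟨rfl, rfl, fun x => hasDerivAt_const x 1, fun x => ?_⟩,
      fun x _ => ?_⟩
    · simpa using hasDerivAt_const x (0 : ℝ)
    · have h1 : coeffGrow 1 = 1 := by
        rw [coeffGrow, show (1 : ℝ) - 1 / 2 = 1 / 2 by norm_num, Gamma_one_half_eq]
        have : √π ≠ 0 := (sqrt_pos.2 pi_pos).ne'
        field_simp
      have h2 : coeffDecay 1 = 0 := by simp [coeffDecay]
      simp [h1, h2]
  have hs0 : 0 < s := by linarith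
  have hs' : 0 < 1 - s := by linarith
  -- the values and derivatives of `Ψ_s` and `Ψ_{1-s}` at `0`, and their leading coefficients
  have a1 := decaying_zero hs0
  have a2 := decaying_zero hs'
  have b1 := decayingDeriv_zero hs0
  have b2 := decayingDeriv_zero hs'
  have k1 := leading_eq hs0
  have k2 := leading_eq hs'
  rw [show (1 - s + 1) / 2 = 1 - s / 2 by ring] at a2 b2 k2
  rw [show 1 - s + 1 / 2 = 3 / 2 - s by ring] at k2
  have g1 : 0 < Gamma (s / 2) := Gamma_pos_of_pos (by positivity)
  have g2 : 0 < Gamma ((s + 1) / 2) := Gamma_pos_of_pos (by positivity)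
  have g3 : 0 < Gamma ((1 - s) / 2) := Gamma_pos_of_pos (by positivity)
  have g4 : 0 < Gamma (1 - s / 2) := Gamma_pos_of_pos (by linarith)
  have g5 : 0 < Gamma (s + 1 / 2) := Gamma_pos_of_pos (by positivity)
  have g6 : 0 < Gamma (3 / 2 - s) := Gamma_pos_of_pos (by linarith)
  have r1 := Gamma_mul_Gamma_one_sub (s / 2)
  have r2 := Gamma_mul_Gamma_one_sub ((1 - s) / 2)
  have r3 := Gamma_mul_Gamma_one_sub (s - 1 / 2)
  have r4 := Gamma_mul_Gamma_one_sub (s + 1 / 2)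
  rw [show 1 - (1 - s) / 2 = (s + 1) / 2 by ring, show π * ((1 - s) / 2) = π / 2 - π * (s / 2) by
    ring, sin_pi_div_two_sub] at r2
  rw [show 1 - (s - 1 / 2) = 3 / 2 - s by ring, show π * (s - 1 / 2) = π * s - π / 2 by ring,
    sin_sub_pi_div_two] at r3
  rw [show 1 - (s + 1 / 2) = 1 / 2 - s by ring, show π * (s + 1 / 2) = π * s + π / 2 by ring,
    sin_add_pi_div_two] at r4
  have hsin : 0 < sin (π * (s / 2)) :=
    sin_pos_of_pos_of_lt_pi (by positivity) (by nlinarith [pi_pos])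
  have hcos : 0 < cos (π * (s / 2)) :=
    cos_pos_of_mem_Ioo ⟨by nlinarith [pi_pos], by nlinarith [pi_pos]⟩
  have hcs : cos (π * s) < 0 :=
    cos_neg_of_pi_div_two_lt_of_lt (by nlinarith [pi_pos]) (by nlinarith [pi_pos])
  have hcos2 : cos (π * s) = cos (π * (s / 2)) ^ 2 - sin (π * (s / 2)) ^ 2 := by
    rw [← cos_two_mul']; ring_nf
  have hπ := pi_pos
  have hsπ : 0 < √π := sqrt_pos.2 pi_pos
  have hsq : √π ^ 2 = π := sq_sqrt pi_pos.le
  rw [coeffDecay_eq hs hs1, coeffGrow]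
  -- the Wronskian at `0`, which the reflection formula evaluates
  set D := decaying (1 - s) 0 * decayingDeriv s 0 - decaying s 0 * decayingDeriv (1 - s) 0 with hD
  generalize Gamma (s / 2) = x₁ at *
  generalize Gamma ((s + 1) / 2) = x₂ at *
  generalize Gamma ((1 - s) / 2) = x₃ at *
  generalize Gamma (1 - s / 2) = x₄ at *
  generalize Gamma (s + 1 / 2) = x₅ at *
  generalize Gamma (3 / 2 - s) = x₆ at *
  generalize sin (π * (s / 2)) = σ at *
  generalize cos (π * (s / 2)) = κ at *
  generalize cos (π * s) = c at *
  rw [eq_div_iff hsin.ne'] at r1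
  rw [eq_div_iff hcos.ne'] at r2
  rw [eq_div_iff (by linarith)] at r3
  rw [eq_div_iff hcs.ne] at r4
  have hc0 : c ≠ 0 := hcs.ne
  have hDval : D = x₁ * x₂ * x₃ * x₄ * c / (2 * π) := by
    have e : D = √π ^ 2 / 2 * ((x₁ * x₄) ^ 2 - (x₂ * x₃) ^ 2) / (x₁ * x₂ * x₃ * x₄) := by
      rw [hD, a1, a2, b1, b2]
      field_simp
      ring
    have f1 : x₁ * x₄ = π / σ := by rw [eq_div_iff hsin.ne']; exact r1
    have f2 : x₂ * x₃ = π / κ := by rw [eq_div_iff hcos.ne', ← r2]; ring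
    have f3 : x₁ * x₂ * x₃ * x₄ = (π / σ) * (π / κ) := by rw [← f1, ← f2]; ring
    rw [e, f1, f2, f3, hcos2, hsq]
    field_simp
  have hD0 : D ≠ 0 := by
    rw [hDval]
    have : x₁ * x₂ * x₃ * x₄ * c ≠ 0 := by positivity
    positivity
  obtain ⟨p, hp⟩ : ∃ p, p = decayingDeriv s 0 / D := ⟨_, rfl⟩
  obtain ⟨q, hq⟩ : ∃ q, q = -decayingDeriv (1 - s) 0 / D := ⟨_, rfl⟩
  have hp1 : p * leading (1 - s) = √π * Gamma (s - 1 / 2) / x₁ ^ 2 := by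
    have : Gamma (s - 1 / 2) = -π / (x₆ * c) := by
      rw [eq_div_iff (by positivity)]; linarith
    rw [this, hp, k2, b1, hDval]
    field_simp
  have hq1 : q * leading s = √π * Gamma (1 / 2 - s) / x₃ ^ 2 := by
    have : Gamma (1 / 2 - s) = π / (x₅ * c) := by
      rw [eq_div_iff (by positivity)]; linarith
    rw [this, hq, k1, b2, hDval]
    field_simp
  have hw : ∀ u, HasDerivAt (fun u => p * decaying (1 - s) u + q * decaying s u)
      (p * decayingDeriv (1 - s) u + q * decayingDeriv s u) u := fun u =>
    ((hasDerivAt_decaying hs' u).2.const_mul p).fun_add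
      ((hasDerivAt_decaying hs0 u).2.const_mul q)
  have hw' : ∀ u, HasDerivAt (fun u => p * decayingDeriv (1 - s) u + q * decayingDeriv s u)
      (-(sinh u / cosh u) * (p * decayingDeriv (1 - s) u + q * decayingDeriv s u) -
        s * (1 - s) * (p * decaying (1 - s) u + q * decaying s u)) u := fun u =>
    (((hasDerivAt_decayingDeriv hs' u).const_mul p).fun_add
      ((hasDerivAt_decayingDeriv hs0 u).const_mul q)).congr_deriv (by ring)
  refine ⟨_, _, isLegendre_of_hyperbolic ?_ ?_ hw hw', fun x hx => ?_⟩
  · rw [hp, hq]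
    field_simp
    rw [hD]
    ring
  · rw [hp, hq]
    field_simp
    ring
  · have e1 := abs_decaying_sub_le hs' (by linarith) hx
    have e2 := abs_decaying_sub_le hs0 hs1.le hx
    have x1 : x * x ^ (-(1 - s)) = x ^ s := by
      rw [show -(1 - s) = s - 1 by ring, rpow_sub_one hx.ne']; field_simp
    have x2 : x * x ^ (-s) = x ^ (1 - s) := by
      rw [sub_eq_add_neg, rpow_add hx, rpow_one]
    rw [← hp1, ← hq1, abs_mul, abs_mul, abs_of_nonneg (leading_nonneg _),
      abs_of_nonneg (leading_nonneg _)]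
    have key : x * (p * decaying (1 - s) (arsinh x) + q * decaying s (arsinh x)) -
        p * leading (1 - s) * x ^ s - q * leading s * x ^ (1 - s) =
        p * (x * (decaying (1 - s) (arsinh x) - leading (1 - s) * x ^ (-(1 - s)))) +
        q * (x * (decaying s (arsinh x) - leading s * x ^ (-s))) := by
      linear_combination (p * leading (1 - s)) * x1 + (q * leading s) * x2
    rw [key]
    refine (abs_add_le _ _).trans ?_
    rw [abs_mul, abs_mul, abs_mul, abs_mul x, abs_of_pos hx]
    gcongr

end GammaValues

/-! ### Real exponents `1/2 < s ≤ 1` -/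

section RealExponent

/-- A bounded density contributes boundedly to the difference quotient: for a constant density
the integral is exactly proportional to `A² - a²`. -/
lemma abs_integral_kernel_sub_le {ε : ℝ → ℝ} (hε : Continuous ε) {M a A : ℝ}
    (hM : ∀ x, 0 ≤ x → |ε x| ≤ M) (ha : 0 ≤ a) (haA : a ≤ A) :
    |A ^ 2 * (∫ θ in (0 : ℝ)..(π / 2), cos θ ^ 2 * ε (A * sin θ)) -
      a ^ 2 * ∫ θ in (0 : ℝ)..(π / 2), cos θ ^ 2 * ε (a * sin θ)| ≤
      M * (π / 4) * (A ^ 2 - a ^ 2) := by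
  have hA := ha.trans haA
  have hc : Continuous fun _ : ℝ => (1 : ℝ) := continuous_const
  have hI : ∀ r : ℝ, 0 ≤ r →
      ∫ v in (0 : ℝ)..(π / 2), kernel (fun _ => 1) r v = r ^ 2 * (π / 4) := fun r hr => by
    rw [integral_kernel hc hr]
    simp only [mul_one]
    rw [integral_cos_sq]
    simp
    left
    ring
  rw [← integral_kernel hε hA, ← integral_kernel hε ha,
    ← intervalIntegral.integral_sub (kernel_intervalIntegrable hε hA)
      (kernel_intervalIntegrable hε ha)]
  have key := intervalIntegral.norm_integral_le_of_norm_le (a := 0) (b := π / 2)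
    (f := fun v => kernel ε A v - kernel ε a v)
    (g := fun v => M * (kernel (fun _ => 1) A v - kernel (fun _ => 1) a v)) (μ := volume)
    (by positivity) (Eventually.of_forall fun v hv => ?_)
    (((kernel_intervalIntegrable hc hA).sub (kernel_intervalIntegrable hc ha)).const_mul M)
  · rw [norm_eq_abs] at key
    refine key.trans (le_of_eq ?_)
    rw [intervalIntegral.integral_const_mul, intervalIntegral.integral_sub
      (kernel_intervalIntegrable hc hA) (kernel_intervalIntegrable hc ha), hI A hA, hI a ha]
    ring
  · have ht := tan_nonneg_of_nonneg_of_le_pi_div_two hv.1.le hv.2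
    have hs : √(a ^ 2 - tan v ^ 2) ≤ √(A ^ 2 - tan v ^ 2) := by gcongr
    have e1 : kernel ε A v - kernel ε a v =
        ε (tan v) * ((√(A ^ 2 - tan v ^ 2) - √(a ^ 2 - tan v ^ 2)) / cos v ^ 2) := by
      simp only [kernel]; ring
    have e2 : kernel (fun _ => 1) A v - kernel (fun _ => 1) a v =
        (√(A ^ 2 - tan v ^ 2) - √(a ^ 2 - tan v ^ 2)) / cos v ^ 2 := by
      simp only [kernel]; ring
    have h0 : 0 ≤ (√(A ^ 2 - tan v ^ 2) - √(a ^ 2 - tan v ^ 2)) / cos v ^ 2 :=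
      div_nonneg (sub_nonneg.2 hs) (by positivity)
    rw [e1, e2, norm_mul, norm_eq_abs, norm_of_nonneg h0]
    gcongr
    exact hM _ ht

/-- The difference quotient of a power of `√(X² - 1)`, as a function of `X²`. -/
lemma abs_rpow_quotient_sub_le {e c X Y : ℝ} (he : 0 ≤ e) (he1 : e ≤ 1) (hc : 0 < c)
    (hX : 2 ≤ X) (hY : c ≤ Y) :
    |2 / (e + 2) * ((√((X + Y) ^ 2 - 1) ^ (e + 2) - √(X ^ 2 - 1) ^ (e + 2)) /
      (Y ^ 2 + 2 * Y * X)) - X ^ e| ≤ (1 + 1 / c) * Y := by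
  have hY0 : 0 < Y := hc.trans_le hY
  have hX0 : 0 < X := by linarith
  have hpow : ∀ q : ℝ, 0 ≤ q → √q ^ (e + 2) = q ^ (e / 2 + 1) := fun q hq => by
    rw [sqrt_eq_rpow, ← rpow_mul hq]; ring_nf
  have hlt : X ^ 2 - 1 < (X + Y) ^ 2 - 1 := by nlinarith
  have hq0 : 0 < X ^ 2 - 1 := by nlinarith
  have hd : ∀ q, 0 < q → HasDerivAt (fun q : ℝ => q ^ (e / 2 + 1)) ((e / 2 + 1) * q ^ (e / 2)) q :=
    fun q hq => (hasDerivAt_rpow_const (Or.inl hq.ne')).congr_deriv (by rw [add_sub_cancel_right])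
  obtain ⟨q, ⟨hq1, hq2⟩, hq⟩ := exists_hasDerivAt_eq_slope (fun q : ℝ => q ^ (e / 2 + 1))
    (fun q => (e / 2 + 1) * q ^ (e / 2)) hlt
    (fun q hq => (hd q (hq0.trans_le hq.1)).continuousAt.continuousWithinAt)
    (fun q hq => hd q (hq0.trans hq.1))
  have hqp : 0 < q := hq0.trans hq1
  rw [hpow _ hq0.le, hpow _ (hq0.le.trans hlt.le),
    show Y ^ 2 + 2 * Y * X = (X + Y) ^ 2 - 1 - (X ^ 2 - 1) by ring, ← hq,
    show 2 / (e + 2) * ((e / 2 + 1) * q ^ (e / 2)) = q ^ (e / 2) by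
      have : e + 2 ≠ 0 := by positivity
      field_simp]
  have hsq : ∀ x : ℝ, 0 ≤ x → (x ^ 2) ^ (e / 2) = x ^ e := fun x hx => by
    rw [← rpow_natCast, ← rpow_mul hx]; congr 1; push_cast; ring
  have hup : q ^ (e / 2) ≤ X ^ e + Y := by
    have h1 : q ^ (e / 2) ≤ (X + Y) ^ e := by
      rw [← hsq _ (by positivity)]
      exact rpow_le_rpow hqp.le (by linarith) (by positivity)
    have h2 : (X + Y) ^ e = X ^ e * (1 + Y / X) ^ e := by
      rw [← mul_rpow hX0.le (by positivity)]; congr 1; field_simp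
    have h3 : (1 + Y / X) ^ e ≤ 1 + Y / X := by
      have : 0 < Y / X := by positivity
      calc (1 + Y / X) ^ e ≤ (1 + Y / X) ^ (1 : ℝ) :=
            rpow_le_rpow_of_exponent_le (by linarith) he1
        _ = _ := rpow_one _
    have h4 : X ^ e ≤ X := by
      calc X ^ e ≤ X ^ (1 : ℝ) := rpow_le_rpow_of_exponent_le (by linarith) he1
        _ = X := rpow_one X
    have h5 : 0 < X ^ e := rpow_pos_of_pos hX0 _
    calc q ^ (e / 2) ≤ X ^ e * (1 + Y / X) := by rw [h2] at h1; exact h1.trans (by gcongr)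
      _ = X ^ e + X ^ e * (Y / X) := by ring
      _ ≤ X ^ e + X * (Y / X) := by gcongr
      _ = X ^ e + Y := by field_simp
  have hlow : X ^ e ≤ q ^ (e / 2) + 1 := by
    have h1 := rpow_add_le_add_rpow (a := X ^ 2 - 1) (b := 1) (p := e / 2) hq0.le zero_le_one
      (by positivity) (by linarith)
    rw [sub_add_cancel, hsq _ hX0.le, one_rpow] at h1
    have h2 : (X ^ 2 - 1) ^ (e / 2) ≤ q ^ (e / 2) := rpow_le_rpow hq0.le hq1.le (by positivity)
    linarith
  have h1Y : 1 ≤ 1 / c * Y := by rw [one_div_mul_eq_div, le_div_iff₀ hc]; linarith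
  rw [abs_le]
  constructor <;> nlinarith

/-- The constant `∫_0^{π/2} cos² θ sin^s θ dθ`. -/
noncomputable def wallis (s : ℝ) : ℝ := ∫ θ in (0 : ℝ)..(π / 2), cos θ ^ 2 * sin θ ^ s

lemma abs_wallis_le {s : ℝ} (hs : 0 ≤ s) : |wallis s| ≤ 2 := by
  have := abs_integral_zero_pi_div_two_le (f := fun θ => cos θ ^ 2 * sin θ ^ s) (B := 1)
    fun θ hθ => by
      have h0 := sin_nonneg_of_nonneg_of_le_pi hθ.1 (by linarith [hθ.2, pi_pos])
      rw [abs_mul, abs_pow, abs_of_nonneg (rpow_nonneg h0 _)]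
      exact mul_le_one₀ (pow_le_one₀ (abs_nonneg _) (abs_cos_le_one _)) (rpow_nonneg h0 _)
        (rpow_le_one h0 (sin_le_one _) hs)
  simpa [wallis] using this

/-- The factor `γ₁(s)` combines the coefficient of `x^{s-1}`, the Beta integral and the derivative
of a power. -/
lemma gamma₁_ofReal {s : ℝ} (hs : 1 / 2 < s) :
    gamma₁ (s : ℂ) = (((s + 2) * wallis s * coeffGrow s : ℝ) : ℂ) := by
  have hs0 : 0 < s := by linarith
  have h1 : Gamma (s + 1 / 2) = (s - 1 / 2) * Gamma (s - 1 / 2) := by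
    rw [← Gamma_add_one (by linarith)]; ring_nf
  have h2 : Gamma (s / 2 + 2) = (s / 2 + 1) * (s / 2 * Gamma (s / 2)) := by
    rw [← Gamma_add_one (by positivity), ← Gamma_add_one (by positivity)]; ring_nf
  have hg : Gamma (s / 2) ≠ 0 := (Gamma_pos_of_pos (by positivity)).ne'
  have e : gamma₁ (s : ℂ) = ((π / 2 * (Gamma (s + 1 / 2) * Gamma ((s + 1) / 2) /
      Gamma (s / 2) ^ 3) * (4 / (s * (2 * s - 1))) : ℝ) : ℂ) := by
    rw [gamma₁]
    push_cast [← Complex.Gamma_ofReal]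
    ring_nf
  have hsq : √π ^ 2 = π := sq_sqrt pi_pos.le
  have h3 : 2 * s - 1 ≠ 0 := by linarith
  rw [e, wallis, integral_cos_sq_mul_sin_rpow hs0.le, coeffGrow, h1, h2]
  congr 1
  generalize Gamma (s / 2) = x at *
  generalize Gamma ((s + 1) / 2) = y at *
  generalize Gamma (s - 1 / 2) = z at *
  have h4 : s + 2 ≠ 0 := by positivity
  field_simp
  rw [hsq]
  ring

lemma gamma₂_ofReal {s : ℝ} (hs : 1 / 2 < s) (hs1 : s ≤ 1) :
    gamma₂ (s : ℂ) = ((2 * wallis (1 - s) * coeffDecay s : ℝ) : ℂ) := by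
  rcases hs1.eq_or_lt with rfl | hs1
  · simp [gamma₂, coeffDecay]
  have e : gamma₂ (s : ℂ) = ((π / 2 * (Gamma ((1 - 2 * s) / 2) * Gamma ((2 - s) / 2) /
      (Gamma ((1 - s) / 2) ^ 2 * Gamma ((5 - s) / 2))) : ℝ) : ℂ) := by
    rw [gamma₂]
    push_cast [← Complex.Gamma_ofReal]
    rfl
  have hsq : √π ^ 2 = π := sq_sqrt pi_pos.le
  rw [e, wallis, integral_cos_sq_mul_sin_rpow (by linarith), coeffDecay_eq hs hs1,
    show (1 - s + 1) / 2 = (2 - s) / 2 by ring, show (1 - s) / 2 + 2 = (5 - s) / 2 by ring,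
    show 1 / 2 - s = (1 - 2 * s) / 2 by ring]
  congr 1
  have h1 : Gamma ((1 - s) / 2) ≠ 0 := (Gamma_pos_of_pos (by linarith)).ne'
  have h2 : Gamma ((5 - s) / 2) ≠ 0 := (Gamma_pos_of_pos (by linarith)).ne'
  field_simp
  rw [hsq]
  ring

/-- The coefficients are continuous on the compact interval `[1/2 + δ, 1]`. -/
lemma exists_coeff_bound {δ : ℝ} (hδ : 0 < δ) : ∃ K : ℝ, 0 < K ∧ ∀ s, 1 / 2 + δ ≤ s → s ≤ 1 →
    |coeffGrow s| ≤ K ∧ |coeffDecay s| ≤ K := by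
  have hG : ∀ x : ℝ, 0 < x → ContinuousAt Gamma x := fun x hx =>
    (differentiableAt_Gamma fun m => by
      have : (0 : ℝ) ≤ m := Nat.cast_nonneg m
      linarith).continuousAt
  have hcomp : ∀ f : ℝ → ℝ, Continuous f → (∀ s ∈ Icc (1 / 2 + δ) 1, 0 < f s) →
      ContinuousOn (fun s => Gamma (f s)) (Icc (1 / 2 + δ) 1) := fun f hf hpos s hs =>
    ((hG _ (hpos s hs)).comp hf.continuousAt).continuousWithinAt
  have c1 : ContinuousOn coeffGrow (Icc (1 / 2 + δ) 1) := by
    refine ContinuousOn.div (continuousOn_const.mul (hcomp _ (by fun_prop) fun s hs => ?_))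
      ((hcomp _ (by fun_prop) fun s hs => ?_).pow 2) fun s hs => ?_
    · linarith [hs.1]
    · linarith [hs.1]
    · exact pow_ne_zero 2 (Gamma_pos_of_pos (by linarith [hs.1])).ne'
  have c2 : ContinuousOn coeffDecay (Icc (1 / 2 + δ) 1) := by
    refine ContinuousOn.div ((continuousOn_const.mul (hcomp _ (by fun_prop) fun s hs => ?_)).mul
      (by fun_prop)) (ContinuousOn.mul (by fun_prop)
        ((hcomp _ (by fun_prop) fun s hs => ?_).pow 2)) fun s hs => ?_
    · linarith [hs.2]
    · linarith [hs.2]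
    · exact mul_ne_zero (by linarith [hs.1])
        (pow_ne_zero 2 (Gamma_pos_of_pos (by linarith [hs.2])).ne')
  obtain ⟨K₁, h1⟩ := isCompact_Icc.exists_bound_of_continuousOn c1
  obtain ⟨K₂, h2⟩ := isCompact_Icc.exists_bound_of_continuousOn c2
  refine ⟨max 1 (max K₁ K₂), by positivity, fun s hs hs1 => ⟨?_, ?_⟩⟩
  · exact (h1 s ⟨hs, hs1⟩).trans ((le_max_left _ _).trans (le_max_right _ _))
  · exact (h2 s ⟨hs, hs1⟩).trans ((le_max_right _ _).trans (le_max_right _ _))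

/-- The asymptotic formula for real `s = 1/2 + it` in `(1/2, 1]`. -/
theorem exists_huber_real_asymptotics {δ c : ℝ} (hδ : 0 < δ) (hc : 0 < c) : ∃ M : ℝ,
    ∀ (X Y s : ℝ) (t : ℂ), 2 ≤ X → c ≤ Y → 1 / 2 + δ ≤ s → s ≤ 1 →
      (s : ℂ) = 1 / 2 + Complex.I * t →
      ‖huber t (fPlus X Y) -
          (gamma₁ (1 / 2 + Complex.I * t) / π * (X : ℂ) ^ (1 / 2 + Complex.I * t) +
            gamma₂ (1 / 2 + Complex.I * t) / π * ((5 / 2 - Complex.I * t) / 2) *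
              (X : ℂ) ^ (1 / 2 - Complex.I * t))‖ ≤
        M * (X ^ (s - 1) * Y + X ^ (-s) * Y + Y) := by
  obtain ⟨K, hK0, hK⟩ := exists_coeff_bound hδ
  refine ⟨12 * K * (1 + 1 / c) + K / c, fun X Y s t hX hY hs hs1 ht => ?_⟩
  have hX0 : 0 < X := by linarith
  have hY0 : 0 < Y := hc.trans_le hY
  have hs2 : 1 / 2 < s := by linarith
  obtain ⟨k1, k2⟩ := hK s hs hs1
  obtain ⟨φ, φ', h, has⟩ := exists_isLegendre_asymptotics hs2 hs1
  have hl : 1 / 4 + t ^ 2 = ((s * (1 - s) : ℝ) : ℂ) := by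
    push_cast
    rw [ht]
    linear_combination t ^ 2 * Complex.I_sq
  have w1 := abs_wallis_le (s := s) (by linarith)
  have w2 := abs_wallis_le (s := 1 - s) (by linarith)
  have hφ := h.continuous
  -- the error term `ε` in the asymptotics of `x φ(x)`
  set ε : ℝ → ℝ := fun x => x * φ x - coeffGrow s * x ^ s - coeffDecay s * x ^ (1 - s) with hε
  have hr1 : Continuous fun x : ℝ => x ^ s := continuous_rpow_const (by linarith)
  have hr2 : Continuous fun x : ℝ => x ^ (1 - s) := continuous_rpow_const (by linarith)
  have hεc : Continuous ε := by fun_prop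
  have hεb : ∀ x, 0 ≤ x → |ε x| ≤ |coeffGrow s| + |coeffDecay s| := fun x hx => by
    rcases hx.eq_or_lt with rfl | hx
    · have h1 : (0 : ℝ) ^ s = 0 := zero_rpow (by linarith)
      have h2 : |(0 : ℝ) ^ (1 - s)| ≤ 1 := by
        rw [abs_of_nonneg (rpow_nonneg le_rfl _)]
        exact rpow_le_one le_rfl zero_le_one (by linarith)
      simp only [hε, h1, zero_mul, mul_zero, sub_zero, zero_sub, abs_neg, abs_mul]
      nlinarith [abs_nonneg (coeffGrow s), abs_nonneg (coeffDecay s)]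
    · exact has x hx
  have hprim : ∀ r : ℝ, 0 < r → r ^ 3 * avg φ r =
      coeffGrow s * wallis s * r ^ (s + 2) + coeffDecay s * wallis (1 - s) * r ^ (1 - s + 2) +
        r ^ 2 * ∫ θ in (0 : ℝ)..(π / 2), cos θ ^ 2 * ε (r * sin θ) := fun r hr => by
    have e : ∀ θ ∈ uIcc 0 (π / 2), cos θ ^ 2 * (r * sin θ * φ (r * sin θ)) =
        coeffGrow s * r ^ s * (cos θ ^ 2 * sin θ ^ s) +
        coeffDecay s * r ^ (1 - s) * (cos θ ^ 2 * sin θ ^ (1 - s)) +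
        cos θ ^ 2 * ε (r * sin θ) := fun θ hθ => by
      rw [uIcc_of_le (by positivity)] at hθ
      have h0 := sin_nonneg_of_nonneg_of_le_pi hθ.1 (by linarith [hθ.2, pi_pos])
      simp only [hε]
      rw [mul_rpow hr.le h0, mul_rpow hr.le h0]
      ring
    have c1 : Continuous fun θ => cos θ ^ 2 * sin θ ^ s :=
      (continuous_cos.pow 2).mul (hr1.comp continuous_sin)
    have c2 : Continuous fun θ => cos θ ^ 2 * sin θ ^ (1 - s) :=
      (continuous_cos.pow 2).mul (hr2.comp continuous_sin)
    rw [← integral_kernel_id_mul hφ hr.le, integral_kernel (by fun_prop) hr.le,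
      intervalIntegral.integral_congr e, intervalIntegral.integral_add,
      intervalIntegral.integral_add, intervalIntegral.integral_const_mul,
      intervalIntegral.integral_const_mul, rpow_add hr, rpow_add hr, rpow_two, wallis, wallis]
    · ring
    all_goals exact Continuous.intervalIntegrable (by fun_prop) _ _
  have ha : 0 < √(X ^ 2 - 1) := sqrt_pos.2 (by nlinarith)
  have haA : √(X ^ 2 - 1) ≤ √((X + Y) ^ 2 - 1) := sqrt_le_sqrt (by nlinarith)
  have herr := abs_integral_kernel_sub_le hεc hεb ha.le haA
  have p1 := abs_rpow_quotient_sub_le (e := s) (by linarith) hs1 hc hX hY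
  have p2 := abs_rpow_quotient_sub_le (e := 1 - s) (by linarith) (by linarith) hc hX hY
  have hHA : √((X + Y) ^ 2 - 1) ^ 2 - √(X ^ 2 - 1) ^ 2 = Y ^ 2 + 2 * Y * X := by
    rw [sq_sqrt (by nlinarith), sq_sqrt (by nlinarith)]; ring
  rw [hHA] at herr
  -- both sides are real
  have hmain : gamma₁ (1 / 2 + Complex.I * t) / π * (X : ℂ) ^ (1 / 2 + Complex.I * t) +
      gamma₂ (1 / 2 + Complex.I * t) / π * ((5 / 2 - Complex.I * t) / 2) *
        (X : ℂ) ^ (1 / 2 - Complex.I * t) =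
      (((s + 2) * wallis s * coeffGrow s / π * X ^ s +
        2 * wallis (1 - s) * coeffDecay s / π * ((3 - s) / 2) * X ^ (1 - s) : ℝ) : ℂ) := by
    have e1 : 1 / 2 - Complex.I * t = ((1 - s : ℝ) : ℂ) := by push_cast; rw [ht]; ring
    have e2 : 5 / 2 - Complex.I * t = ((3 - s : ℝ) : ℂ) := by push_cast; rw [ht]; ring
    rw [e1, e2, ← ht, gamma₁_ofReal hs2, gamma₂_ofReal hs2 hs1, ← Complex.ofReal_cpow hX0.le,
      ← Complex.ofReal_cpow hX0.le]
    push_cast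
    ring
  rw [hmain, huber_fPlus h hl (by linarith) hY0, ← Complex.ofReal_sub, Complex.norm_real,
    norm_eq_abs, primitive, primitive, hprim _ ha, hprim _ (ha.trans_le haA)]
  set H := Y ^ 2 + 2 * Y * X with hH
  have hH0 : 0 < H := by positivity
  set A := √((X + Y) ^ 2 - 1)
  set a := √(X ^ 2 - 1)
  set E := A ^ 2 * ∫ θ in (0 : ℝ)..(π / 2), cos θ ^ 2 * ε (A * sin θ)
  set E' := a ^ 2 * ∫ θ in (0 : ℝ)..(π / 2), cos θ ^ 2 * ε (a * sin θ)
  have hπ := pi_pos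
  have hs3 : s + 2 ≠ 0 := by linarith
  have hs4 : 1 - s + 2 ≠ 0 := by linarith
  -- each power contributes a difference quotient close to the main term, and `ε` the rest
  have key : 2 / (π * H) * (coeffGrow s * wallis s * A ^ (s + 2) +
        coeffDecay s * wallis (1 - s) * A ^ (1 - s + 2) + E -
        (coeffGrow s * wallis s * a ^ (s + 2) + coeffDecay s * wallis (1 - s) * a ^ (1 - s + 2) +
          E')) - ((s + 2) * wallis s * coeffGrow s / π * X ^ s +
        2 * wallis (1 - s) * coeffDecay s / π * ((3 - s) / 2) * X ^ (1 - s)) =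
      (s + 2) / π * wallis s * coeffGrow s *
        (2 / (s + 2) * ((A ^ (s + 2) - a ^ (s + 2)) / H) - X ^ s) +
      (1 - s + 2) / π * wallis (1 - s) * coeffDecay s *
        (2 / (1 - s + 2) * ((A ^ (1 - s + 2) - a ^ (1 - s + 2)) / H) - X ^ (1 - s)) +
      2 / (π * H) * (E - E') := by
    field_simp
    ring
  rw [key]
  have hb : ∀ e w k P : ℝ, 0 ≤ e → e ≤ 3 → |w| ≤ 2 → |k| ≤ K → |P| ≤ (1 + 1 / c) * Y →
      |e / π * w * k * P| ≤ 6 * K * ((1 + 1 / c) * Y) := fun e w k P he0 he hw hk hP => by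
    rw [abs_mul, abs_mul, abs_mul, abs_of_nonneg (by positivity)]
    calc _ ≤ 3 / 1 * 2 * K * ((1 + 1 / c) * Y) := by
          gcongr
          linarith [two_le_pi]
      _ = _ := by ring
  have b3 : |2 / (π * H) * (E - E')| ≤ K / c * Y := by
    rw [abs_mul, abs_of_pos (by positivity)]
    calc _ ≤ 2 / (π * H) * ((K + K) * (π / 4) * H) := by
          gcongr
          exact herr.trans (by gcongr)
      _ = K / c * c := by field_simp; ring
      _ ≤ _ := by gcongr
  have hX1 : 0 < X ^ (s - 1) := rpow_pos_of_pos hX0 _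
  have hX2 : 0 < X ^ (-s) := rpow_pos_of_pos hX0 _
  calc _ ≤ 6 * K * ((1 + 1 / c) * Y) + 6 * K * ((1 + 1 / c) * Y) + K / c * Y := by
        refine (abs_add_le _ _).trans (add_le_add ((abs_add_le _ _).trans (add_le_add ?_ ?_)) b3)
        · exact hb _ _ _ _ (by linarith) (by linarith) w1 k1 p1
        · exact hb _ _ _ _ (by linarith) (by linarith) w2 k2 p2
    _ = (12 * K * (1 + 1 / c) + K / c) * (0 * Y + 0 * Y + Y) := by ring
    _ ≤ _ := by gcongr

end RealExponent

end HuberTransform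

open HuberTransform in
theorem proposition5p3 :
    -- (i) small eigenvalues: `s = 1/2 + it` is real with `1/2 < s ≤ 1`
    (∀ δ c C : ℝ, 0 < δ → 0 < c → 0 < C → ∃ M : ℝ, ∀ (X Y s : ℝ) (t : ℂ),
      2 ≤ X → c ≤ Y → Y ≤ C * X → 1 / 2 + δ ≤ s → s ≤ 1 → (s : ℂ) = 1 / 2 + Complex.I * t →
      ‖huber t (fPlus X Y) -
          (gamma₁ (1 / 2 + Complex.I * t) / Real.pi * (X : ℂ) ^ (1 / 2 + Complex.I * t) +
            gamma₂ (1 / 2 + Complex.I * t) / Real.pi * ((5 / 2 - Complex.I * t) / 2) *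
              (X : ℂ) ^ (1 / 2 - Complex.I * t))‖ ≤
        M * (X ^ (s - 1) * Y + X ^ (-s) * Y + Y)) ∧
    -- (ii) real `t ≠ 0`, uniformly away from zero
    (∀ δ C : ℝ, 0 < δ → 0 < C → ∃ M : ℝ, ∀ X Y t : ℝ,
      2 ≤ X → 0 < Y → Y ≤ C * X → δ ≤ |t| →
      ‖huber t (fPlus X Y)‖ ≤
        M * (X ^ (1 / 2 : ℝ) *
          min (|t| ^ (-(1 / 2) : ℝ)) (|t| ^ (-(3 / 2) : ℝ) * (X / Y)))) ∧
    -- (iii) oscillating main terms whose coefficients depend only on `t` and `X / Y`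
    (∃ a b : ℝ → ℝ → ℂ, ∀ δ c C : ℝ, 0 < δ → 0 < c → 0 < C → ∃ M : ℝ, ∀ X Y t : ℝ,
      2 ≤ X → c * X ^ (1 / 2 : ℝ) ≤ Y → Y ≤ C * X → δ ≤ |t| → |t| ≤ X ^ 2 / Y ^ 2 →
      ‖huber t (fPlus X Y) -
          (a t (X / Y) * (X : ℂ) ^ (1 / 2 + Complex.I * t) +
            b t (X / Y) * (X : ℂ) ^ (1 / 2 - Complex.I * t))‖ ≤ M * |t| ^ (-(3 / 2) : ℝ) ∧
      ‖a t (X / Y)‖ ≤ M * min (|t| ^ (-(1 / 2) : ℝ)) (|t| ^ (-(3 / 2) : ℝ) * (X / Y)) ∧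
      ‖b t (X / Y)‖ ≤ M * min (|t| ^ (-(1 / 2) : ℝ)) (|t| ^ (-(3 / 2) : ℝ) * (X / Y))) ∧
    -- (iv) `t = 0`
    (∀ C : ℝ, 0 < C → ∃ M : ℝ, ∀ X Y : ℝ, 2 ≤ X → 0 < Y → Y ≤ C * X →
      ‖huber 0 (fPlus X Y)‖ ≤ M * (X ^ (1 / 2 : ℝ) * Real.log X)) := by
  refine ⟨fun δ c C hδ hc _ => ?_, fun δ C hδ hC => exists_norm_huber_bound hδ hC,
    exists_huber_oscillation, fun C hC => exists_norm_huber_zero_bound hC⟩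
  obtain ⟨M, hM⟩ := exists_huber_real_asymptotics hδ hc
  exact ⟨M, fun X Y s t hX hY _ hs hs1 ht => hM X Y s t hX hY hs hs1 ht⟩
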